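/- Let $r>0$, $d\in\mathbb N$, and let $g$ be a function holomorphic in the strip $\{|\Im z|<r\}$ with $\sup_{|w|<r}\int_{\mathbb R}|g(v+iw)|\,dv<\infty$ whose restriction to $\mathbb R$ is a probability density with zero mean and finite second moment. For real $\lambda$ let $H_\omega$ be the Anderson Hamiltonian on $\ell^2(\mathbb Z^d)$, $$(H_\omega\psi)(x)=\lambda\sum_{|y-x|=1}\psi(y)+V_\omega(x)\psi(x),$$ where the $V_\omega(x)$, $x\in\mathbb Z^d$, are independent with common law $g(v)\,dv$; let $\mathbb P$ be their joint law. For a family $A=(A_\omega)$ of bounded operators put $\mathcal T(A)=\int\langle 0|A_\omega|0\rangle\,d\mathbb P(\omega)$. The density of states is the density of the Lebesgue--Stieltjes measure of $\mathcal N(E)=\mathcal T(\chi(H\le E))$. With the position operators $R_\nu$ and $\partial_\nu H=i[R_\nu,H]$, the current-current correlation measure is the positive matrix-valued measure $(m_{\nu,\nu'})_{1\le\nu,\nu'\le d}$ on $\mathbb R^2$ determined by $$\mathcal T\big(f(H)\,\partial_\nu H\,f'(H)\,\partial_{\nu'}H\big)=\int_{\mathbb R^2}f(E)f'(E')\,m_{\nu,\nu'}(dE,dE'),\qquad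 f,f'\in C_0(\mathbb R).$$ There is a constant $0<a_2<\infty$ such that for every $\epsilon\in(0,r)$ there is $\lambda_{r,\epsilon}>0$ such that for all real $\lambda$ with $|\lambda|<\lambda_{r,\epsilon}$ the following hold. (The constant $a_2$ depends only on $r,g,d$, and $\lambda_{r,\epsilon}$ only on $r,g,d,\epsilon$.) 1. The density of states exists and extends to a holomorphic function in the strip $\{|\Im z|<r-\epsilon\}$. 2. The measure $m$ exists, and on $\mathbb R^2\setminus\{(E,E'):|E-E'|\le a_2|\lambda|\}$ each $m_{\nu,\nu'}$ has a density with respect to Lebesgue measure that is real analytic in $(E,E')$ there. -/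

import Mathlib

open MeasureTheory Set
open scoped ENNReal ZeroAtInfty ComplexOrder

noncomputable section

namespace Anderson

/-! ### Functional calculus of a self-adjoint operator, through its Cayley transform -/

section Abstract

variable {E : Type*} [NormedAddCommGroup E] [InnerProductSpace ℂ E]

/-- `R` is the bounded operator `(T - z)⁻¹`: it maps into the domain of `T` and is a two-sided
inverse of `T - z`. -/
def IsResolventAt (T : E →ₗ.[ℂ] E) (z : ℂ) (R : E →L[ℂ] E) : Prop :=
  (∀ φ : E, ∃ h : R φ ∈ T.domain, T ⟨R φ, h⟩ - z • R φ = φ) ∧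
    ∀ ψ : T.domain, R (T ψ - z • (ψ : E)) = ψ

theorem IsResolventAt.unique {T : E →ₗ.[ℂ] E} {z : ℂ} {R S : E →L[ℂ] E}
    (hR : IsResolventAt T z R) (hS : IsResolventAt T z S) : R = S := by
  ext φ
  obtain ⟨h, hφ⟩ := hS.1 φ
  have := hR.2 ⟨S φ, h⟩
  simpa [hφ] using this

open Classical in
/-- The resolvent `(T - z)⁻¹` (zero if `z` is not in the resolvent set of `T`). -/
def resolventAt (T : E →ₗ.[ℂ] E) (z : ℂ) : E →L[ℂ] E :=
  if h : ∃ R, IsResolventAt T z R then h.choose else 0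

/-- The Cayley transform `(T - i) (T + i)⁻¹ = 1 - 2 i (T + i)⁻¹`. -/
def cayley (T : E →ₗ.[ℂ] E) : E →L[ℂ] E :=
  1 - (2 * Complex.I) • resolventAt T (-Complex.I)

/-- The function on the unit circle that corresponds to `f` on the line under the Cayley map
`x ↦ w = (x - i) / (x + i)`, whose inverse is `w ↦ i (1 + w) / (1 - w)`; the point at infinity
`w = 1` gets the value `0`. -/
def onCircle (f : C₀(ℝ, ℂ)) (w : ℂ) : ℂ :=
  if w = 1 then 0 else f (Complex.I * (1 + w) / (1 - w)).re

/-- `f(T)` for a self-adjoint operator `T` and a continuous function `f` vanishing at infinity: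
the continuous functional calculus of the (unitary) Cayley transform. -/
def funCalc [CompleteSpace E] (T : E →ₗ.[ℂ] E) (f : C₀(ℝ, ℂ)) : E →L[ℂ] E :=
  cfc (onCircle f) (cayley T)

/-- `μ` is the spectral measure of `T` at the vector `φ`: `⟨φ, f(T) φ⟩ = ∫ f dμ`. -/
def IsSpectralMeasure [CompleteSpace E] (T : E →ₗ.[ℂ] E) (φ : E) (μ : Measure ℝ) : Prop :=
  IsFiniteMeasure μ ∧ ∀ f : C₀(ℝ, ℂ), inner ℂ φ (funCalc T f φ) = ∫ x, f x ∂μ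

open Classical in
/-- The spectral measure `B ↦ ⟨φ, χ(T ∈ B) φ⟩` of `T` at `φ`. -/
def spectralMeasure [CompleteSpace E] (T : E →ₗ.[ℂ] E) (φ : E) : Measure ℝ :=
  if h : ∃ μ, IsSpectralMeasure T φ μ then h.choose else 0

end Abstract

/-! ### The Anderson Hamiltonian on `ℓ²(ℤᵈ)` -/

/-- The lattice `ℤᵈ`. -/
abbrev Site (d : ℕ) : Type := Fin d → ℤ

/-- The Hilbert space `ℓ²(ℤᵈ)`. -/
abbrev Hilb (d : ℕ) : Type := lp (fun _ : Site d => ℂ) 2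

/-- The `j`-th unit vector of `ℤᵈ`. -/
def unitVec {d : ℕ} (j : Fin d) : Site d := Pi.single j 1

/-- `ψ ↦ (x ↦ λ ∑_{|y - x| = 1} ψ(y) + V(x) ψ(x))` on arbitrary functions; the neighbours of `x`
are the points `x ± e_j`. -/
def andersonAction {d : ℕ} (lam : ℝ) (V : Site d → ℝ) (ψ : Site d → ℂ) (x : Site d) : ℂ :=
  lam * ∑ j : Fin d, (ψ (x + unitVec j) + ψ (x - unitVec j)) + V x * ψ x

theorem andersonAction_add {d : ℕ} (lam : ℝ) (V : Site d → ℝ) (ψ φ : Site d → ℂ) :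
    andersonAction lam V (ψ + φ) = andersonAction lam V ψ + andersonAction lam V φ := by
  funext x
  simp only [andersonAction, Pi.add_apply, Finset.sum_add_distrib]
  ring

theorem andersonAction_smul {d : ℕ} (lam : ℝ) (V : Site d → ℝ) (c : ℂ) (ψ : Site d → ℂ) :
    andersonAction lam V (c • ψ) = c • andersonAction lam V ψ := by
  funext x
  simp only [andersonAction, Pi.smul_apply, smul_eq_mul, ← mul_add, ← Finset.mul_sum]
  ring

/-- The Anderson Hamiltonian with potential `V`, on its maximal domain in `ℓ²(ℤᵈ)`. -/
def hamiltonian {d : ℕ} (lam : ℝ) (V : Site d → ℝ) : Hilb d →ₗ.[ℂ] Hilb d where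
  domain :=
    { carrier := {ψ | Memℓp (andersonAction lam V ψ) 2}
      add_mem' := by
        intro ψ φ hψ hφ
        simp only [mem_ofPred_eq, lp.coeFn_add, andersonAction_add] at *
        exact hψ.add hφ
      zero_mem' := by
        have h : andersonAction lam V ((0 : Hilb d) : Site d → ℂ) = 0 := by
          funext x
          simp [andersonAction]
        simp only [mem_ofPred_eq, h]
        exact zero_memℓp
      smul_mem' := by
        intro c ψ hψ
        simp only [mem_ofPred_eq, lp.coeFn_smul, andersonAction_smul] at *
        exact hψ.const_smul c }
  toFun :=
    { toFun := fun ψ => ⟨andersonAction lam V (ψ : Hilb d), ψ.2⟩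
      map_add' := fun ψ φ => Subtype.ext (andersonAction_add lam V _ _)
      map_smul' := fun c ψ => Subtype.ext (andersonAction_smul lam V c _) }

/-- The unitary shift `(S_a ψ)(x) = ψ(x + a)`. -/
def shift {d : ℕ} (a : Site d) : Hilb d →L[ℂ] Hilb d :=
  LinearMap.mkContinuous
    { toFun := fun ψ => ⟨fun x => ψ (x + a), by
        have h := (memℓp_gen_iff (by norm_num)).1 (lp.memℓp ψ)
        refine (memℓp_gen_iff (by norm_num)).2 ?_
        exact h.comp_injective (add_left_injective a)⟩
      map_add' := fun _ _ => rfl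
      map_smul' := fun _ _ => rfl } 1 (by
    intro ψ
    refine le_of_eq ?_
    rw [one_mul, lp.norm_eq_tsum_rpow (by norm_num), lp.norm_eq_tsum_rpow (by norm_num)]
    congr 1
    exact (Equiv.addRight a).tsum_eq (fun x => ‖ψ x‖ ^ (2 : ℝ≥0∞).toReal))

@[simp] theorem shift_apply {d : ℕ} (a : Site d) (ψ : Hilb d) (x : Site d) :
    shift a ψ x = ψ (x + a) := rfl

/-- The velocity `∂_ν H = i [R_ν, H]`, as a bounded operator; `(∂_ν H ψ)(x)` is
`i λ (ψ(x - e_ν) - ψ(x + e_ν))`. That this is the commutator with the position operator is the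
next theorem. -/
def velocity {d : ℕ} (lam : ℝ) (ν : Fin d) : Hilb d →L[ℂ] Hilb d :=
  (Complex.I * lam) • (shift (-unitVec ν) - shift (unitVec ν))

/-- `∂_ν H = i (R_ν H - H R_ν)`, where `R_ν` is multiplication by the coordinate `x_ν`. -/
theorem velocity_eq_commutator {d : ℕ} (lam : ℝ) (V : Site d → ℝ) (ν : Fin d) (ψ : Hilb d)
    (x : Site d) :
    velocity lam ν ψ x =
      Complex.I * ((x ν : ℂ) * andersonAction lam V ψ x -
        andersonAction lam V (fun y => (y ν : ℂ) * ψ y) x) := by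
  have h1 : ∀ j : Fin d, ((unitVec j ν : ℤ) : ℂ) = if j = ν then 1 else 0 := by
    intro j
    by_cases h : j = ν
    · subst h; simp [unitVec]
    · simp [unitVec, h, Ne.symm h]
  have h2 : ∑ j : Fin d, ((((x + unitVec j) ν : ℤ) : ℂ) * ψ (x + unitVec j) +
        (((x - unitVec j) ν : ℤ) : ℂ) * ψ (x - unitVec j)) =
      (x ν : ℂ) * ∑ j : Fin d, (ψ (x + unitVec j) + ψ (x - unitVec j)) +
        (ψ (x + unitVec ν) - ψ (x - unitVec ν)) := by
    have h3 : ∀ j : Fin d, ((((x + unitVec j) ν : ℤ) : ℂ) * ψ (x + unitVec j) +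
        (((x - unitVec j) ν : ℤ) : ℂ) * ψ (x - unitVec j)) =
        (x ν : ℂ) * (ψ (x + unitVec j) + ψ (x - unitVec j)) +
          if j = ν then ψ (x + unitVec j) - ψ (x - unitVec j) else 0 := by
      intro j
      simp only [Pi.add_apply, Pi.sub_apply, Int.cast_add, Int.cast_sub, h1]
      split_ifs <;> ring
    rw [Finset.sum_congr rfl fun j _ => h3 j, Finset.sum_add_distrib, Finset.mul_sum,
      Finset.sum_ite_eq', if_pos (Finset.mem_univ ν)]
  simp only [andersonAction]
  rw [h2]
  simp only [velocity, smul_apply, sub_apply,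
    lp.coeFn_smul, lp.coeFn_sub, Pi.smul_apply, Pi.sub_apply, shift_apply, smul_eq_mul,
    ← sub_eq_add_neg]
  ring

/-- The basis vector `|0⟩` of `ℓ²(ℤᵈ)`. -/
def origin (d : ℕ) : Hilb d := lp.single 2 0 1

/-! ### The disorder -/

/-- The strip `|Im z| < r`. -/
def strip (r : ℝ) : Set ℂ := {z | |z.im| < r}

/-- The single-site densities: `g` is a holomorphic function on the strip `|Im z| < r` (the
continuation of the density), with `sup_{|w| < r} ∫ |g(v + i w)| dv < ∞`, whose restriction to the
real line is a probability density with zero mean and a finite second moment. -/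
structure IsSiteDensity (r : ℝ) (g : ℂ → ℂ) : Prop where
  holomorphic : DifferentiableOn ℂ g (strip r)
  bounded : ⨆ w ∈ Ioo (-r) r, ∫⁻ v : ℝ, ‖g (v + w * Complex.I)‖ₑ < ∞
  real : ∀ v : ℝ, (g v).im = 0
  nonneg : ∀ v : ℝ, 0 ≤ (g v).re
  total : ∫ v : ℝ, (g v).re = 1
  mean_integrable : Integrable fun v : ℝ => (g v).re * v
  mean : ∫ v : ℝ, (g v).re * v = 0
  second_moment : Integrable fun v : ℝ => (g v).re * v ^ 2

/-- The single-site distribution `g(v) dv`. -/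
def siteMeasure (g : ℂ → ℂ) : Measure ℝ :=
  volume.withDensity fun v : ℝ => ENNReal.ofReal (g v).re

/-- The law `ℙ` of the potential: the infinite product of `g(v) dv` over the sites of `ℤᵈ`. -/
def disorder (d : ℕ) (g : ℂ → ℂ) : Measure (Site d → ℝ) :=
  Measure.infinitePi fun _ : Site d => siteMeasure g

/-- The trace per unit volume `∫ ⟨0| A_ω |0⟩ dℙ(ω)` of a family of bounded operators. -/
def traceP (d : ℕ) (g : ℂ → ℂ) (A : (Site d → ℝ) → (Hilb d →L[ℂ] Hilb d)) : ℂ :=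
  ∫ V, inner ℂ (origin d) (A V (origin d)) ∂(disorder d g)

/-! ### Density of states and current-current correlation -/

/-- The integrated density of states: the trace per unit volume of the spectral projection
`χ(H ≤ E)`, that is, `∫ ⟨0| χ(H_ω ≤ E) |0⟩ dℙ(ω)`. -/
def ids (d : ℕ) (g : ℂ → ℂ) (lam : ℝ) (E : ℝ) : ℝ :=
  ∫ V, (spectralMeasure (hamiltonian lam V) (origin d)).real (Iic E) ∂(disorder d g)

/-- `ρ` is the density of states: the Lebesgue-Stieltjes measure of the integrated density of states
is `ρ(E) dE`. -/
def IsDensityOfStates (d : ℕ) (g : ℂ → ℂ) (lam : ℝ) (ρ : ℝ → ℝ) : Prop :=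
  Integrable ρ ∧ (∀ E, 0 ≤ ρ E) ∧ ∀ E, ids d g lam E = ∫ x in Iic E, ρ x

/-- `m` is the current-current correlation measure: the positive matrix-valued measure on `ℝ²` with
`∫ f(E) f'(E') m_{ν,ν'}(dE, dE')` equal to the trace per unit volume of
`f(H) ∂_ν H f'(H) ∂_{ν'} H`. -/
def IsCurrentCorrelation (d : ℕ) (g : ℂ → ℂ) (lam : ℝ)
    (m : Fin d → Fin d → ComplexMeasure (ℝ × ℝ)) : Prop :=
  (∀ B : Set (ℝ × ℝ), MeasurableSet B → (Matrix.of fun ν ν' => m ν ν' B).PosSemidef) ∧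
    ∀ (ν ν' : Fin d) (f f' : C₀(ℝ, ℂ)),
      traceP d g (fun V => funCalc (hamiltonian lam V) f * velocity lam ν *
          funCalc (hamiltonian lam V) f' * velocity lam ν') =
        ∫ᵛ p, f p.1 * f' p.2 ∂[ContinuousLinearMap.mul ℝ ℂ; m ν ν']

/-- The complex measure `m` has, on the measurable set `U`, the density `k` with respect to Lebesgue
measure. -/
def HasDensityOn (m : ComplexMeasure (ℝ × ℝ)) (U : Set (ℝ × ℝ)) (k : ℝ × ℝ → ℂ) : Prop :=
  IntegrableOn k U ∧ ∀ B : Set (ℝ × ℝ), MeasurableSet B → B ⊆ U → m B = ∫ p in B, k p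

end Anderson

end

/-! # Analytic densities for the Anderson model at weak hopping

For `|Im z| > 2 d |λ|` the resolvent of `H` is a sum over nearest-neighbour walks of products of the
single-site factors `(V x - z)⁻¹` (`IsResolventAt.hasSum_walkTerm`). The average of such a product
over the disorder is a product over the visited sites of integrals of `g` against powers of
`(v - z)⁻¹`, and in every one of them the real line can be replaced by another contour in the strip
of analyticity of `g` (`IsSiteDensity.integral_list_prod`). The deformed integrals do not notice the
real axis: they make sense for all `z` that stay at a distance `δ` from the contour, and there the
sum over walks still converges if `2 d |λ| C < δ`, where `C` bounds the total variation of `g(z) dz`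
along the contour. In this way averages that are defined for non-real spectral parameters continue
analytically to the real axis and beyond.

For the density of states there is one spectral parameter. The contour is a line at height almost
`∓r`, so that `𝒯((H - z)⁻¹)` continues from each half-plane to the strip of width `r - ε`; the jump
between the two continuations is the density (`density_of_continuation`).

For the correlation measure two spectral parameters, `z` near `E` and `z'` near `E'`, approach the
real axis from independent sides. If `E` and `E'` are far apart compared with `|λ|`, the contour can
pass on the required side of each of them, since it has room to change sides half-way
(`exists_continuation_near`). The continuation is holomorphic in `z` and in `z'`, hence jointly
analytic (`analyticAt_of_separately`), and the Poisson integrals of the measure converge to the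
combination of boundary values over the four sides, which is a real analytic density
(`exists_analytic_density`).

The measures are obtained from positivity. The forms `(f, f') ↦ 𝒯(f(H) A f'(H) A*)` are nonnegative
on pairs of nonnegative functions, because the trace per unit volume is cyclic, and
therefore given by measures on the plane (`exists_measure_of_bilinear`). Polarization turns them
into the complex measures `m ν ν'`, which are determined by their integrals against products
(`eq_combination_of_integral_eq`).
-/

noncomputable section

namespace Anderson

open Complex Filter Topology
open scoped CompactlySupported

/-! ### Integrals of holomorphic functions over contours in a strip -/

/-- `h` is holomorphic in the strip `|Im z| < r`, and its `L¹` norms over the horizontal lines of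
the strip are bounded by `K`. -/
structure StripL1 (r : ℝ) (h : ℂ → ℂ) (K : ℝ) : Prop where
  hol : DifferentiableOn ℂ h (strip r)
  int : ∀ w ∈ Ioo (-r) r, Integrable fun v : ℝ => h (v + w * I)
  bound : ∀ w ∈ Ioo (-r) r, ∫ v : ℝ, ‖h (v + w * I)‖ ≤ K

theorem isOpen_strip (r : ℝ) : IsOpen (strip r) :=
  isOpen_lt (by fun_prop) continuous_const

theorem mem_strip_line {r w : ℝ} (hw : w ∈ Ioo (-r) r) (v : ℝ) : (v + w * I : ℂ) ∈ strip r := by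
  simpa [strip, abs_lt] using hw

theorem IsSiteDensity.stripL1 {r : ℝ} {g : ℂ → ℂ} (hg : IsSiteDensity r g) :
    ∃ K, StripL1 r g K := by
  have hcont : ∀ w ∈ Ioo (-r) r, Continuous fun v : ℝ => g (v + w * I) := fun w hw =>
    hg.holomorphic.continuousOn.comp_continuous (by fun_prop) fun v => mem_strip_line hw v
  have hle : ∀ w ∈ Ioo (-r) r, ∫⁻ v : ℝ, ‖g (v + w * I)‖ₑ ≤
      ⨆ w ∈ Ioo (-r) r, ∫⁻ v : ℝ, ‖g (v + w * I)‖ₑ := fun w hw =>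
    le_biSup (fun w : ℝ => ∫⁻ v : ℝ, ‖g (v + w * I)‖ₑ) hw
  refine ⟨(⨆ w ∈ Ioo (-r) r, ∫⁻ v : ℝ, ‖g (v + w * I)‖ₑ).toReal, hg.holomorphic, fun w hw => ?_,
    fun w hw => ?_⟩
  · exact ⟨(hcont w hw).aestronglyMeasurable, (hle w hw).trans_lt hg.bounded⟩
  · rw [integral_norm_eq_lintegral_enorm (hcont w hw).aestronglyMeasurable]
    exact ENNReal.toReal_mono hg.bounded.ne (hle w hw)

theorem StripL1.nonneg {r K : ℝ} {h : ℂ → ℂ} (hr : 0 < r) (hh : StripL1 r h K) : 0 ≤ K :=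
  (integral_nonneg fun _ => norm_nonneg _).trans (hh.bound 0 ⟨by linarith, hr⟩)

theorem StripL1.mul_bounded {r K B : ℝ} {h F : ℂ → ℂ} (hr : 0 < r) (hh : StripL1 r h K)
    (hF : DifferentiableOn ℂ F (strip r)) (hB : ∀ z ∈ strip r, ‖F z‖ ≤ B) :
    StripL1 r (fun z => h z * F z) (K * B) := by
  have hB0 : 0 ≤ B := (norm_nonneg _).trans (hB 0 (by simpa [strip] using hr))
  have hm : ∀ w ∈ Ioo (-r) r, AEStronglyMeasurable (fun v : ℝ => F (v + w * I)) volume :=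
    fun w hw => (hF.continuousOn.comp_continuous (by fun_prop)
      fun v => mem_strip_line hw v).aestronglyMeasurable
  have hi : ∀ w ∈ Ioo (-r) r, Integrable fun v : ℝ => h (v + w * I) * F (v + w * I) :=
    fun w hw => (hh.int w hw).mul_bdd (hm w hw) (ae_of_all _ fun v => hB _ (mem_strip_line hw v))
  refine ⟨hh.hol.mul hF, hi, fun w hw => ?_⟩
  calc ∫ v : ℝ, ‖h (v + w * I) * F (v + w * I)‖ ≤ ∫ v : ℝ, ‖h (v + w * I)‖ * B := by
        refine integral_mono (hi w hw).norm ((hh.int w hw).norm.mul_const B) fun v => ?_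
        simp only [norm_mul]
        exact mul_le_mul_of_nonneg_left (hB _ (mem_strip_line hw v)) (norm_nonneg _)
    _ = (∫ v : ℝ, ‖h (v + w * I)‖) * B := integral_mul_const _ _
    _ ≤ K * B := mul_le_mul_of_nonneg_right (hh.bound w hw) hB0

theorem uIcc_zero_subset {r a : ℝ} (ha : a ∈ Ioo (-r) r) : uIcc 0 a ⊆ Ioo (-r) r := by
  intro y hy
  rcases mem_uIcc.1 hy with h | h <;> constructor <;> linarith [ha.1, ha.2, h.1, h.2]

/-- The vertical integrals of a function of class `StripL1` are an integrable function of the real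
part. -/
theorem StripL1.integrable_vertical {r K : ℝ} {h : ℂ → ℂ} (hh : StripL1 r h K) {a : ℝ}
    (ha : a ∈ Ioo (-r) r) : Integrable fun x : ℝ => ∫ y in (0 : ℝ)..a, h (x + y * I) := by
  have hsub := uIcc_zero_subset ha
  have hms : AEStronglyMeasurable (fun p : ℝ × ℝ => h (p.1 + p.2 * I))
      (volume.prod (volume.restrict (uIoc 0 a))) := by
    have : (volume : Measure ℝ).prod (volume.restrict (uIoc 0 a)) =
        (volume.prod volume).restrict (univ ×ˢ uIoc 0 a) := by
      rw [← Measure.prod_restrict, Measure.restrict_univ]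
    rw [this]
    refine ContinuousOn.aestronglyMeasurable ?_ (MeasurableSet.univ.prod measurableSet_uIoc)
    refine hh.hol.continuousOn.comp (by fun_prop) fun p hp => ?_
    exact mem_strip_line (hsub (uIoc_subset_uIcc hp.2)) _
  have hint : Integrable (fun p : ℝ × ℝ => h (p.1 + p.2 * I))
      (volume.prod (volume.restrict (uIoc 0 a))) := by
    rw [integrable_prod_iff' hms]
    have hmem : ∀ᵐ y ∂volume.restrict (uIoc 0 a), y ∈ Ioo (-r) r :=
      (ae_restrict_mem measurableSet_uIoc).mono fun y hy => hsub (uIoc_subset_uIcc hy)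
    refine ⟨hmem.mono fun y hy => hh.int y hy, ?_⟩
    have : IsFiniteMeasure (volume.restrict (uIoc 0 a)) := ⟨by simp [uIoc]⟩
    refine Integrable.mono' (integrable_const K) hms.norm.prod_swap.integral_prod_right' ?_
    filter_upwards [hmem] with y hy
    rw [Real.norm_of_nonneg (integral_nonneg fun _ => norm_nonneg _)]
    exact hh.bound y hy
  simp only [intervalIntegral.intervalIntegral_eq_integral_uIoc]
  exact hint.integral_prod_left.smul _

theorem StripL1.rect {r K : ℝ} {h : ℂ → ℂ} (hh : StripL1 r h K) {a : ℝ}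
    (ha : a ∈ Ioo (-r) r) (S T : ℝ) :
    (∫ x in S..T, h x) - (∫ x in S..T, h (x + a * I)) + I * (∫ y in (0 : ℝ)..a, h (T + y * I)) -
      I * (∫ y in (0 : ℝ)..a, h (S + y * I)) = 0 := by
  have := integral_boundary_rect_eq_zero_of_differentiableOn h (S : ℂ) (T + a * I) (by
    refine hh.hol.mono fun z hz => ?_
    have hz2 := hz.2
    simp only [ofReal_im, add_im, mul_im, ofReal_re, I_im, mul_one, I_re, mul_zero, add_zero,
      zero_add] at hz2
    have := uIcc_zero_subset ha hz2
    simpa [strip, abs_lt] using this)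
  simpa using this

theorem eq_zero_of_tendsto_atTop {v : ℝ → ℂ} (hv : Integrable v) {c : ℂ}
    (hc : Tendsto v atTop (𝓝 c)) : c = 0 := by
  refine IntegrableAtFilter.eq_zero_of_tendsto (μ := volume) (f := v) (l := atTop)
    ⟨univ, univ_mem, hv.integrableOn⟩ (fun s hs => ?_) hc
  obtain ⟨A, hA⟩ := mem_atTop_sets.1 hs
  exact top_le_iff.1 (Real.volume_Ici (a := A) ▸ measure_mono hA)

theorem eq_zero_of_tendsto_atBot {v : ℝ → ℂ} (hv : Integrable v) {c : ℂ}
    (hc : Tendsto v atBot (𝓝 c)) : c = 0 := by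
  refine eq_zero_of_tendsto_atTop hv.comp_neg (hc.comp tendsto_neg_atTop_atBot)

theorem StripL1.int_zero {r K : ℝ} {h : ℂ → ℂ} (hr : 0 < r) (hh : StripL1 r h K) :
    Integrable fun v : ℝ => h v := by
  simpa using hh.int 0 ⟨by linarith, hr⟩

theorem StripL1.integral_Iic {r K : ℝ} {h : ℂ → ℂ} (hr : 0 < r) (hh : StripL1 r h K) {a : ℝ}
    (ha : a ∈ Ioo (-r) r) (M : ℝ) :
    ∫ x in Iic M, h x = (∫ x in Iic M, h (x + a * I)) - I * ∫ y in (0 : ℝ)..a, h (M + y * I) := by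
  have h1 : Tendsto (fun S : ℝ => ∫ x in S..M, h x) atBot (𝓝 (∫ x in Iic M, h x)) :=
    intervalIntegral_tendsto_integral_Iic M (hh.int_zero hr).integrableOn tendsto_id
  have h2 : Tendsto (fun S : ℝ => ∫ x in S..M, h (x + a * I)) atBot
      (𝓝 (∫ x in Iic M, h (x + a * I))) :=
    intervalIntegral_tendsto_integral_Iic M (hh.int a ha).integrableOn tendsto_id
  have h3 : ∀ S : ℝ, I * (∫ y in (0 : ℝ)..a, h (S + y * I)) =
      (∫ x in S..M, h x) - (∫ x in S..M, h (x + a * I)) + I * ∫ y in (0 : ℝ)..a, h (M + y * I) :=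
    fun S => (sub_eq_zero.1 (hh.rect ha S M)).symm
  have h4 := eq_zero_of_tendsto_atBot ((hh.integrable_vertical ha).const_mul I)
    (((h1.sub h2).add_const _).congr fun S => (h3 S).symm)
  linear_combination h4

theorem StripL1.integral_Ioi {r K : ℝ} {h : ℂ → ℂ} (hr : 0 < r) (hh : StripL1 r h K) {a : ℝ}
    (ha : a ∈ Ioo (-r) r) (M : ℝ) :
    ∫ x in Ioi M, h x = (∫ x in Ioi M, h (x + a * I)) + I * ∫ y in (0 : ℝ)..a, h (M + y * I) := by
  have h1 : Tendsto (fun T : ℝ => ∫ x in M..T, h x) atTop (𝓝 (∫ x in Ioi M, h x)) :=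
    intervalIntegral_tendsto_integral_Ioi M (hh.int_zero hr).integrableOn tendsto_id
  have h2 : Tendsto (fun T : ℝ => ∫ x in M..T, h (x + a * I)) atTop
      (𝓝 (∫ x in Ioi M, h (x + a * I))) :=
    intervalIntegral_tendsto_integral_Ioi M (hh.int a ha).integrableOn tendsto_id
  have h3 : ∀ T : ℝ, I * (∫ y in (0 : ℝ)..a, h (T + y * I)) =
      (∫ x in M..T, h (x + a * I)) - (∫ x in M..T, h x) + I * ∫ y in (0 : ℝ)..a, h (M + y * I) :=
    fun T => by linear_combination hh.rect ha M T
  have h4 := eq_zero_of_tendsto_atTop ((hh.integrable_vertical ha).const_mul I)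
    (((h2.sub h1).add_const _).congr fun S => (h3 S).symm)
  linear_combination -h4

theorem StripL1.intervalIntegrable_vertical {r K : ℝ} {h : ℂ → ℂ} (hh : StripL1 r h K) {a b : ℝ}
    (ha : a ∈ Ioo (-r) r) (hb : b ∈ Ioo (-r) r) (M : ℝ) :
    IntervalIntegrable (fun y : ℝ => h (M + y * I)) volume a b := by
  refine ContinuousOn.intervalIntegrable ?_
  refine hh.hol.continuousOn.comp (by fun_prop) fun y hy => mem_strip_line ?_ M
  rcases mem_uIcc.1 hy with h | h <;> constructor <;> linarith [ha.1, ha.2, hb.1, hb.2, h.1, h.2]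

/-- Deformation of the real line to the contour that runs at height `a` up to `M`, from there
vertically to height `b`, and then to infinity at height `b`. -/
theorem StripL1.integral_eq_contour {r K : ℝ} {h : ℂ → ℂ} (hr : 0 < r) (hh : StripL1 r h K)
    {a b : ℝ} (ha : a ∈ Ioo (-r) r) (hb : b ∈ Ioo (-r) r) (M : ℝ) :
    ∫ x : ℝ, h x = (∫ x in Iic M, h (x + a * I)) + I * (∫ y in a..b, h (M + y * I)) +
      ∫ x in Ioi M, h (x + b * I) := by
  have h0 : (0 : ℝ) ∈ Ioo (-r) r := ⟨by linarith, hr⟩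
  rw [← intervalIntegral.integral_Iic_add_Ioi (hh.int_zero hr).integrableOn
    (hh.int_zero hr).integrableOn, hh.integral_Iic hr ha M, hh.integral_Ioi hr hb M]
  have := intervalIntegral.integral_add_adjacent_intervals
    (hh.intervalIntegrable_vertical h0 ha M) (hh.intervalIntegrable_vertical ha hb M)
  linear_combination -I * this

/-- The mean value inequality on a disc, in terms of circle integrals of the norm. -/
theorem enorm_le_lintegral_circle {f : ℂ → ℂ} {c : ℂ} {R : ℝ} (hR : 0 ≤ R)
    (hf : DifferentiableOn ℂ f (Metric.closedBall c R)) :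
    ENNReal.ofReal (2 * Real.pi) * ‖f c‖ₑ ≤
      ∫⁻ θ in Ioo (-Real.pi) Real.pi, ‖f (circleMap c R θ)‖ₑ := by
  have h1 : Real.circleAverage f c R = f c :=
    DiffContOnCl.circleAverage (by
      rw [abs_of_nonneg hR]
      exact (hf.diffContOnCl_ball subset_rfl))
  have h2 : ∫ θ in (-Real.pi)..Real.pi, f (circleMap c R θ) =
      ∫ θ in (0)..(2 * Real.pi), f (circleMap c R θ) := by
    have := ((periodic_circleMap c R).comp f).intervalIntegral_add_eq (-Real.pi) 0
    simpa [two_mul] using this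
  rw [Real.circleAverage_def, ← h2, intervalIntegral.integral_of_le (by linarith [Real.pi_pos]),
    integral_Ioc_eq_integral_Ioo] at h1
  rw [← h1, enorm_smul, ← mul_assoc, ← ofReal_norm (((2 : ℝ) * Real.pi)⁻¹), norm_inv,
    Real.norm_of_nonneg (by positivity), ← ENNReal.ofReal_mul (by positivity),
    mul_inv_cancel₀ (by positivity), ENNReal.ofReal_one, one_mul]
  exact enorm_integral_le_lintegral_enorm _


theorem StripL1.measurable_indicator {r K : ℝ} {h : ℂ → ℂ} (hh : StripL1 r h K) :
    Measurable ((strip r).indicator h) := by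
  classical
  rw [← Set.piecewise_eq_indicator]
  exact hh.hol.continuousOn.measurable_piecewise continuousOn_const (isOpen_strip r).measurableSet

/-- A holomorphic function with bounded `L¹` norms on the lines of a strip is bounded on the strip
of half the width, by the mean value property on discs. -/
theorem StripL1.exists_bound {r K : ℝ} {h : ℂ → ℂ} (hr : 0 < r) (hh : StripL1 r h K) :
    ∃ B, 0 ≤ B ∧ ∀ z : ℂ, |z.im| ≤ r / 2 → ‖h z‖ ≤ B := by
  have hK := hh.nonneg hr
  set R := r / 4 with hR
  have hRpos : 0 < R := by positivity
  refine ⟨2 * R * K / (Real.pi * R ^ 2), by positivity, fun z hz => ?_⟩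
  set G : ℂ → ℂ := (strip r).indicator h
  have hG : Measurable G := hh.measurable_indicator
  set f : ℂ → ℝ≥0∞ := (Metric.ball 0 R).indicator fun u => ‖G (z + u)‖ₑ with hf
  have hfm : Measurable f := by
    refine Measurable.indicator ?_ measurableSet_ball
    exact (hG.comp (measurable_const_add z)).enorm
  have hball : ∀ u : ℂ, ‖u‖ < R → z + u ∈ strip r := by
    intro u hu
    have h1 := (abs_im_le_norm u).trans hu.le
    have h2 := abs_add_le z.im u.im
    simp only [strip, mem_ofPred_eq, add_im]
    linarith
  -- lower bound in polar coordinates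
  have hlow : ENNReal.ofReal (Real.pi * R ^ 2) * ‖h z‖ₑ ≤ ∫⁻ u, f u := by
    rw [← Complex.lintegral_comp_polarCoord_symm]
    have ht : polarCoord.target = Ioi (0 : ℝ) ×ˢ Ioo (-Real.pi) Real.pi := rfl
    rw [ht, Measure.volume_eq_prod, ← Measure.prod_restrict, lintegral_prod _ (by
      refine Measurable.aemeasurable ?_
      refine (ENNReal.measurable_ofReal.comp measurable_fst).smul (hfm.comp ?_)
      have : (fun p : ℝ × ℝ => Complex.polarCoord.symm p) =
          fun p : ℝ × ℝ => (p.1 * (Real.cos p.2 + Real.sin p.2 * I) : ℂ) := by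
        funext p; exact Complex.polarCoord_symm_apply p
      change Measurable (fun p : ℝ × ℝ => Complex.polarCoord.symm p)
      rw [this]
      fun_prop)]
    calc ENNReal.ofReal (Real.pi * R ^ 2) * ‖h z‖ₑ
        = ∫⁻ ρ in Ioo (0 : ℝ) R, ENNReal.ofReal ρ * (ENNReal.ofReal (2 * Real.pi) * ‖h z‖ₑ) := by
          rw [lintegral_mul_const _ (by fun_prop),
            ← ofReal_integral_eq_lintegral_ofReal (f := fun x : ℝ => x)]
          · rw [← integral_Ioc_eq_integral_Ioo, ← intervalIntegral.integral_of_le hRpos.le,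
              integral_id, ← mul_assoc, ← ENNReal.ofReal_mul (by
                rw [zero_pow two_ne_zero, sub_zero]; positivity)]
            congr 2; ring
          · exact (continuous_id.integrableOn_Icc).mono_set Ioo_subset_Icc_self
          · filter_upwards [ae_restrict_mem measurableSet_Ioo] with x hx using hx.1.le
      _ ≤ ∫⁻ ρ in Ioo (0 : ℝ) R, ∫⁻ θ in Ioo (-Real.pi) Real.pi,
            ENNReal.ofReal ρ • f (Complex.polarCoord.symm (ρ, θ)) := by
          refine setLIntegral_mono' measurableSet_Ioo fun ρ hρ => ?_
          have h1 := enorm_le_lintegral_circle (f := h) (c := z) hρ.1.le (hh.hol.mono (by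
            intro u hu
            have := hball (u - z) (by
              rw [mem_closedBall_iff_norm] at hu; exact hu.trans_lt hρ.2)
            simpa using this))
          simp only [smul_eq_mul]
          rw [lintegral_const_mul' _ _ ENNReal.ofReal_ne_top]
          gcongr
          refine h1.trans (lintegral_mono fun θ => ?_)
          have h2 : Complex.polarCoord.symm (ρ, θ) = circleMap 0 ρ θ := by
            rw [Complex.polarCoord_symm_apply]
            simp [circleMap, Complex.exp_mul_I]
          have h3 : ‖circleMap 0 ρ θ‖ < R := by
            simpa [abs_of_pos hρ.1] using hρ.2
          rw [h2, hf, indicator_of_mem (by simpa using h3)]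
          have h4 : z + circleMap 0 ρ θ = circleMap z ρ θ := by simp [circleMap]
          have h5 := hball _ h3
          rw [h4] at h5 ⊢
          simp only [G, indicator_of_mem h5]
          exact le_rfl
      _ ≤ _ := lintegral_mono_set Ioo_subset_Ioi_self
  -- upper bound in Cartesian coordinates
  have hup : ∫⁻ u, f u ≤ ENNReal.ofReal (2 * R * K) := by
    rw [← (Complex.volume_preserving_equiv_real_prod.symm).lintegral_comp_emb
      measurableEquivRealProd.symm.measurableEmbedding, Measure.volume_eq_prod, lintegral_prod_symm]
    swap
    · exact (hfm.comp measurableEquivRealProd.symm.measurable).aemeasurable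
    have h1 : ∀ y : ℝ, ∫⁻ x : ℝ, f (measurableEquivRealProd.symm (x, y)) ≤
        (Ioo (-R) R).indicator (fun _ => ENNReal.ofReal K) y := by
      intro y
      by_cases hy : y ∈ Ioo (-R) R
      · rw [indicator_of_mem hy]
        have hw : z.im + y ∈ Ioo (-r) r := by
          have := abs_le.1 hz
          constructor <;> linarith [hy.1, hy.2]
        calc ∫⁻ x : ℝ, f (measurableEquivRealProd.symm (x, y))
            ≤ ∫⁻ x : ℝ, ‖h ((z.re + x : ℝ) + (z.im + y : ℝ) * I)‖ₑ := by
              refine lintegral_mono fun x => ?_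
              refine (indicator_le_self _ _ _).trans ?_
              have : z + measurableEquivRealProd.symm (x, y) =
                  (z.re + x : ℝ) + (z.im + y : ℝ) * I := by
                apply Complex.ext <;> simp [measurableEquivRealProd]
              simp only [this, G, indicator_of_mem (mem_strip_line hw _)]
              exact le_rfl
          _ = ∫⁻ x : ℝ, ‖h (x + (z.im + y : ℝ) * I)‖ₑ :=
              lintegral_add_left_eq_self
                (fun x : ℝ => ‖h (x + (z.im + y : ℝ) * I)‖ₑ) z.re
          _ ≤ ENNReal.ofReal K := by
              rw [← ofReal_integral_norm_eq_lintegral_enorm (hh.int _ hw)]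
              exact ENNReal.ofReal_le_ofReal (hh.bound _ hw)
      · rw [indicator_of_notMem hy]
        refine le_of_eq ?_
        rw [lintegral_eq_zero_iff' (by
          exact (hfm.comp (measurableEquivRealProd.symm.measurable.comp
            (measurable_id.prodMk measurable_const))).aemeasurable)]
        refine ae_of_all _ fun x => indicator_of_notMem (fun hx => hy ?_) _
        have h2 := (abs_im_le_norm _).trans_lt (mem_ball_zero_iff.1 hx)
        have h3 : (measurableEquivRealProd.symm (x, y)).im = y := by
          simp [measurableEquivRealProd]
        rw [h3] at h2
        exact abs_lt.1 h2
    refine (lintegral_mono h1).trans ?_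
    rw [lintegral_indicator measurableSet_Ioo, lintegral_const, Measure.restrict_apply_univ,
      Real.volume_Ioo, mul_comm, ← ENNReal.ofReal_mul (by linarith)]
    exact le_of_eq (congrArg _ (by ring))
  have h1 := hlow.trans hup
  rw [← ofReal_norm, ← ENNReal.ofReal_mul (by positivity),
    ENNReal.ofReal_le_ofReal_iff (by positivity)] at h1
  rw [le_div_iff₀ (by positivity)]
  linarith

/-- A contour that can replace the real line in integrals of `g` against bounded holomorphic
functions on the strip of width `r`: it is parametrized by `γ`, and `w` is `g ∘ γ` times the
derivative of the parametrization. The total variation of `w` is at most `C`. -/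
structure IsDeformation (r : ℝ) (g : ℂ → ℂ) (C : ℝ) (γ w : ℝ → ℂ) : Prop where
  measurable : Measurable γ
  integrable : Integrable w
  bound : ∫ t, ‖w t‖ ≤ C
  repr : ∀ (F : ℂ → ℂ) (B : ℝ), DifferentiableOn ℂ F (strip r) → (∀ z ∈ strip r, ‖F z‖ ≤ B) →
    ∫ v : ℝ, g v * F v = ∫ t, w t * F (γ t)

/-- Parametrization of the contour at height `a` up to abscissa `M`, vertical from height `a` to
`b` at `M`, and at height `b` after that. The vertical part takes one unit of the parameter. -/
def stepContour (M a b t : ℝ) : ℂ :=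
  if t ≤ M then t + a * I else if t ≤ M + 1 then M + (a + (t - M) * (b - a)) * I
    else (t - 1) + b * I

/-- The density of `g(z) dz` along `stepContour`. -/
def stepWeight (g : ℂ → ℂ) (M a b t : ℝ) : ℂ :=
  g (stepContour M a b t) * if t ≤ M then 1 else if t ≤ M + 1 then (b - a) * I else 1

theorem integral_three_pieces {M : ℝ} {f f₁ f₂ f₃ : ℝ → ℂ} (h₁ : IntegrableOn f₁ (Iic M))
    (h₂ : IntegrableOn f₂ (Ioc M (M + 1))) (h₃ : IntegrableOn f₃ (Ioi (M + 1)))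
    (e₁ : EqOn f f₁ (Iic M)) (e₂ : EqOn f f₂ (Ioc M (M + 1))) (e₃ : EqOn f f₃ (Ioi (M + 1))) :
    Integrable f ∧
      ∫ t, f t = (∫ t in Iic M, f₁ t) + (∫ t in Ioc M (M + 1), f₂ t) + ∫ t in Ioi (M + 1), f₃ t := by
  have i₁ := h₁.congr_fun e₁.symm measurableSet_Iic
  have i₂ := h₂.congr_fun e₂.symm measurableSet_Ioc
  have i₃ := h₃.congr_fun e₃.symm measurableSet_Ioi
  have hu : Ioi M = Ioc M (M + 1) ∪ Ioi (M + 1) := (Ioc_union_Ioi_eq_Ioi (by linarith)).symm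
  have i₄ : IntegrableOn f (Ioi M) := by rw [hu]; exact i₂.union i₃
  have hd : Disjoint (Ioc M (M + 1)) (Ioi (M + 1)) :=
    Set.disjoint_left.2 fun x hx hx' => not_lt.2 hx.2 hx'
  refine ⟨?_, ?_⟩
  · rw [← integrableOn_univ, ← Iic_union_Ioi (a := M)]
    exact i₁.union i₄
  · rw [← intervalIntegral.integral_Iic_add_Ioi i₁ i₄, hu,
      setIntegral_union hd measurableSet_Ioi i₂ i₃, setIntegral_congr_fun measurableSet_Iic e₁,
      setIntegral_congr_fun measurableSet_Ioc e₂, setIntegral_congr_fun measurableSet_Ioi e₃,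
      add_assoc]

theorem integrableOn_Ioi_sub_one {f : ℝ → ℂ} {M : ℝ} (hf : IntegrableOn f (Ioi M)) :
    IntegrableOn (fun t => f (t - 1)) (Ioi (M + 1)) ∧
      ∫ t in Ioi (M + 1), f (t - 1) = ∫ t in Ioi M, f t := by
  have hmp := measurePreserving_sub_right (volume : Measure ℝ) (1 : ℝ)
  have hme := (MeasurableEquiv.subRight (1 : ℝ)).measurableEmbedding
  have hpre : (fun t : ℝ => t - 1) ⁻¹' Ioi M = Ioi (M + 1) := by
    ext t; simp
  constructor
  · rw [← hpre]
    exact (hmp.integrableOn_comp_preimage hme).2 hf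
  · rw [← hpre]
    exact hmp.setIntegral_preimage_emb hme f (Ioi M)

theorem stepContour_segment (M a b : ℝ) (F : ℂ → ℂ) :
    ∫ t in Ioc M (M + 1), F (M + (a + (t - M) * (b - a)) * I) * ((b - a) * I) =
      I * ∫ y in a..b, F (M + y * I) := by
  rw [← intervalIntegral.integral_of_le (by linarith)]
  have h := intervalIntegral.smul_integral_comp_add_mul (a := M) (b := M + 1)
    (fun y : ℝ => F (M + y * I)) (b - a) (a - M * (b - a))
  have e1 : a - M * (b - a) + (b - a) * M = a := by ring
  have e2 : a - M * (b - a) + (b - a) * (M + 1) = b := by ring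
  rw [e1, e2] at h
  rw [← h, intervalIntegral.integral_mul_const]
  have : ∀ t : ℝ, (M + (a + (t - M) * (b - a)) * I : ℂ) =
      M + ((a - M * (b - a) + (b - a) * t : ℝ) : ℂ) * I := by
    intro t; push_cast; ring
  simp only [this, real_smul]
  push_cast
  ring

/-- The step contours are admissible: their weight is at most twice the bound on the lines plus the
length of the vertical segment times the supremum of `g` on it. -/
theorem StripL1.isDeformation {r K B : ℝ} {g : ℂ → ℂ} (hr : 0 < r) (hg : StripL1 r g K)
    {a b : ℝ} (ha : a ∈ Ioo (-r) r) (hb : b ∈ Ioo (-r) r) (M : ℝ)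
    (hB : a ≠ b → ∀ y ∈ uIcc a b, ‖g (M + y * I)‖ ≤ B) :
    IsDeformation r g (2 * K + |b - a| * B) (stepContour M a b) (stepWeight g M a b) := by
  have hγ : Measurable (stepContour M a b) := by
    refine Measurable.ite measurableSet_Iic (by fun_prop) (Measurable.ite measurableSet_Iic ?_ ?_)
      <;> fun_prop
  have hseg : ∀ t ∈ Ioc M (M + 1), a + (t - M) * (b - a) ∈ uIcc a b := by
    intro t ht
    rw [mem_uIcc]
    rcases le_total a b with h | h
    · left; constructor <;> nlinarith [ht.1, ht.2]
    · right; constructor <;> nlinarith [ht.1, ht.2]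
  have hsub : uIcc a b ⊆ Ioo (-r) r := by
    intro y hy
    rcases mem_uIcc.1 hy with h | h <;> constructor <;>
      linarith [ha.1, ha.2, hb.1, hb.2, h.1, h.2]
  have key : ∀ (F : ℂ → ℂ) (B' : ℝ), DifferentiableOn ℂ F (strip r) →
      (∀ z ∈ strip r, ‖F z‖ ≤ B') →
      Integrable (fun t => stepWeight g M a b t * F (stepContour M a b t)) ∧
      ∫ t, stepWeight g M a b t * F (stepContour M a b t) = ∫ v : ℝ, g v * F v := by
    intro F B' hF hB'
    have hh := hg.mul_bounded hr hF hB'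
    obtain ⟨j₁, j₂⟩ := integrableOn_Ioi_sub_one (M := M) (hh.int b hb).integrableOn
    have hcont : ContinuousOn (fun t : ℝ => (g (M + (a + (t - M) * (b - a)) * I) *
        F (M + (a + (t - M) * (b - a)) * I)) * ((b - a) * I)) (Icc M (M + 1)) := by
      refine ContinuousOn.mul ?_ continuousOn_const
      refine hh.hol.continuousOn.comp (by fun_prop) fun t ht => ?_
      have h1 : a + (t - M) * (b - a) ∈ uIcc a b := by
        rw [mem_uIcc]
        rcases le_total a b with h | h
        · left; constructor <;> nlinarith [ht.1, ht.2]
        · right; constructor <;> nlinarith [ht.1, ht.2]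
      have h2 := mem_strip_line (hsub h1) M
      push_cast at h2
      exact h2
    obtain ⟨i, e⟩ := integral_three_pieces (M := M)
      (f := fun t => stepWeight g M a b t * F (stepContour M a b t))
      (f₁ := fun t => g (t + a * I) * F (t + a * I))
      (f₂ := fun t => (g (M + (a + (t - M) * (b - a)) * I) *
        F (M + (a + (t - M) * (b - a)) * I)) * ((b - a) * I))
      (f₃ := fun t => g ((t - 1 : ℝ) + b * I) * F ((t - 1 : ℝ) + b * I))
      (hh.int a ha).integrableOn (hcont.integrableOn_Icc.mono_set Ioc_subset_Icc_self) j₁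
      (fun t ht => by
        have : t ≤ M := ht
        simp [stepWeight, stepContour, this])
      (fun t ht => by
        have h1 : ¬ t ≤ M := not_le.2 ht.1
        have h2 : t ≤ M + 1 := ht.2
        simp only [stepWeight, stepContour, h1, h2, if_true, if_false]
        ring)
      (fun t ht => by
        have h2 : ¬ t ≤ M + 1 := not_le.2 ht
        have h1 : ¬ t ≤ M := fun h => h2 (by linarith)
        simp [stepWeight, stepContour, h1, h2])
    refine ⟨i, ?_⟩
    rw [e, hh.integral_eq_contour hr ha hb M, j₂,
      stepContour_segment M a b (fun z => g z * F z)]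
  have hw : Integrable (stepWeight g M a b) := by
    simpa using (key (fun _ => 1) 1 (differentiableOn_const _) (by simp)).1
  refine ⟨hγ, hw, ?_, fun F B' hF hB' => (key F B' hF hB').2.symm⟩
  -- the bound on the three pieces of the contour
  have hn := hw.norm
  have hu : Ioi M = Ioc M (M + 1) ∪ Ioi (M + 1) := (Ioc_union_Ioi_eq_Ioi (by linarith)).symm
  have hd : Disjoint (Ioc M (M + 1)) (Ioi (M + 1)) :=
    Set.disjoint_left.2 fun x hx hx' => not_lt.2 hx.2 hx'
  rw [← intervalIntegral.integral_Iic_add_Ioi hn.integrableOn hn.integrableOn (b := M), hu,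
    setIntegral_union hd measurableSet_Ioi hn.integrableOn hn.integrableOn]
  have b1 : ∫ t in Iic M, ‖stepWeight g M a b t‖ ≤ K := by
    refine le_trans ?_ (hg.bound a ha)
    rw [setIntegral_congr_fun (g := fun t : ℝ => ‖g (t + a * I)‖) measurableSet_Iic (fun t ht => by
      have : t ≤ M := ht
      simp [stepWeight, stepContour, this])]
    exact setIntegral_le_integral (hg.int a ha).norm (ae_of_all _ fun _ => norm_nonneg _)
  have b2 : ∫ t in Ioc M (M + 1), ‖stepWeight g M a b t‖ ≤ |b - a| * B := by
    have : ∀ t ∈ Ioc M (M + 1), ‖stepWeight g M a b t‖ ≤ |b - a| * B := by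
      intro t ht
      have h1 : ¬ t ≤ M := not_le.2 ht.1
      have h2 : t ≤ M + 1 := ht.2
      have h4 : ‖((b : ℂ) - a) * I‖ = |b - a| := by
        rw [norm_mul, norm_I, mul_one, ← ofReal_sub, norm_real, Real.norm_eq_abs]
      simp only [stepWeight, stepContour, h1, h2, if_true, if_false, norm_mul (g _), h4]
      rw [mul_comm]
      by_cases hab : a = b
      · simp [hab]
      · refine mul_le_mul_of_nonneg_left ?_ (abs_nonneg _)
        have := hB hab _ (hseg t ht)
        push_cast at this
        exact this
    calc ∫ t in Ioc M (M + 1), ‖stepWeight g M a b t‖ ≤ ∫ t in Ioc M (M + 1), |b - a| * B :=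
          setIntegral_mono_on hn.integrableOn (integrableOn_const (by simp)) measurableSet_Ioc this
      _ = |b - a| * B := by simp
  have b3 : ∫ t in Ioi (M + 1), ‖stepWeight g M a b t‖ ≤ K := by
    refine le_trans ?_ (hg.bound b hb)
    rw [setIntegral_congr_fun (g := fun t : ℝ => ‖g ((t - 1 : ℝ) + b * I)‖) measurableSet_Ioi
      (fun t ht => by
        have h2 : ¬ t ≤ M + 1 := not_le.2 ht
        have h1 : ¬ t ≤ M := fun h => h2 (by linarith)
        simp [stepWeight, stepContour, h1, h2])]
    have hi : Integrable fun t : ℝ => ‖g ((t - 1 : ℝ) + b * I)‖ :=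
      (hg.int b hb).norm.comp_sub_right 1
    refine (setIntegral_le_integral hi (ae_of_all _ fun _ => norm_nonneg _)).trans (le_of_eq ?_)
    exact integral_sub_right_eq_self (fun t : ℝ => ‖g (t + b * I)‖) 1
  linarith

/-! ### Joint analyticity of separately holomorphic functions -/

/-- The parameter interval `[0, 2π]` of a circle. -/
abbrev AngleInterval : Type := Icc (0 : ℝ) (2 * Real.pi)

/-- Lebesgue measure on the parameter interval of a circle. -/
abbrev angleMeasure : Measure AngleInterval := Measure.comap Subtype.val volume

instance : IsFiniteMeasure angleMeasure :=
  ⟨by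
    rw [Measure.comap_apply _ Subtype.val_injective
      (fun s hs => measurableSet_Icc.subtype_image hs) _ MeasurableSet.univ, image_univ,
      Subtype.range_coe, Real.volume_Icc]
    exact ENNReal.ofReal_lt_top⟩

/-- Integration over a compact square as a continuous linear functional on continuous functions. -/
def squareIntegral : C(AngleInterval × AngleInterval, ℂ) →L[ℂ] ℂ :=
  LinearMap.mkContinuous
    { toFun := fun f => ∫ p, f p ∂((angleMeasure).prod
        (angleMeasure))
      map_add' := fun f g => by
        exact integral_add (f.continuous.integrable_of_hasCompactSupport
          (HasCompactSupport.of_compactSpace _)) (g.continuous.integrable_of_hasCompactSupport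
          (HasCompactSupport.of_compactSpace _))
      map_smul' := fun c f => integral_const_mul c _ }
    (((angleMeasure).prod (angleMeasure)).real
      (univ : Set (AngleInterval × AngleInterval))) fun f => by
    exact (norm_integral_le_of_norm_le_const (ae_of_all _ fun p => f.norm_coe_le_norm p)).trans_eq
      (mul_comm _ _)

theorem squareIntegral_apply {f : ℝ × ℝ → ℂ} (hf : Continuous f) :
    squareIntegral ⟨fun p => f (p.1, p.2), by fun_prop⟩ =
      ∫ θ in (0 : ℝ)..(2 * Real.pi), ∫ θ' in (0 : ℝ)..(2 * Real.pi), f (θ, θ') := by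
  change ∫ p : AngleInterval × AngleInterval, f (p.1, p.2)
    ∂((angleMeasure).prod (angleMeasure)) = _
  have hc : Continuous fun p : AngleInterval × AngleInterval =>
    f (p.1, p.2) := by fun_prop
  rw [integral_prod _ (hc.integrable_of_hasCompactSupport (HasCompactSupport.of_compactSpace _)),
    integral_subtype_comap measurableSet_Icc
      (fun θ => ∫ y : AngleInterval, f (θ, y) ∂(angleMeasure)),
    integral_Icc_eq_integral_Ioc, intervalIntegral.integral_of_le (by positivity)]
  congr 1
  funext θ
  rw [integral_subtype_comap measurableSet_Icc (fun θ' => f (θ, θ')),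
    integral_Icc_eq_integral_Ioc, intervalIntegral.integral_of_le (by positivity)]

/-- The map `z ↦ 1 / (u - z)` with values in the Banach algebra of continuous functions on a compact
space is analytic where `u - z` is invertible. -/
theorem analyticAt_inv_sub {X : Type*} [TopologicalSpace X] [CompactSpace X] (u : C(X, ℂ))
    {z₀ : ℂ} (h : IsUnit (u - algebraMap ℂ C(X, ℂ) z₀)) :
    AnalyticAt ℂ (fun z : ℂ => Ring.inverse (u - algebraMap ℂ C(X, ℂ) z)) z₀ := by
  have h1 : AnalyticAt ℂ (Ring.inverse : C(X, ℂ) → C(X, ℂ)) (u - algebraMap ℂ C(X, ℂ) z₀) := by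
    obtain ⟨v, hv⟩ := h
    rw [← hv]
    exact analyticAt_inverse (𝕜 := ℂ) v
  refine AnalyticAt.fun_comp (g := (Ring.inverse : C(X, ℂ) → C(X, ℂ))) (f := fun z : ℂ =>
    u - algebraMap ℂ C(X, ℂ) z) h1 ?_
  exact analyticAt_const.sub ((Algebra.linearMap ℂ C(X, ℂ)).toContinuousLinearMap.analyticAt z₀)

theorem ringInverse_apply {X : Type*} [TopologicalSpace X] [CompactSpace X] (u : C(X, ℂ))
    (h : ∀ x, u x ≠ 0) (x : X) : IsUnit u ∧ Ring.inverse u x = (u x)⁻¹ := by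
  have hu : IsUnit u := by
    rw [ContinuousMap.isUnit_iff_forall_ne_zero]
    exact h
  refine ⟨hu, ?_⟩
  have h1 := congrArg (fun f : C(X, ℂ) => f x) (Ring.mul_inverse_cancel u hu)
  simp only [ContinuousMap.mul_apply, ContinuousMap.one_apply] at h1
  exact eq_inv_of_mul_eq_one_right h1

/-- A continuous function of two complex variables that is holomorphic in each of them is jointly
analytic: by the Cauchy formula on a torus it is a continuous linear image of the product of the
two Cauchy kernels, which are analytic functions with values in a Banach algebra. -/
theorem analyticAt_of_separately {Z Z' : Set ℂ} (hZ : IsOpen Z) (hZ' : IsOpen Z') {F : ℂ → ℂ → ℂ}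
    (hc : ContinuousOn (fun p : ℂ × ℂ => F p.1 p.2) (Z ×ˢ Z'))
    (h₁ : ∀ z' ∈ Z', DifferentiableOn ℂ (fun z => F z z') Z)
    (h₂ : ∀ z ∈ Z, DifferentiableOn ℂ (fun z' => F z z') Z') {p : ℂ × ℂ} (hp : p ∈ Z ×ˢ Z') :
    AnalyticAt ℂ (fun p : ℂ × ℂ => F p.1 p.2) p := by
  obtain ⟨R, hR, hRZ⟩ := Metric.nhds_basis_closedBall.mem_iff.1 (hZ.mem_nhds hp.1)
  obtain ⟨R', hR', hRZ'⟩ := Metric.nhds_basis_closedBall.mem_iff.1 (hZ'.mem_nhds hp.2)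
  let u : C(AngleInterval × AngleInterval, ℂ) := ⟨fun x => circleMap p.1 R x.1, by fun_prop⟩
  let u' : C(AngleInterval × AngleInterval, ℂ) := ⟨fun x => circleMap p.2 R' x.2, by fun_prop⟩
  have hmem : ∀ θ, circleMap p.1 R θ ∈ Z := fun θ =>
    hRZ (circleMap_mem_closedBall _ hR.le θ)
  have hmem' : ∀ θ, circleMap p.2 R' θ ∈ Z' := fun θ =>
    hRZ' (circleMap_mem_closedBall _ hR'.le θ)
  have hFc : Continuous fun x : ℝ × ℝ => F (circleMap p.1 R x.1) (circleMap p.2 R' x.2) :=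
    hc.comp_continuous (f := fun x : ℝ × ℝ => (circleMap p.1 R x.1, circleMap p.2 R' x.2))
      (by fun_prop) fun x => ⟨hmem _, hmem' _⟩
  have hne : ∀ z ∈ Metric.ball p.1 R, ∀ θ, circleMap p.1 R θ - z ≠ 0 := fun z hz θ =>
    sub_ne_zero.2 (circleMap_ne_mem_ball hz θ)
  have hne' : ∀ z ∈ Metric.ball p.2 R', ∀ θ, circleMap p.2 R' θ - z ≠ 0 := fun z hz θ =>
    sub_ne_zero.2 (circleMap_ne_mem_ball hz θ)
  let k : C(AngleInterval × AngleInterval, ℂ) := ⟨fun x => (circleMap 0 R x.1 * I) *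
      (circleMap 0 R' x.2 * I) * F (circleMap p.1 R x.1) (circleMap p.2 R' x.2),
    Continuous.mul (by fun_prop) (hFc.comp (by fun_prop :
      Continuous fun x : AngleInterval × AngleInterval => ((x.1 : ℝ), (x.2 : ℝ))))⟩
  let Φ : ℂ × ℂ → C(AngleInterval × AngleInterval, ℂ) := fun q =>
    Ring.inverse (u - algebraMap ℂ _ q.1) * Ring.inverse (u' - algebraMap ℂ _ q.2) * k
  have hΦ : AnalyticAt ℂ Φ p := by
    refine (AnalyticAt.mul ?_ ?_).mul analyticAt_const
    · refine AnalyticAt.fun_comp (f := Prod.fst)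
        (g := fun z : ℂ => Ring.inverse (u - algebraMap ℂ _ z)) (analyticAt_inv_sub u ?_) analyticAt_fst
      rw [ContinuousMap.isUnit_iff_forall_ne_zero]
      exact fun x => hne p.1 (Metric.mem_ball_self hR) x.1
    · refine AnalyticAt.fun_comp (f := Prod.snd)
        (g := fun z : ℂ => Ring.inverse (u' - algebraMap ℂ _ z)) (analyticAt_inv_sub u' ?_) analyticAt_snd
      rw [ContinuousMap.isUnit_iff_forall_ne_zero]
      exact fun x => hne' p.2 (Metric.mem_ball_self hR') x.2
  have hL : AnalyticAt ℂ (fun q => (2 * Real.pi * I : ℂ)⁻¹ * ((2 * Real.pi * I : ℂ)⁻¹ *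
      squareIntegral (Φ q))) p :=
    analyticAt_const.mul (analyticAt_const.mul ((squareIntegral.analyticAt _).fun_comp hΦ))
  refine hL.congr ?_
  filter_upwards [prod_mem_nhds (Metric.ball_mem_nhds p.1 hR) (Metric.ball_mem_nhds p.2 hR')]
    with q hq
  have hi : ∀ θ, F (circleMap p.1 R θ) q.2 = (2 * Real.pi * I : ℂ)⁻¹ *
      ∫ θ' in (0 : ℝ)..(2 * Real.pi), circleMap 0 R' θ' * I * ((circleMap p.2 R' θ' - q.2)⁻¹ *
        F (circleMap p.1 R θ) (circleMap p.2 R' θ')) := by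
    intro θ
    have := two_pi_I_inv_smul_circleIntegral_sub_inv_smul_of_differentiable_on_off_countable
      (f := fun z' => F (circleMap p.1 R θ) z') countable_empty hq.2
      ((h₂ _ (hmem θ)).continuousOn.mono hRZ') (fun x hx => (h₂ _ (hmem θ)).differentiableAt
        (hZ'.mem_nhds (hRZ' (Metric.ball_subset_closedBall hx.1))))
    rw [← this, circleIntegral]
    simp [smul_eq_mul, deriv_circleMap]
  have ho : F q.1 q.2 = (2 * Real.pi * I : ℂ)⁻¹ *
      ∫ θ in (0 : ℝ)..(2 * Real.pi), circleMap 0 R θ * I * ((circleMap p.1 R θ - q.1)⁻¹ *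
        F (circleMap p.1 R θ) q.2) := by
    have hq2 := hRZ' (Metric.ball_subset_closedBall hq.2)
    have := two_pi_I_inv_smul_circleIntegral_sub_inv_smul_of_differentiable_on_off_countable
      (f := fun z => F z q.2) countable_empty hq.1
      ((h₁ _ hq2).continuousOn.mono hRZ) (fun x hx => (h₁ _ hq2).differentiableAt
        (hZ.mem_nhds (hRZ (Metric.ball_subset_closedBall hx.1))))
    rw [← this, circleIntegral]
    simp [smul_eq_mul, deriv_circleMap]
  rw [ho]
  congr 1
  have hcont : Continuous fun x : ℝ × ℝ => (circleMap p.1 R x.1 - q.1)⁻¹ *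
      (circleMap p.2 R' x.2 - q.2)⁻¹ * ((circleMap 0 R x.1 * I) * (circleMap 0 R' x.2 * I) *
      F (circleMap p.1 R x.1) (circleMap p.2 R' x.2)) := by
    refine Continuous.mul (Continuous.mul ?_ ?_) (Continuous.mul (by fun_prop) hFc)
    · exact Continuous.inv₀ (by fun_prop) fun x => hne _ hq.1 _
    · exact Continuous.inv₀ (by fun_prop) fun x => hne' _ hq.2 _
  have hΦq : Φ q = ⟨fun x : AngleInterval × AngleInterval =>
      (fun x : ℝ × ℝ => (circleMap p.1 R x.1 - q.1)⁻¹ *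
      (circleMap p.2 R' x.2 - q.2)⁻¹ * ((circleMap 0 R x.1 * I) * (circleMap 0 R' x.2 * I) *
      F (circleMap p.1 R x.1) (circleMap p.2 R' x.2))) ((x.1 : ℝ), (x.2 : ℝ)),
      hcont.comp (by fun_prop)⟩ := by
    ext x
    have e1 := (ringInverse_apply (u - algebraMap ℂ _ q.1)
      (fun x => hne _ hq.1 x.1) x).2
    have e2 := (ringInverse_apply (u' - algebraMap ℂ _ q.2)
      (fun x => hne' _ hq.2 x.2) x).2
    simp only [Φ, ContinuousMap.mul_apply, e1, e2]
    rfl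
  rw [hΦq, squareIntegral_apply hcont, ← intervalIntegral.integral_const_mul]
  congr 1
  funext θ
  rw [hi θ, ← intervalIntegral.integral_const_mul]
  simp only [← mul_assoc]
  rw [← intervalIntegral.integral_const_mul]
  congr 1
  funext θ'
  ring

/-! ### Averages of products of resolvents of the potential -/

section

/-- `∫ (γ - z)⁻ᵃ (γ - z')⁻ᵇ w dt`: the average over one site, computed along a contour. -/
def siteIntegral (γ w : ℝ → ℂ) (a b : ℕ) (z z' : ℂ) : ℂ :=
  ∫ t, w t * ((γ t - z)⁻¹ ^ a * (γ t - z')⁻¹ ^ b)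

/-- The average of `∏_{x ∈ l} (V x - z)⁻¹ ∏_{x ∈ l'} (V x - z')⁻¹` over independent values `V x`,
computed along a contour: the product over the sites of `siteIntegral`. -/
def listIntegral {S : Type*} [DecidableEq S] (γ w : ℝ → ℂ) (l l' : List S) (z z' : ℂ) : ℂ :=
  ∏ x ∈ (l ++ l').toFinset, siteIntegral γ w (l.count x) (l'.count x) z z'

section Separated

variable {γ w : ℝ → ℂ} {C δ : ℝ} {Z Z' : Set ℂ}

theorem norm_inv_pow_le (hδ : 0 < δ) {z v : ℂ} (h : δ ≤ ‖v - z‖) (a : ℕ) :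
    ‖(v - z)⁻¹ ^ a‖ ≤ δ⁻¹ ^ a := by
  rw [norm_pow, norm_inv]
  gcongr

theorem measurable_sitePow (hγ : Measurable γ) (a b : ℕ) (z z' : ℂ) :
    Measurable fun t => (γ t - z)⁻¹ ^ a * (γ t - z')⁻¹ ^ b := by fun_prop

theorem norm_sitePow_le (hδ : 0 < δ) {z z' v : ℂ} (h : δ ≤ ‖v - z‖) (h' : δ ≤ ‖v - z'‖) (a b : ℕ) :
    ‖(v - z)⁻¹ ^ a * (v - z')⁻¹ ^ b‖ ≤ δ⁻¹ ^ (a + b) := by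
  rw [norm_mul, pow_add]
  exact mul_le_mul (norm_inv_pow_le hδ h a) (norm_inv_pow_le hδ h' b) (norm_nonneg _)
    (by positivity)

theorem integrable_sitePow (hγ : Measurable γ) (hw : Integrable w) (hδ : 0 < δ) {z z' : ℂ}
    (h : ∀ t, δ ≤ ‖γ t - z‖) (h' : ∀ t, δ ≤ ‖γ t - z'‖) (a b : ℕ) :
    Integrable fun t => w t * ((γ t - z)⁻¹ ^ a * (γ t - z')⁻¹ ^ b) :=
  hw.mul_bdd (measurable_sitePow hγ a b z z').aestronglyMeasurable
    (ae_of_all _ fun t => norm_sitePow_le hδ (h t) (h' t) a b)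

theorem norm_siteIntegral_le (hw : Integrable w) (hC : ∫ t, ‖w t‖ ≤ C) (hδ : 0 < δ) {z z' : ℂ}
    (h : ∀ t, δ ≤ ‖γ t - z‖) (h' : ∀ t, δ ≤ ‖γ t - z'‖) (a b : ℕ) :
    ‖siteIntegral γ w a b z z'‖ ≤ C * δ⁻¹ ^ (a + b) := by
  calc ‖siteIntegral γ w a b z z'‖ ≤ ∫ t, ‖w t‖ * δ⁻¹ ^ (a + b) := by
        refine norm_integral_le_of_norm_le (hw.norm.mul_const _) (ae_of_all _ fun t => ?_)
        rw [norm_mul]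
        exact mul_le_mul_of_nonneg_left (norm_sitePow_le hδ (h t) (h' t) a b) (norm_nonneg _)
    _ = (∫ t, ‖w t‖) * δ⁻¹ ^ (a + b) := integral_mul_const _ _
    _ ≤ C * δ⁻¹ ^ (a + b) := by gcongr

theorem continuousOn_siteIntegral (hγ : Measurable γ) (hw : Integrable w) (hδ : 0 < δ)
    (h : ∀ z ∈ Z, ∀ t, δ ≤ ‖γ t - z‖) (h' : ∀ z ∈ Z', ∀ t, δ ≤ ‖γ t - z‖) (a b : ℕ) :
    ContinuousOn (fun p : ℂ × ℂ => siteIntegral γ w a b p.1 p.2) (Z ×ˢ Z') := by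
  refine continuousOn_of_dominated (bound := fun t => ‖w t‖ * δ⁻¹ ^ (a + b)) (fun p hp => ?_)
    (fun p hp => ae_of_all _ fun t => ?_) (hw.norm.mul_const _) (ae_of_all _ fun t => ?_)
  · exact (integrable_sitePow hγ hw hδ (h _ hp.1) (h' _ hp.2) a b).aestronglyMeasurable
  · rw [norm_mul]
    exact mul_le_mul_of_nonneg_left (norm_sitePow_le hδ (h _ hp.1 t) (h' _ hp.2 t) a b)
      (norm_nonneg _)
  · refine continuousOn_const.mul (ContinuousOn.mul (ContinuousOn.pow ?_ _) (ContinuousOn.pow ?_ _))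
    · refine ContinuousOn.inv₀ (by fun_prop) fun p hp => norm_pos_iff.1 (hδ.trans_le (h _ hp.1 t))
    · refine ContinuousOn.inv₀ (by fun_prop) fun p hp => norm_pos_iff.1 (hδ.trans_le (h' _ hp.2 t))

theorem siteIntegral_swap (a b : ℕ) (z z' : ℂ) :
    siteIntegral γ w a b z z' = siteIntegral γ w b a z' z := by
  simp only [siteIntegral, mul_comm]

theorem differentiableOn_siteIntegral (hγ : Measurable γ) (hw : Integrable w) (hδ : 0 < δ)
    (hZ : IsOpen Z) (h : ∀ z ∈ Z, ∀ t, δ ≤ ‖γ t - z‖) {z' : ℂ} (h' : ∀ t, δ ≤ ‖γ t - z'‖)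
    (a b : ℕ) : DifferentiableOn ℂ (fun z => siteIntegral γ w a b z z') Z := by
  intro z₀ hz₀
  have hderiv : ∀ t, ∀ z ∈ Z, HasDerivAt (fun z => w t * ((γ t - z)⁻¹ ^ a * (γ t - z')⁻¹ ^ b))
      (w t * (a * ((γ t - z)⁻¹ ^ (a + 1) * (γ t - z')⁻¹ ^ b))) z := by
    intro t z hz
    have hne : γ t - z ≠ 0 := norm_pos_iff.1 (hδ.trans_le (h z hz t))
    have h1 : HasDerivAt (fun z : ℂ => (γ t - z)⁻¹) (-(-1) / (γ t - z) ^ 2) z :=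
      ((hasDerivAt_id z).const_sub (γ t)).inv hne
    convert! (((h1.pow a).mul_const ((γ t - z')⁻¹ ^ b)).const_mul (w t)) using 1
    rcases a with _ | a
    · simp
    · simp only [Nat.add_sub_cancel, div_eq_mul_inv, ← inv_pow]
      ring
  have := (hasDerivAt_integral_of_dominated_loc_of_deriv_le (μ := volume)
    (F := fun z t => w t * ((γ t - z)⁻¹ ^ a * (γ t - z')⁻¹ ^ b))
    (F' := fun z t => w t * (a * ((γ t - z)⁻¹ ^ (a + 1) * (γ t - z')⁻¹ ^ b)))
    (bound := fun t => ‖w t‖ * (a * δ⁻¹ ^ (a + 1 + b))) (hZ.mem_nhds hz₀)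
    ((hZ.eventually_mem hz₀).mono fun z hz =>
      (integrable_sitePow hγ hw hδ (h z hz) h' a b).aestronglyMeasurable)
    (integrable_sitePow hγ hw hδ (h z₀ hz₀) h' a b)
    (hw.aestronglyMeasurable.mul
      ((measurable_sitePow hγ (a + 1) b z₀ z').const_mul _).aestronglyMeasurable)
    (ae_of_all _ fun t z hz => ?_) (hw.norm.mul_const _)
    (ae_of_all _ fun t z hz => hderiv t z hz)).2
  · exact this.differentiableAt.differentiableWithinAt
  · rw [norm_mul, norm_mul, Complex.norm_natCast]
    gcongr
    exact norm_sitePow_le hδ (h z hz t) (h' t) (a + 1) b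

variable {S : Type*} [DecidableEq S]

theorem sum_count_append (l l' : List S) :
    ∑ x ∈ (l ++ l').toFinset, (l.count x + l'.count x) = l.length + l'.length := by
  have := Multiset.sum_count_eq_card (s := (l ++ l').toFinset) (m := ((l ++ l' : List S) :
    Multiset S)) (fun a ha => by simpa using ha)
  simpa [List.count_append] using this

theorem norm_listIntegral_le (hw : Integrable w) (hC : ∫ t, ‖w t‖ ≤ C) (h1 : 1 ≤ C) (hδ : 0 < δ)
    {z z' : ℂ} (h : ∀ t, δ ≤ ‖γ t - z‖) (h' : ∀ t, δ ≤ ‖γ t - z'‖) (l l' : List S) :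
    ‖listIntegral γ w l l' z z'‖ ≤ (C * δ⁻¹) ^ (l.length + l'.length) := by
  rw [listIntegral, norm_prod, ← sum_count_append, ← Finset.prod_pow_eq_pow_sum]
  refine Finset.prod_le_prod (fun _ _ => norm_nonneg _) fun x hx => ?_
  refine (norm_siteIntegral_le hw hC hδ h h' _ _).trans ?_
  rw [mul_pow]
  gcongr
  refine le_self_pow₀ h1 ?_
  have : x ∈ l ∨ x ∈ l' := by simpa using hx
  rcases this with hx | hx
  · have := List.count_pos_iff.2 hx; omega
  · have := List.count_pos_iff.2 hx; omega

theorem continuousOn_listIntegral (hγ : Measurable γ) (hw : Integrable w) (hδ : 0 < δ)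
    (h : ∀ z ∈ Z, ∀ t, δ ≤ ‖γ t - z‖) (h' : ∀ z ∈ Z', ∀ t, δ ≤ ‖γ t - z‖) (l l' : List S) :
    ContinuousOn (fun p : ℂ × ℂ => listIntegral γ w l l' p.1 p.2) (Z ×ˢ Z') :=
  continuousOn_finsetProd _ fun _ _ => continuousOn_siteIntegral hγ hw hδ h h' _ _

theorem differentiableOn_listIntegral_left (hγ : Measurable γ) (hw : Integrable w) (hδ : 0 < δ)
    (hZ : IsOpen Z) (h : ∀ z ∈ Z, ∀ t, δ ≤ ‖γ t - z‖) {z' : ℂ} (h' : ∀ t, δ ≤ ‖γ t - z'‖)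
    (l l' : List S) : DifferentiableOn ℂ (fun z => listIntegral γ w l l' z z') Z := by
  unfold listIntegral
  exact DifferentiableOn.fun_finsetProd fun x _ =>
    differentiableOn_siteIntegral hγ hw hδ hZ h h' _ _

theorem differentiableOn_listIntegral_right (hγ : Measurable γ) (hw : Integrable w) (hδ : 0 < δ)
    (hZ : IsOpen Z) (h : ∀ z ∈ Z, ∀ t, δ ≤ ‖γ t - z‖) {z' : ℂ} (h' : ∀ t, δ ≤ ‖γ t - z'‖)
    (l l' : List S) : DifferentiableOn ℂ (fun z => listIntegral γ w l l' z' z) Z := by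
  unfold listIntegral
  refine DifferentiableOn.fun_finsetProd fun x _ => ?_
  have e : siteIntegral γ w (l.count x) (l'.count x) z' =
      fun z => siteIntegral γ w (l'.count x) (l.count x) z z' :=
    funext fun z => siteIntegral_swap _ _ _ _
  rw [e]
  exact differentiableOn_siteIntegral hγ hw hδ hZ h h' _ _

/-- A series of contour averages, as it comes from expanding a product of two resolvents. -/
def walkSeries {ι : Type*} (γ w : ℝ → ℂ) (c : ι → ℂ) (l l' : ι → List S) (z z' : ℂ) : ℂ :=
  ∑' i, c i * listIntegral γ w (l i) (l' i) z z'

variable {ι : Type*} {c : ι → ℂ} {l l' : ι → List S}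

theorem norm_walkSeries_term_le (hw : Integrable w) (hC : ∫ t, ‖w t‖ ≤ C) (h1 : 1 ≤ C) (hδ : 0 < δ)
    {z z' : ℂ} (h : ∀ t, δ ≤ ‖γ t - z‖) (h' : ∀ t, δ ≤ ‖γ t - z'‖) (i : ι) :
    ‖c i * listIntegral γ w (l i) (l' i) z z'‖ ≤
      ‖c i‖ * (C * δ⁻¹) ^ ((l i).length + (l' i).length) := by
  rw [norm_mul]
  exact mul_le_mul_of_nonneg_left (norm_listIntegral_le hw hC h1 hδ h h' _ _) (norm_nonneg _)

theorem continuousOn_walkSeries (hγ : Measurable γ) (hw : Integrable w) (hC : ∫ t, ‖w t‖ ≤ C)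
    (h1 : 1 ≤ C) (hδ : 0 < δ)
    (hs : Summable fun i => ‖c i‖ * (C * δ⁻¹) ^ ((l i).length + (l' i).length))
    (h : ∀ z ∈ Z, ∀ t, δ ≤ ‖γ t - z‖) (h' : ∀ z ∈ Z', ∀ t, δ ≤ ‖γ t - z‖) :
    ContinuousOn (fun p : ℂ × ℂ => walkSeries γ w c l l' p.1 p.2) (Z ×ˢ Z') :=
  continuousOn_tsum (fun _ => continuousOn_const.mul (continuousOn_listIntegral hγ hw hδ h h' _ _))
    hs fun i _ hp => norm_walkSeries_term_le hw hC h1 hδ (h _ hp.1) (h' _ hp.2) i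

theorem differentiableOn_walkSeries_left (hγ : Measurable γ) (hw : Integrable w)
    (hC : ∫ t, ‖w t‖ ≤ C) (h1 : 1 ≤ C) (hδ : 0 < δ)
    (hs : Summable fun i => ‖c i‖ * (C * δ⁻¹) ^ ((l i).length + (l' i).length)) (hZ : IsOpen Z)
    (h : ∀ z ∈ Z, ∀ t, δ ≤ ‖γ t - z‖) {z' : ℂ} (h' : ∀ t, δ ≤ ‖γ t - z'‖) :
    DifferentiableOn ℂ (fun z => walkSeries γ w c l l' z z') Z :=
  differentiableOn_tsum_of_summable_norm hs (fun _ => (differentiableOn_const _).mul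
    (differentiableOn_listIntegral_left hγ hw hδ hZ h h' _ _)) hZ
    fun i z hz => norm_walkSeries_term_le hw hC h1 hδ (h z hz) h' i

theorem differentiableOn_walkSeries_right (hγ : Measurable γ) (hw : Integrable w)
    (hC : ∫ t, ‖w t‖ ≤ C) (h1 : 1 ≤ C) (hδ : 0 < δ)
    (hs : Summable fun i => ‖c i‖ * (C * δ⁻¹) ^ ((l i).length + (l' i).length)) (hZ : IsOpen Z)
    (h : ∀ z ∈ Z, ∀ t, δ ≤ ‖γ t - z‖) {z' : ℂ} (h' : ∀ t, δ ≤ ‖γ t - z'‖) :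
    DifferentiableOn ℂ (fun z => walkSeries γ w c l l' z' z) Z :=
  differentiableOn_tsum_of_summable_norm hs (fun _ => (differentiableOn_const _).mul
    (differentiableOn_listIntegral_right hγ hw hδ hZ h h' _ _)) hZ
    fun i z hz => norm_walkSeries_term_le hw hC h1 hδ h' (h z hz) i

end Separated

/-! ### The disorder average of a product of resolvents of the potential -/

theorem IsSiteDensity.integrable_re {r : ℝ} {g : ℂ → ℂ} (hg : IsSiteDensity r g) :
    Integrable fun v : ℝ => (g v).re := by
  by_contra h
  have := integral_undef h
  rw [hg.total] at this
  exact one_ne_zero this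

theorem IsSiteDensity.isProbabilityMeasure {r : ℝ} {g : ℂ → ℂ} (hg : IsSiteDensity r g) :
    IsProbabilityMeasure (siteMeasure g) := by
  constructor
  rw [siteMeasure, withDensity_apply _ MeasurableSet.univ, Measure.restrict_univ,
    ← ofReal_integral_eq_lintegral_ofReal hg.integrable_re (ae_of_all _ hg.nonneg), hg.total,
    ENNReal.ofReal_one]

theorem IsSiteDensity.integral_siteMeasure {r : ℝ} {g : ℂ → ℂ} (hg : IsSiteDensity r g)
    (F : ℝ → ℂ) : ∫ v, F v ∂(siteMeasure g) = ∫ v : ℝ, g v * F v := by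
  rw [siteMeasure, integral_withDensity_eq_integral_toReal_smul₀
    hg.integrable_re.aestronglyMeasurable.aemeasurable.ennreal_ofReal
    (ae_of_all _ fun _ => ENNReal.ofReal_lt_top)]
  congr 1
  funext v
  rw [ENNReal.toReal_ofReal (hg.nonneg v), real_smul]
  congr 1
  apply Complex.ext
  · simp
  · simp [hg.real v]

/-- If `|Im z|` and `|Im z'|` exceed the width of the strip, the average over one site can be
computed along any admissible contour. -/
theorem IsSiteDensity.siteIntegral_eq {r C : ℝ} {g : ℂ → ℂ} {γ w : ℝ → ℂ} (hg : IsSiteDensity r g)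
    (hd : IsDeformation r g C γ w) {z z' : ℂ} (hz : r + 1 ≤ |z.im|) (hz' : r + 1 ≤ |z'.im|)
    (a b : ℕ) : ∫ v : ℝ, ((v - z)⁻¹ ^ a * (v - z')⁻¹ ^ b : ℂ) ∂(siteMeasure g) =
      siteIntegral γ w a b z z' := by
  have hfar : ∀ z : ℂ, r + 1 ≤ |z.im| → ∀ v ∈ strip r, 1 ≤ ‖v - z‖ := by
    intro z hz v hv
    have h1 : |v.im| < r := hv
    have h2 := abs_im_le_norm (v - z)
    have h3 := abs_sub_abs_le_abs_sub z.im v.im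
    rw [sub_im, abs_sub_comm] at h2
    linarith
  have hne : ∀ z : ℂ, r + 1 ≤ |z.im| → ∀ v ∈ strip r, v - z ≠ 0 := fun z hz v hv =>
    norm_pos_iff.1 (one_pos.trans_le (hfar z hz v hv))
  rw [hg.integral_siteMeasure]
  refine hd.repr (fun v => (v - z)⁻¹ ^ a * (v - z')⁻¹ ^ b) 1 ?_ fun v hv => ?_
  · refine DifferentiableOn.mul (DifferentiableOn.pow (DifferentiableOn.inv (by fun_prop) ?_) _)
      (DifferentiableOn.pow (DifferentiableOn.inv (by fun_prop) ?_) _)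
    · exact hne z hz
    · exact hne z' hz'
  · simpa using norm_sitePow_le one_pos (hfar z hz v hv) (hfar z' hz' v hv) a b

/-- The average of a product of single-site resolvents factorizes over the sites, and each factor
can be computed along an admissible contour. -/
theorem IsSiteDensity.integral_list_prod {r C : ℝ} {g : ℂ → ℂ} {γ w : ℝ → ℂ} {d : ℕ}
    (hg : IsSiteDensity r g) (hd : IsDeformation r g C γ w) {z z' : ℂ} (hz : r + 1 ≤ |z.im|)
    (hz' : r + 1 ≤ |z'.im|) (l l' : List (Site d)) :
    ∫ V, (l.map fun x => (V x - z : ℂ)⁻¹).prod * (l'.map fun x => (V x - z' : ℂ)⁻¹).prod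
      ∂(disorder d g) = listIntegral γ w l l' z z' := by
  have := hg.isProbabilityMeasure
  have e : ∀ V : Site d → ℝ, (l.map fun x => (V x - z : ℂ)⁻¹).prod *
      (l'.map fun x => (V x - z' : ℂ)⁻¹).prod = (fun y : (l ++ l').toFinset → ℝ =>
        ∏ i, ((y i - z : ℂ)⁻¹ ^ (l.count i.1) * (y i - z' : ℂ)⁻¹ ^ (l'.count i.1)))
          ((l ++ l').toFinset.restrict V) := by
    intro V
    have h1 : (l.map fun x => (V x - z : ℂ)⁻¹).prod =
        ∏ x ∈ (l ++ l').toFinset, (V x - z : ℂ)⁻¹ ^ (l.count x) := by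
      rw [Finset.prod_list_map_count]
      refine Finset.prod_subset (by intro x; simp +contextual) fun x _ hx => ?_
      rw [List.count_eq_zero_of_not_mem (by simpa using hx), pow_zero]
    have h2 : (l'.map fun x => (V x - z' : ℂ)⁻¹).prod =
        ∏ x ∈ (l ++ l').toFinset, (V x - z' : ℂ)⁻¹ ^ (l'.count x) := by
      rw [Finset.prod_list_map_count]
      refine Finset.prod_subset (by intro x; simp +contextual) fun x _ hx => ?_
      rw [List.count_eq_zero_of_not_mem (by simpa using hx), pow_zero]
    rw [h1, h2, ← Finset.prod_mul_distrib, ← Finset.prod_coe_sort]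
    rfl
  refine (integral_congr_ae (ae_of_all _ e)).trans ?_
  refine (integral_restrict_infinitePi (fun _ : Site d => siteMeasure g)
    (f := fun y : (l ++ l').toFinset → ℝ =>
        ∏ i, ((y i - z : ℂ)⁻¹ ^ (l.count i.1) * (y i - z' : ℂ)⁻¹ ^ (l'.count i.1)))
    (by
      refine Measurable.aestronglyMeasurable ?_
      fun_prop)).trans ?_
  rw [integral_fintype_prod_eq_prod (fun (i : (l ++ l').toFinset) (v : ℝ) =>
      ((v - z : ℂ)⁻¹ ^ (l.count i.1) * (v - z' : ℂ)⁻¹ ^ (l'.count i.1))), listIntegral,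
    ← Finset.prod_coe_sort (l ++ l').toFinset
      (fun x => siteIntegral γ w (l.count x) (l'.count x) z z')]
  exact Finset.prod_congr rfl fun i _ => hg.siteIntegral_eq hd hz hz' _ _

end

/-! ### Resolvents of the Anderson Hamiltonian -/

section

variable {d : ℕ}

theorem norm_shift_le (a : Site d) : ‖shift a‖ ≤ 1 :=
  LinearMap.mkContinuous_norm_le _ zero_le_one _

/-- The lattice Laplacian without its diagonal part: the sum over the neighbours. -/
def hopping (d : ℕ) : Hilb d →L[ℂ] Hilb d :=
  ∑ j : Fin d, (shift (unitVec j) + shift (-unitVec j))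

theorem norm_hopping_le (d : ℕ) : ‖hopping d‖ ≤ 2 * d := by
  refine (norm_sum_le _ _).trans ?_
  calc ∑ j : Fin d, ‖shift (unitVec j) + shift (-unitVec j)‖ ≤ ∑ _j : Fin d, (2 : ℝ) :=
        Finset.sum_le_sum fun j _ => (norm_add_le _ _).trans (by
          linarith [norm_shift_le (unitVec j), norm_shift_le (-unitVec j)])
    _ = 2 * d := by simp [mul_comm]

theorem hopping_apply (ψ : Hilb d) (x : Site d) :
    hopping d ψ x = ∑ j : Fin d, (ψ (x + unitVec j) + ψ (x - unitVec j)) := by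
  simp only [hopping, sum_apply, lp.coeFn_sum, Finset.sum_apply, add_apply, lp.coeFn_add,
    Pi.add_apply, shift_apply, sub_eq_add_neg]

theorem andersonAction_eq (lam : ℝ) (V : Site d → ℝ) (ψ : Hilb d) (x : Site d) :
    andersonAction lam V ψ x = lam * hopping d ψ x + V x * ψ x := by
  rw [andersonAction, hopping_apply]

/-- Multiplication by a bounded function on `ℓ²(ℤᵈ)`. -/
def multiplication (f : Site d → ℂ) (C : ℝ) (hf : ∀ x, ‖f x‖ ≤ C) : Hilb d →L[ℂ] Hilb d :=
  have hC : 0 ≤ C := (norm_nonneg _).trans (hf 0)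
  have hle : ∀ (ψ : Hilb d) x, ‖f x * ψ x‖ ^ (2 : ℝ≥0∞).toReal ≤
      C ^ (2 : ℝ≥0∞).toReal * ‖ψ x‖ ^ (2 : ℝ≥0∞).toReal := fun ψ x => by
    rw [norm_mul, ← Real.mul_rpow hC (norm_nonneg _)]
    exact Real.rpow_le_rpow (by positivity) (mul_le_mul_of_nonneg_right (hf x) (norm_nonneg _))
      (by norm_num)
  have hs : ∀ ψ : Hilb d, Summable fun x => C ^ (2 : ℝ≥0∞).toReal * ‖ψ x‖ ^ (2 : ℝ≥0∞).toReal :=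
    fun ψ => ((memℓp_gen_iff (by norm_num)).1 (lp.memℓp ψ)).mul_left _
  LinearMap.mkContinuous
    { toFun := fun ψ => ⟨fun x => f x * ψ x, (memℓp_gen_iff (by norm_num)).2
        (Summable.of_nonneg_of_le (fun _ => by positivity) (hle ψ) (hs ψ))⟩
      map_add' := fun ψ φ => Subtype.ext (funext fun x => mul_add _ _ _)
      map_smul' := fun c ψ => Subtype.ext (funext fun x => by
        simp only [lp.coeFn_smul, Pi.smul_apply, smul_eq_mul, RingHom.id_apply]
        ring) } C (by
    intro ψ
    refine lp.norm_le_of_tsum_le (by norm_num) (by positivity) ?_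
    rw [Real.mul_rpow hC (norm_nonneg _), lp.norm_rpow_eq_tsum (by norm_num) ψ, ← tsum_mul_left]
    exact (Summable.of_nonneg_of_le (fun _ => by positivity) (hle ψ) (hs ψ)).tsum_le_tsum
      (hle ψ) (hs ψ))

@[simp] theorem multiplication_apply (f : Site d → ℂ) (C : ℝ) (hf : ∀ x, ‖f x‖ ≤ C) (ψ : Hilb d)
    (x : Site d) : multiplication f C hf ψ x = f x * ψ x := rfl

theorem norm_multiplication_le (f : Site d → ℂ) (C : ℝ) (hf : ∀ x, ‖f x‖ ≤ C) :
    ‖multiplication f C hf‖ ≤ C := by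
  unfold multiplication
  exact LinearMap.mkContinuous_norm_le _ ((norm_nonneg _).trans (hf 0)) _

theorem norm_inv_sub_le {z : ℂ} (hz : z.im ≠ 0) (v : ℝ) : ‖(v - z : ℂ)⁻¹‖ ≤ |z.im|⁻¹ := by
  rw [norm_inv]
  have := abs_im_le_norm (v - z)
  rw [sub_im, ofReal_im, zero_sub, abs_neg] at this
  exact inv_anti₀ (abs_pos.2 hz) this

theorem sub_ne_zero_of_im {z : ℂ} (hz : z.im ≠ 0) (v : ℝ) : (v - z : ℂ) ≠ 0 := by
  intro h
  have := congrArg im h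
  simp at this
  exact hz this

theorem mem_domain_iff {lam : ℝ} {V : Site d → ℝ} {ψ : Hilb d} :
    ψ ∈ (hamiltonian lam V).domain ↔ Memℓp (andersonAction lam V ψ) 2 := Iff.rfl

theorem hamiltonian_apply {lam : ℝ} {V : Site d → ℝ} (ψ : (hamiltonian lam V).domain) (x : Site d) :
    hamiltonian lam V ψ x = andersonAction lam V (ψ : Hilb d) x := rfl

/-- If `z` is far enough from the real axis, the resolvent of `H` exists by perturbation theory
around the resolvent of the potential. -/
theorem exists_isResolventAt {lam : ℝ} (V : Site d → ℝ) {z : ℂ} (hz : 2 * d * |lam| < |z.im|) :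
    ∃ R, IsResolventAt (hamiltonian lam V) z R := by
  have hz0 : z.im ≠ 0 := abs_pos.1 (lt_of_le_of_lt (by positivity) hz)
  -- With `D = (V - z)⁻¹` and `Δ` the hopping, `H - z = (1 + λ Δ D) (V - z)`, so that the resolvent
  -- is `D (1 + λ Δ D)⁻¹`, with a Neumann series for the second factor.
  set D := multiplication (fun x => (V x - z : ℂ)⁻¹) |z.im|⁻¹ (fun x => norm_inv_sub_le hz0 _)
    with hD
  set A : Hilb d →L[ℂ] Hilb d := (lam : ℂ) • (hopping d * D) with hA
  have hnorm : ‖-A‖ < 1 := by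
    have h1 : ‖hopping d * D‖ ≤ 2 * d * |z.im|⁻¹ := (norm_mul_le _ _).trans
      (mul_le_mul (norm_hopping_le d) (norm_multiplication_le _ _ _) (norm_nonneg _) (by positivity))
    have h2 : 0 < |z.im| := abs_pos.2 hz0
    rw [norm_neg, hA, norm_smul, norm_real, Real.norm_eq_abs]
    calc |lam| * ‖hopping d * D‖ ≤ |lam| * (2 * d * |z.im|⁻¹) := by gcongr
      _ = (2 * d * |lam|) / |z.im| := by ring
      _ < 1 := (div_lt_one h2).2 hz
  set N : (Hilb d →L[ℂ] Hilb d)ˣ := Units.oneSub (-A) hnorm with hN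
  have hNv : (N : Hilb d →L[ℂ] Hilb d) = 1 + A := by simp [hN]
  have hN1 : ∀ φ, (↑N⁻¹ : Hilb d →L[ℂ] Hilb d) φ + A ((↑N⁻¹ : Hilb d →L[ℂ] Hilb d) φ) = φ := by
    intro φ
    have := congrArg (fun B : Hilb d →L[ℂ] Hilb d => B φ) (Units.mul_inv N)
    rw [hNv] at this
    simpa using this
  have hN2 : ∀ φ, (↑N⁻¹ : Hilb d →L[ℂ] Hilb d) (φ + A φ) = φ := by
    intro φ
    have := congrArg (fun B : Hilb d →L[ℂ] Hilb d => B φ) (Units.inv_mul N)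
    rw [hNv] at this
    simpa using this
  refine ⟨D * (↑N⁻¹ : Hilb d →L[ℂ] Hilb d), fun φ => ?_, fun ψ => ?_⟩
  · set χ := (↑N⁻¹ : Hilb d →L[ℂ] Hilb d) φ with hχ
    have hact : andersonAction lam V (D χ) = ((φ + z • D χ : Hilb d) : Site d → ℂ) := by
      funext x
      have h1 := congrArg (fun ψ : Hilb d => ψ x) (hN1 φ)
      simp only [← hχ, lp.coeFn_add, Pi.add_apply, hA, smul_apply, lp.coeFn_smul,
        Pi.smul_apply, smul_eq_mul, mul_apply_eq_comp] at h1
      rw [andersonAction_eq, lp.coeFn_add, Pi.add_apply, lp.coeFn_smul, Pi.smul_apply, ← h1,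
        smul_eq_mul, hD, multiplication_apply]
      have := sub_ne_zero_of_im hz0 (V x)
      field_simp
      ring
    have hmem : D χ ∈ (hamiltonian lam V).domain := by
      rw [mem_domain_iff, hact]
      exact lp.memℓp _
    refine ⟨hmem, ?_⟩
    have : hamiltonian lam V ⟨D χ, hmem⟩ = φ + z • D χ := Subtype.ext hact
    change hamiltonian lam V ⟨D χ, hmem⟩ - z • D χ = φ
    rw [this, add_sub_cancel_right]
  · set χ : Hilb d := hamiltonian lam V ψ - (lam : ℂ) • hopping d (ψ : Hilb d) - z • (ψ : Hilb d)
      with hχ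
    have hχx : ∀ x, χ x = (V x - z) * (ψ : Hilb d) x := by
      intro x
      simp only [hχ, lp.coeFn_sub, Pi.sub_apply, hamiltonian_apply, andersonAction_eq, lp.coeFn_smul,
        Pi.smul_apply, smul_eq_mul]
      ring
    have hDχ : D χ = (ψ : Hilb d) := by
      refine lp.ext (funext fun x => ?_)
      rw [hD, multiplication_apply, hχx, inv_mul_cancel_left₀ (sub_ne_zero_of_im hz0 (V x))]
    have h2 : hamiltonian lam V ψ - z • (ψ : Hilb d) = χ + A χ := by
      rw [hA, smul_apply, mul_apply_eq_comp, hDχ, hχ]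
      abel
    rw [mul_apply_eq_comp, h2, hN2, hDχ]

theorem isResolventAt_resolventAt {lam : ℝ} (V : Site d → ℝ) {z : ℂ}
    (hz : 2 * d * |lam| < |z.im|) :
    IsResolventAt (hamiltonian lam V) z (resolventAt (hamiltonian lam V) z) := by
  rw [resolventAt, dif_pos (exists_isResolventAt V hz)]
  exact (exists_isResolventAt V hz).choose_spec

theorem IsResolventAt.apply_eq {lam : ℝ} {V : Site d → ℝ} {z : ℂ} {R : Hilb d →L[ℂ] Hilb d}
    (hR : IsResolventAt (hamiltonian lam V) z R) (φ : Hilb d) (x : Site d) :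
    (V x - z) * R φ x = φ x - lam * hopping d (R φ) x := by
  obtain ⟨h, e⟩ := hR.1 φ
  have h1 := congrArg (fun ψ : Hilb d => ψ x) e
  simp only [lp.coeFn_sub, Pi.sub_apply, hamiltonian_apply, andersonAction_eq, lp.coeFn_smul,
        Pi.smul_apply, smul_eq_mul] at h1
  linear_combination h1

section Abstract

variable {E : Type*} [NormedAddCommGroup E] [InnerProductSpace ℂ E]

theorem IsResolventAt.sub_eq {T : E →ₗ.[ℂ] E} {z z' : ℂ} {R R' : E →L[ℂ] E}
    (hR : IsResolventAt T z R) (hR' : IsResolventAt T z' R') :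
    R - R' = (z - z') • (R * R') := by
  ext φ
  obtain ⟨h, e⟩ := hR'.1 φ
  have h1 := hR.2 ⟨R' φ, h⟩
  have h2 : T ⟨R' φ, h⟩ = φ + z' • R' φ := sub_eq_iff_eq_add.1 e
  simp only [h2, map_sub, map_add, map_smul] at h1
  simp only [sub_apply, smul_apply, mul_apply_eq_comp]
  rw [sub_smul]
  have h3 := sub_eq_zero.2 h1
  rw [← sub_eq_zero, ← h3]
  abel

theorem IsResolventAt.adjoint_eq [CompleteSpace E] {T : E →ₗ.[ℂ] E} {z : ℂ} {R R' : E →L[ℂ] E}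
    (hT : ∀ ψ φ : T.domain, inner ℂ (T ψ) (φ : E) = inner ℂ (ψ : E) (T φ))
    (hR : IsResolventAt T z R) (hR' : IsResolventAt T (starRingEnd ℂ z) R') :
    ContinuousLinearMap.adjoint R = R' := by
  symm
  rw [ContinuousLinearMap.eq_adjoint_iff]
  intro φ ψ
  obtain ⟨h, e⟩ := hR.1 ψ
  obtain ⟨h', e'⟩ := hR'.1 φ
  have h1 := hT ⟨R' φ, h'⟩ ⟨R ψ, h⟩
  conv_lhs => rw [← e]
  conv_rhs => rw [← e']
  simp only [inner_sub_right, inner_sub_left, inner_smul_left, inner_smul_right, h1,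
    Complex.conj_conj]

/-- The Cayley transform of a symmetric operator with resolvents at `±i` is unitary. -/
theorem cayley_mem_unitary [CompleteSpace E] {T : E →ₗ.[ℂ] E}
    (hT : ∀ ψ φ : T.domain, inner ℂ (T ψ) (φ : E) = inner ℂ (ψ : E) (T φ))
    (h₁ : ∃ R, IsResolventAt T (-I) R) (h₂ : ∃ R, IsResolventAt T I R) :
    cayley T ∈ unitary (E →L[ℂ] E) := by
  obtain ⟨R', hR'⟩ := h₂
  have hR : IsResolventAt T (-I) (resolventAt T (-I)) := by
    rw [resolventAt, dif_pos h₁]; exact h₁.choose_spec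
  set R := resolventAt T (-I)
  have hstar : star R = R' := hR.adjoint_eq hT (by simpa using hR')
  have e1 := hR'.sub_eq hR
  have e2 := hR.sub_eq hR'
  have hs : star (cayley T) = 1 + (2 * I) • R' := by
    rw [cayley, star_sub, star_smul, hstar, star_one]
    simp [sub_eq_add_neg, ← neg_smul]
  have hI : (2 * I) * (2 * I) = (-4 : ℂ) := by
    linear_combination 4 * I_mul_I
  rw [Unitary.mem_iff, hs, cayley]
  constructor
  · have : (1 + (2 * I) • R') * (1 - (2 * I) • R) =
        1 + (2 * I) • (R' - R) - ((2 * I) * (2 * I)) • (R' * R) := by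
      rw [mul_sub, add_mul, add_mul, smul_mul_smul_comm, smul_sub]
      simp only [one_mul, mul_one]
      abel
    rw [this, e1, smul_smul, show (2 * I) * (I - -I) = (2 * I) * (2 * I) by ring]
    simp
  · have : (1 - (2 * I) • R) * (1 + (2 * I) • R') =
        1 - (2 * I) • (R - R') - ((2 * I) * (2 * I)) • (R * R') := by
      rw [mul_add, sub_mul, sub_mul, smul_mul_smul_comm, smul_sub]
      simp only [one_mul, mul_one]
      abel
    rw [this, e2, smul_smul, show (2 * I) * (-I - I) = -((2 * I) * (2 * I)) by ring]
    simp

end Abstract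

theorem inner_eq_tsum (ψ φ : Hilb d) :
    inner ℂ ψ φ = ∑' x, (starRingEnd ℂ) (ψ x) * φ x := by
  rw [lp.inner_eq_tsum]
  exact tsum_congr fun x => by rw [RCLike.inner_apply, mul_comm]

theorem inner_shift (a : Site d) (ψ φ : Hilb d) :
    inner ℂ (shift a ψ) φ = inner ℂ ψ (shift (-a) φ) := by
  rw [inner_eq_tsum, inner_eq_tsum, ← (Equiv.addRight (-a)).tsum_eq]
  simp

theorem adjoint_shift (a : Site d) : ContinuousLinearMap.adjoint (shift a) = shift (-a) := by
  symm
  rw [ContinuousLinearMap.eq_adjoint_iff]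
  intro ψ φ
  rw [inner_shift, neg_neg]

theorem star_velocity (lam : ℝ) (ν : Fin d) : star (velocity lam ν) = velocity lam ν := by
  have h1 : ∀ a : Site d, star (shift a) = shift (-a) := adjoint_shift
  rw [velocity, star_smul, star_sub, h1, h1, neg_neg]
  simp only [star_def, map_mul, conj_I, conj_ofReal]
  rw [← neg_sub, smul_neg, ← neg_smul]
  congr 1
  ring

theorem hamiltonian_symmetric (lam : ℝ) (V : Site d → ℝ) (ψ φ : (hamiltonian lam V).domain) :
    inner ℂ (hamiltonian lam V ψ) (φ : Hilb d) = inner ℂ (ψ : Hilb d) (hamiltonian lam V φ) := by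
  have hsa : ∀ ψ φ : Hilb d, inner ℂ (hopping d ψ) φ = inner ℂ ψ (hopping d φ) := by
    intro ψ φ
    simp only [hopping, sum_apply, sum_inner, inner_sum, add_apply, inner_add_left, inner_add_right,
      inner_shift, neg_neg]
    exact Finset.sum_congr rfl fun j _ => add_comm _ _
  have hpot : ∀ ψ : (hamiltonian lam V).domain, ∀ x,
      (hamiltonian lam V ψ - (lam : ℂ) • hopping d (ψ : Hilb d)) x = V x * (ψ : Hilb d) x := by
    intro ψ x
    simp only [lp.coeFn_sub, Pi.sub_apply, hamiltonian_apply, andersonAction_eq, lp.coeFn_smul,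
      Pi.smul_apply, smul_eq_mul]
    ring
  have h1 : inner ℂ (hamiltonian lam V ψ - (lam : ℂ) • hopping d (ψ : Hilb d)) (φ : Hilb d) =
      inner ℂ (ψ : Hilb d) (hamiltonian lam V φ - (lam : ℂ) • hopping d (φ : Hilb d)) := by
    rw [inner_eq_tsum, inner_eq_tsum]
    refine tsum_congr fun x => ?_
    rw [hpot, hpot, map_mul, conj_ofReal]
    ring
  rw [inner_sub_left, inner_sub_right, inner_smul_left, inner_smul_right, conj_ofReal, hsa] at h1
  linear_combination h1

theorem cayley_hamiltonian_mem_unitary {lam : ℝ} (hlam : 2 * d * |lam| < 1) (V : Site d → ℝ) :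
    cayley (hamiltonian lam V) ∈ unitary (Hilb d →L[ℂ] Hilb d) :=
  cayley_mem_unitary (hamiltonian_symmetric lam V)
    (exists_isResolventAt V (by simpa using hlam)) (exists_isResolventAt V (by simpa using hlam))

/-! ### The random walk expansion of the resolvent -/

/-- The steps `±e_j` of the nearest-neighbour walk. -/
abbrev Step (d : ℕ) : Type := Fin d × Bool

/-- The unit vector of a step. -/
def stepVec (e : Step d) : Site d := if e.2 then unitVec e.1 else -unitVec e.1

/-- The sites visited by a walk from `x`, including the two end points. -/
def path : Site d → List (Step d) → List (Site d)
  | x, [] => [x]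
  | x, e :: s => x :: path (x + stepVec e) s

/-- The end point of a walk from `x`. -/
def endpoint : Site d → List (Step d) → Site d
  | x, [] => x
  | x, e :: s => endpoint (x + stepVec e) s

theorem length_path (x : Site d) (s : List (Step d)) : (path x s).length = s.length + 1 := by
  induction s generalizing x with
  | nil => rfl
  | cons e s ih => simp [path, ih]

theorem hopping_apply_step (ψ : Hilb d) (x : Site d) :
    hopping d ψ x = ∑ e : Step d, ψ (x + stepVec e) := by
  rw [hopping_apply, Fintype.sum_prod_type]
  simp [stepVec, sub_eq_add_neg]

/-- A list is empty or has a head and a tail. -/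
def listEquivSum (α : Type*) : List α ≃ (α × List α) ⊕ Unit where
  toFun | [] => Sum.inr () | a :: s => Sum.inl (a, s)
  invFun | Sum.inr _ => [] | Sum.inl (a, s) => a :: s
  left_inv s := by cases s <;> rfl
  right_inv o := by rcases o with ⟨a, s⟩ | _ <;> rfl

theorem summable_pow_length {α : Type*} [Fintype α] {q : ℝ} (hq : 0 ≤ q)
    (h : Fintype.card α * q < 1) : Summable fun s : List α => q ^ s.length := by
  rw [← (Equiv.sigmaFiberEquiv (List.length : List α → ℕ)).summable_iff]
  have hval : ∀ n (s : {s : List α // s.length = n}), q ^ (s : List α).length = q ^ n :=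
    fun n s => by rw [s.2]
  have hfin : ∀ n, Finite {s : List α // s.length = n} := fun n =>
    inferInstanceAs (Finite (List.Vector α n))
  rw [summable_sigma_of_nonneg fun p => by exact pow_nonneg hq _]
  refine ⟨fun n => Summable.of_finite, ?_⟩
  have : ∀ n, ∑' s : {s : List α // s.length = n}, q ^ (s : List α).length =
      (Fintype.card α * q) ^ n := by
    intro n
    have hc : Nat.card {s : List α // s.length = n} = Fintype.card α ^ n := by
      change Nat.card (List.Vector α n) = _
      rw [Nat.card_eq_fintype_card, card_vector]
    simp only [hval]
    rw [tsum_const, hc, mul_pow, nsmul_eq_mul]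
    push_cast
    rfl
  exact (summable_geometric_of_lt_one (by positivity) h).congr fun n => (this n).symm

/-- The contribution of the walk `s` from `x` to `((H - z)⁻¹ φ)(x)`. -/
def walkTerm (lam : ℝ) (V : Site d → ℝ) (z : ℂ) (φ : Site d → ℂ) (x : Site d)
    (s : List (Step d)) : ℂ :=
  (-lam : ℂ) ^ s.length * ((path x s).map fun p => (V p - z : ℂ)⁻¹).prod * φ (endpoint x s)

theorem norm_list_prod_le (V : Site d → ℝ) {z : ℂ} (hz : z.im ≠ 0) (l : List (Site d)) :
    ‖(l.map fun p => (V p - z : ℂ)⁻¹).prod‖ ≤ |z.im|⁻¹ ^ l.length := by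
  induction l with
  | nil => simp
  | cons a l ih =>
    rw [List.map_cons, List.prod_cons, norm_mul, List.length_cons, pow_succ']
    exact mul_le_mul (norm_inv_sub_le hz _) ih (norm_nonneg _) (by positivity)

theorem norm_walkTerm_le (lam : ℝ) (V : Site d → ℝ) {z : ℂ} (hz : z.im ≠ 0) {φ : Site d → ℂ} {B : ℝ}
    (hφ : ∀ x, ‖φ x‖ ≤ B) (x : Site d) (s : List (Step d)) :
    ‖walkTerm lam V z φ x s‖ ≤ (|lam| * |z.im|⁻¹) ^ s.length * (|z.im|⁻¹ * B) := by
  have hB : 0 ≤ B := (norm_nonneg _).trans (hφ 0)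
  rw [walkTerm, norm_mul, norm_mul, norm_pow, norm_neg, norm_real, Real.norm_eq_abs]
  calc |lam| ^ s.length * ‖((path x s).map fun p => (V p - z : ℂ)⁻¹).prod‖ * ‖φ (endpoint x s)‖
      ≤ |lam| ^ s.length * |z.im|⁻¹ ^ (s.length + 1) * B := by
        have := norm_list_prod_le V hz (path x s)
        rw [length_path] at this
        gcongr
        exact hφ _
    _ = _ := by rw [mul_pow, pow_succ]; ring

theorem card_step_mul_lt {lam : ℝ} {z : ℂ} (hz : 2 * d * |lam| < |z.im|) :
    (Fintype.card (Step d) : ℝ) * (|lam| * |z.im|⁻¹) < 1 := by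
  have h2 : 0 < |z.im| := lt_of_le_of_lt (by positivity) hz
  simp only [Fintype.card_prod, Fintype.card_fin, Fintype.card_bool]
  push_cast
  calc (d * 2 : ℝ) * (|lam| * |z.im|⁻¹) = (2 * d * |lam|) / |z.im| := by ring
    _ < 1 := (div_lt_one h2).2 hz

theorem summable_walkTerm_bound {lam : ℝ} {z : ℂ} (hz : 2 * d * |lam| < |z.im|) :
    Summable fun s : List (Step d) => (|lam| * |z.im|⁻¹) ^ s.length :=
  summable_pow_length (by positivity) (card_step_mul_lt hz)

/-- The sum over walks satisfies the resolvent equation. -/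
theorem tsum_walkTerm_eq {lam : ℝ} (V : Site d → ℝ) {z : ℂ} (hz : 2 * d * |lam| < |z.im|)
    {φ : Site d → ℂ} {B : ℝ} (hφ : ∀ x, ‖φ x‖ ≤ B) (x : Site d) :
    ∑' s, walkTerm lam V z φ x s = (V x - z : ℂ)⁻¹ *
      (φ x - lam * ∑ e : Step d, ∑' s, walkTerm lam V z φ (x + stepVec e) s) := by
  have hz0 : z.im ≠ 0 := abs_pos.1 (lt_of_le_of_lt (by positivity) hz)
  have hs : ∀ x, Summable (walkTerm lam V z φ x) := fun x =>
    Summable.of_norm_bounded ((summable_walkTerm_bound hz).mul_right _)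
      (norm_walkTerm_le lam V hz0 hφ x)
  have hcons : ∀ e s, walkTerm lam V z φ x (e :: s) =
      (V x - z : ℂ)⁻¹ * (-lam * walkTerm lam V z φ (x + stepVec e) s) := by
    intro e s
    simp only [walkTerm, path, endpoint, List.length_cons, List.map_cons, List.prod_cons, pow_succ]
    ring
  have h1 : Summable fun p : Step d × List (Step d) => walkTerm lam V z φ x (p.1 :: p.2) :=
    (hs x).comp_injective (i := fun p : Step d × List (Step d) => p.1 :: p.2)
      fun p q h => by
        obtain ⟨h1, h2⟩ := List.cons.inj h
        exact Prod.ext h1 h2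
  have h2 : HasSum (fun p : Step d × List (Step d) => walkTerm lam V z φ x (p.1 :: p.2))
      (∑ e, ∑' s, walkTerm lam V z φ x (e :: s)) := by
    have := h1.hasSum
    rwa [h1.tsum_prod, tsum_fintype] at this
  have h3 : HasSum (walkTerm lam V z φ x)
      (walkTerm lam V z φ x [] + ∑ e, ∑' s, walkTerm lam V z φ x (e :: s)) := by
    rw [← (listEquivSum (Step d)).symm.hasSum_iff, add_comm]
    exact HasSum.sum h2 (hasSum_unique _)
  rw [h3.tsum_eq]
  simp only [hcons, tsum_mul_left, ← Finset.mul_sum]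
  simp only [walkTerm, path, endpoint, List.length_nil, pow_zero, List.map_cons, List.map_nil,
    List.prod_cons, List.prod_nil]
  ring

/-- Random walk expansion of the resolvent. -/
theorem IsResolventAt.hasSum_walkTerm {lam : ℝ} {V : Site d → ℝ} {z : ℂ}
    {R : Hilb d →L[ℂ] Hilb d} (hR : IsResolventAt (hamiltonian lam V) z R)
    (hz : 2 * d * |lam| < |z.im|) (φ : Hilb d) (x : Site d) :
    HasSum (walkTerm lam V z φ x) (R φ x) := by
  have hz0 : z.im ≠ 0 := abs_pos.1 (lt_of_le_of_lt (by positivity) hz)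
  have hφ : ∀ x, ‖φ x‖ ≤ ‖φ‖ := fun x => lp.norm_apply_le_norm two_ne_zero φ x
  set q : ℝ := Fintype.card (Step d) * (|lam| * |z.im|⁻¹) with hq
  have hq0 : 0 ≤ q := by positivity
  have hq1 : q < 1 := card_step_mul_lt hz
  have hs : ∀ x, Summable (walkTerm lam V z φ x) := fun x =>
    Summable.of_norm_bounded ((summable_walkTerm_bound hz).mul_right _)
      (norm_walkTerm_le lam V hz0 hφ x)
  set S : Site d → ℂ := fun x => ∑' s, walkTerm lam V z φ x s with hS
  set K := ‖R φ‖ + (∑' s : List (Step d), (|lam| * |z.im|⁻¹) ^ s.length) * (|z.im|⁻¹ * ‖φ‖)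
  -- the difference of the two solutions of the resolvent equation is contracted by the factor `q`
  have hbound : ∀ n x, ‖R φ x - S x‖ ≤ q ^ n * K := by
    intro n
    induction n with
    | zero =>
      intro x
      rw [pow_zero, one_mul]
      refine (norm_sub_le _ _).trans (add_le_add (lp.norm_apply_le_norm two_ne_zero _ x) ?_)
      rw [← tsum_mul_right]
      exact tsum_of_norm_bounded ((summable_walkTerm_bound hz).mul_right _).hasSum
        (norm_walkTerm_le lam V hz0 hφ x)
    | succ n ih =>
      intro x
      have e1 : R φ x = (V x - z : ℂ)⁻¹ * (φ x - lam * ∑ e : Step d, R φ (x + stepVec e)) := by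
        rw [← hopping_apply_step, ← hR.apply_eq, inv_mul_cancel_left₀ (sub_ne_zero_of_im hz0 _)]
      have e2 : R φ x - S x = (V x - z : ℂ)⁻¹ *
          (-lam * ∑ e : Step d, (R φ (x + stepVec e) - S (x + stepVec e))) := by
        rw [e1, hS]
        simp only
        rw [tsum_walkTerm_eq V hz hφ x, Finset.sum_sub_distrib]
        ring
      rw [e2, norm_mul, norm_mul, norm_neg, norm_real, Real.norm_eq_abs]
      calc ‖(V x - z : ℂ)⁻¹‖ * (|lam| * ‖∑ e : Step d, (R φ (x + stepVec e) - S (x + stepVec e))‖)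
          ≤ |z.im|⁻¹ * (|lam| * ∑ _e : Step d, q ^ n * K) := by
            gcongr
            · exact norm_inv_sub_le hz0 _
            · exact (norm_sum_le _ _).trans (Finset.sum_le_sum fun e _ => ih _)
        _ = q ^ (n + 1) * K := by
            rw [Finset.sum_const, Finset.card_univ, nsmul_eq_mul, pow_succ, hq]
            ring
  have hzero : R φ x - S x = 0 := by
    rw [← norm_le_zero_iff]
    refine ge_of_tendsto' (f := fun n : ℕ => q ^ n * K) (x := atTop) ?_ fun n => hbound n x
    simpa using (tendsto_pow_atTop_nhds_zero_of_lt_one hq0 hq1).mul_const K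
  rw [sub_eq_zero.1 hzero]
  exact (hs x).hasSum

end

/-! ### The functional calculus -/

section

theorem cayley_inverse_real {w : ℂ} (hw : ‖w‖ = 1) (h1 : w ≠ 1) :
    (((I * (1 + w) / (1 - w)).re : ℝ) : ℂ) = I * (1 + w) / (1 - w) := by
  rw [← conj_eq_iff_re]
  have hw0 : w ≠ 0 := by rintro rfl; simp at hw
  have hc : (starRingEnd ℂ) w = w⁻¹ := by
    rw [inv_def, normSq_eq_norm_sq, hw]; simp
  have h2 : 1 - w ≠ 0 := sub_ne_zero.2 h1.symm
  have h3 : 1 - w⁻¹ ≠ 0 := by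
    rw [sub_ne_zero, ne_comm, Ne, inv_eq_one]
    exact h1
  simp only [map_div₀, map_mul, map_add, map_sub, map_one, conj_I, hc]
  rw [div_eq_div_iff h3 h2]
  field_simp
  ring

/-- Since `f` vanishes at infinity, the corresponding function on the circle is continuous at the
point `1`, the image of infinity. -/
theorem continuous_onCircle (f : C₀(ℝ, ℂ)) :
    Continuous fun w : Metric.sphere (0 : ℂ) 1 => onCircle f w := by
  rw [continuous_iff_continuousAt]
  intro w₀
  by_cases h : (w₀ : ℂ) = 1
  · rw [continuousAt_iff_punctured_nhds]
    have h0 : onCircle f w₀ = 0 := if_pos h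
    rw [h0]
    have hx : Tendsto (fun w : Metric.sphere (0 : ℂ) 1 => (I * (1 + w) / (1 - w)).re) (𝓝[≠] w₀)
        (cocompact ℝ) := by
      rw [← Metric.cobounded_eq_cocompact, ← tendsto_norm_atTop_iff_cobounded]
      have hd : Tendsto (fun w : Metric.sphere (0 : ℂ) 1 => ‖(1 : ℂ) - w‖) (𝓝[≠] w₀) (𝓝[>] 0) := by
        refine tendsto_nhdsWithin_iff.2 ⟨?_, ?_⟩
        · have : Continuous fun w : Metric.sphere (0 : ℂ) 1 => ‖(1 : ℂ) - w‖ := by fun_prop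
          have h2 := this.tendsto w₀
          rw [h, sub_self, norm_zero] at h2
          exact h2.mono_left nhdsWithin_le_nhds
        · filter_upwards [self_mem_nhdsWithin] with w hw
          refine norm_pos_iff.2 (sub_ne_zero.2 fun h' => hw ?_)
          exact Subtype.ext (h'.symm.trans h.symm)
      have h3 := tendsto_atTop_add_const_right _ (-1)
        ((tendsto_inv_nhdsGT_zero.comp hd).const_mul_atTop (two_pos))
      refine tendsto_atTop_mono' _ ?_ h3
      filter_upwards [self_mem_nhdsWithin] with w hw
      have hw1 : (w : ℂ) ≠ 1 := fun h' => hw (Subtype.ext (h'.trans h.symm))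
      have hne : (1 : ℂ) - w ≠ 0 := sub_ne_zero.2 hw1.symm
      have e := cayley_inverse_real (by simp) hw1
      have e2 : (I * (1 + w) / (1 - w) + I) * (1 - (w : ℂ)) = 2 * I := by
        field_simp
        ring
      have e3 := congrArg norm e2
      rw [norm_mul, norm_mul, norm_I, Complex.norm_two, mul_one, ← e] at e3
      have e4 : ‖(((I * (1 + (w : ℂ)) / (1 - w)).re : ℝ) : ℂ) + I‖ ≤
          ‖(I * (1 + (w : ℂ)) / (1 - w)).re‖ + 1 := by
        refine (norm_add_le _ _).trans ?_
        rw [norm_I, norm_real]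
      have e5 : ‖(((I * (1 + (w : ℂ)) / (1 - w)).re : ℝ) : ℂ) + I‖ = 2 * ‖(1 : ℂ) - w‖⁻¹ := by
        rw [← e3, mul_inv_cancel_right₀ (norm_ne_zero_iff.2 hne)]
      simp only [Function.comp]
      linarith
    have h4 : Tendsto (fun w : Metric.sphere (0 : ℂ) 1 => f (I * (1 + w) / (1 - w)).re) (𝓝[≠] w₀)
        (𝓝 0) := (zero_at_infty f).comp hx
    refine h4.congr' ?_
    filter_upwards [self_mem_nhdsWithin] with w hw
    have hw1 : (w : ℂ) ≠ 1 := fun h' => hw (Subtype.ext (h'.trans h.symm))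
    rw [onCircle, if_neg hw1]
  · have hne : (1 : ℂ) - w₀ ≠ 0 := sub_ne_zero.2 (Ne.symm h)
    have h1 : ContinuousAt (fun w : Metric.sphere (0 : ℂ) 1 => f (I * (1 + w) / (1 - w)).re) w₀ := by
      refine f.continuous.continuousAt.comp (continuous_re.continuousAt.comp ?_)
      exact ContinuousAt.div (by fun_prop) (by fun_prop) hne
    refine h1.congr ?_
    have : ∀ᶠ w : Metric.sphere (0 : ℂ) 1 in 𝓝 w₀, (w : ℂ) ≠ 1 :=
      continuous_subtype_val.continuousAt.eventually_ne h
    filter_upwards [this] with w hw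
    rw [onCircle, if_neg hw]

/-- The function on the unit circle that corresponds to `f`, as a continuous function. -/
def toCircle (f : C₀(ℝ, ℂ)) : C(Metric.sphere (0 : ℂ) 1, ℂ) :=
  ⟨fun w => onCircle f w, continuous_onCircle f⟩

theorem toCircle_apply (f : C₀(ℝ, ℂ)) (w : Metric.sphere (0 : ℂ) 1) :
    toCircle f w = onCircle f w := rfl

theorem toCircle_add (f f' : C₀(ℝ, ℂ)) : toCircle (f + f') = toCircle f + toCircle f' := by
  ext w
  simp only [toCircle_apply, onCircle, ContinuousMap.add_apply]
  split_ifs <;> simp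

theorem toCircle_mul (f f' : C₀(ℝ, ℂ)) : toCircle (f * f') = toCircle f * toCircle f' := by
  ext w
  simp only [toCircle_apply, onCircle, ContinuousMap.mul_apply]
  split_ifs <;> simp

theorem toCircle_smul (c : ℂ) (f : C₀(ℝ, ℂ)) : toCircle (c • f) = c • toCircle f := by
  ext w
  simp only [toCircle_apply, onCircle, ContinuousMap.smul_apply]
  split_ifs <;> simp

theorem toCircle_star (f : C₀(ℝ, ℂ)) : toCircle (star f) = star (toCircle f) := by
  ext w
  simp only [toCircle_apply, onCircle, ContinuousMap.star_apply]
  split_ifs <;> simp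

theorem norm_zeroAtInfty_apply_le (f : C₀(ℝ, ℂ)) (x : ℝ) : ‖f x‖ ≤ ‖f‖ :=
  f.toBCF.norm_coe_le_norm x

theorem norm_toCircle_le (f : C₀(ℝ, ℂ)) : ‖toCircle f‖ ≤ ‖f‖ := by
  rw [ContinuousMap.norm_le _ (norm_nonneg _)]
  intro w
  rw [toCircle_apply, onCircle]
  split_ifs
  · simp
  · exact norm_zeroAtInfty_apply_le f _

section Abstract

variable {E : Type*} [NormedAddCommGroup E] [InnerProductSpace ℂ E] [CompleteSpace E]

/-- The continuous functional calculus of a unitary operator on functions on the whole circle. -/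
def circleCalc {U : E →L[ℂ] E} (hU : U ∈ unitary (E →L[ℂ] E)) :
    C(Metric.sphere (0 : ℂ) 1, ℂ) →⋆ₐ[ℂ] (E →L[ℂ] E) :=
  cfcHomSuperset (isStarNormal_of_mem_unitary hU) (by
    rcases subsingleton_or_nontrivial E with h | h
    · intro z hz
      have : Subsingleton (E →L[ℂ] E) := ⟨fun A B => by ext x; exact Subsingleton.elim _ _⟩
      exact absurd (isUnit_of_subsingleton _) hz
    · exact spectrum.subset_circle_of_unitary hU)

theorem circleCalc_id {U : E →L[ℂ] E} (hU : U ∈ unitary (E →L[ℂ] E)) :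
    circleCalc hU (.restrict (Metric.sphere (0 : ℂ) 1) (.id ℂ)) = U :=
  cfcHomSuperset_id _ _

theorem norm_circleCalc_le {U : E →L[ℂ] E} (hU : U ∈ unitary (E →L[ℂ] E))
    (f : C(Metric.sphere (0 : ℂ) 1, ℂ)) : ‖circleCalc hU f‖ ≤ ‖f‖ :=
  NonUnitalStarAlgHom.norm_apply_le _ f

theorem funCalc_eq_circleCalc {T : E →ₗ.[ℂ] E} (hU : cayley T ∈ unitary (E →L[ℂ] E))
    (f : C₀(ℝ, ℂ)) : funCalc T f = circleCalc hU (toCircle f) := by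
  have hsub : spectrum ℂ (cayley T) ⊆ Metric.sphere (0 : ℂ) 1 := by
    rcases subsingleton_or_nontrivial E with h | h
    · intro z hz
      have : Subsingleton (E →L[ℂ] E) := ⟨fun A B => by ext x; exact Subsingleton.elim _ _⟩
      exact absurd (isUnit_of_subsingleton _) hz
    · exact spectrum.subset_circle_of_unitary hU
  have hc : ContinuousOn (onCircle f) (Metric.sphere (0 : ℂ) 1) :=
    continuousOn_iff_continuous_domRestrict.2 (continuous_onCircle f)
  rw [funCalc, cfc_apply _ _ (isStarNormal_of_mem_unitary hU) (hc.mono hsub)]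
  rfl

theorem norm_funCalc_le {T : E →ₗ.[ℂ] E} (hU : cayley T ∈ unitary (E →L[ℂ] E)) (f : C₀(ℝ, ℂ)) :
    ‖funCalc T f‖ ≤ ‖f‖ := by
  rw [funCalc_eq_circleCalc hU]
  exact (norm_circleCalc_le hU _).trans (norm_toCircle_le f)

theorem funCalc_add {T : E →ₗ.[ℂ] E} (hU : cayley T ∈ unitary (E →L[ℂ] E)) (f f' : C₀(ℝ, ℂ)) :
    funCalc T (f + f') = funCalc T f + funCalc T f' := by
  simp only [funCalc_eq_circleCalc hU, toCircle_add, map_add]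

theorem funCalc_mul {T : E →ₗ.[ℂ] E} (hU : cayley T ∈ unitary (E →L[ℂ] E)) (f f' : C₀(ℝ, ℂ)) :
    funCalc T (f * f') = funCalc T f * funCalc T f' := by
  simp only [funCalc_eq_circleCalc hU, toCircle_mul, map_mul]

theorem funCalc_smul {T : E →ₗ.[ℂ] E} (hU : cayley T ∈ unitary (E →L[ℂ] E)) (c : ℂ)
    (f : C₀(ℝ, ℂ)) : funCalc T (c • f) = c • funCalc T f := by
  simp only [funCalc_eq_circleCalc hU, toCircle_smul, map_smul]

theorem funCalc_star {T : E →ₗ.[ℂ] E} (hU : cayley T ∈ unitary (E →L[ℂ] E)) (f : C₀(ℝ, ℂ)) :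
    funCalc T (star f) = star (funCalc T f) := by
  simp only [funCalc_eq_circleCalc hU, toCircle_star, map_star]

/-- The function `x ↦ (x - z)⁻¹` for non-real `z`. -/
def resFun (z : ℂ) (hz : z.im ≠ 0) : C₀(ℝ, ℂ) where
  toFun x := (x - z : ℂ)⁻¹
  continuous_toFun := Continuous.inv₀ (by fun_prop) (sub_ne_zero_of_im hz)
  zero_at_infty' := by
    refine tendsto_inv₀_cobounded.comp ?_
    rw [← Metric.cobounded_eq_cocompact, ← tendsto_norm_atTop_iff_cobounded]
    refine tendsto_atTop_mono (f := fun x : ℝ => ‖x‖ + -‖z‖) (fun x => ?_)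
      (tendsto_atTop_add_const_right _ _ tendsto_norm_cobounded_atTop)
    have := norm_sub_norm_le (x : ℂ) z
    rw [norm_real] at this
    linarith

@[simp] theorem resFun_apply (z : ℂ) (hz : z.im ≠ 0) (x : ℝ) : resFun z hz x = (x - z : ℂ)⁻¹ := rfl

/-- The functional calculus of `x ↦ (x - z)⁻¹` is the resolvent. -/
theorem funCalc_resFun {T : E →ₗ.[ℂ] E} (hU : cayley T ∈ unitary (E →L[ℂ] E))
    (h₁ : ∃ R, IsResolventAt T (-I) R) {z : ℂ} (hz : z.im ≠ 0) {R : E →L[ℂ] E}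
    (hR : IsResolventAt T z R) : funCalc T (resFun z hz) = R := by
  have hR₀ : IsResolventAt T (-I) (resolventAt T (-I)) := by
    rw [resolventAt, dif_pos h₁]; exact h₁.choose_spec
  have hUeq : cayley T = 1 - (2 * I) • resolventAt T (-I) := rfl
  set R₀ := resolventAt T (-I)
  set F := funCalc T (resFun z hz) with hF
  set X : C(Metric.sphere (0 : ℂ) 1, ℂ) := .restrict (Metric.sphere (0 : ℂ) 1) (.id ℂ) with hX
  -- On the circle, `x = i (1 + w) / (1 - w)`, and `(x - z)⁻¹ (x - z) = 1` is multiplied by `1 - w`.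
  have e1 : toCircle (resFun z hz) * (I • (1 + X) - z • (1 - X)) = 1 - X := by
    ext w
    have hXw : X w = w := rfl
    simp only [ContinuousMap.mul_apply, ContinuousMap.sub_apply, ContinuousMap.smul_apply,
      ContinuousMap.add_apply, ContinuousMap.one_apply, hXw, toCircle_apply, onCircle, smul_eq_mul]
    split_ifs with h
    · simp [h]
    · have e := cayley_inverse_real (by simp) h
      have hne : (1 : ℂ) - w ≠ 0 := sub_ne_zero.2 (Ne.symm h)
      rw [resFun_apply]
      have h3 := sub_ne_zero_of_im hz (I * (1 + (w : ℂ)) / (1 - w)).re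
      rw [e] at h3 ⊢
      have e3 : I * (1 + (w : ℂ)) - z * (1 - w) = (I * (1 + w) / (1 - w) - z) * (1 - w) := by
        rw [sub_mul, div_mul_cancel₀ _ hne]
      rw [e3, inv_mul_cancel_left₀ h3]
  have e2 := congrArg (circleCalc hU) e1
  simp only [map_mul, map_sub, map_smul, map_add, map_one, hX, circleCalc_id] at e2
  rw [← funCalc_eq_circleCalc hU, ← hF, hUeq] at e2
  have e3 : I • (1 + (1 - (2 * I) • R₀)) - z • (1 - (1 - (2 * I) • R₀)) =
      (2 * I) • (1 - (z + I) • R₀) := by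
    ext φ
    simp only [sub_apply, smul_apply, add_apply, one_apply_eq_self]
    module
  rw [e3, sub_sub_cancel, mul_smul_comm] at e2
  have hI : (2 * I : ℂ) ≠ 0 := mul_ne_zero two_ne_zero I_ne_zero
  -- With `w` replaced by the Cayley transform `1 - 2 i R₀`, where `R₀ = (T + i)⁻¹`, the identity
  -- becomes a linear equation for `F`, which `R` satisfies as well by the resolvent identity.
  have e4 : F * (1 - (z + I) • R₀) = R₀ := smul_right_injective _ hI e2
  have e5 := hR.sub_eq hR₀
  have e6 := hR₀.sub_eq hR
  have e7 : R = R₀ + (z + I) • (R₀ * R) := by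
    have : (-I - z) = -(z + I) := by ring
    rw [this, neg_smul] at e6
    rw [← sub_eq_iff_eq_add', ← neg_sub, e6, neg_neg]
  have e8 : (1 - (z + I) • R₀) * (1 + (z + I) • R) = 1 := by
    rw [sub_mul, one_mul, mul_add, mul_one, smul_mul_smul_comm, mul_smul, ← smul_add, ← e7]
    abel
  calc F = F * ((1 - (z + I) • R₀) * (1 + (z + I) • R)) := by rw [e8, mul_one]
    _ = R₀ * (1 + (z + I) • R) := by rw [← mul_assoc, e4]
    _ = R := by rw [mul_add, mul_one, mul_smul_comm, ← e7]

/-- Induction over the functional calculus, for a family of unitary operators: a class of families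
of operators that contains the given unitaries, their adjoints and the scalars, and that is stable
under sums, products and pointwise norm limits contains all continuous functions of the
unitaries. -/
theorem circleCalc_induction {Ω : Type*} {U : Ω → E →L[ℂ] E}
    (hU : ∀ ω, U ω ∈ unitary (E →L[ℂ] E)) (P : (Ω → E →L[ℂ] E) → Prop)
    (hconst : ∀ c : ℂ, P fun _ => c • 1) (hgen : P U) (hstar : P fun ω => star (U ω))
    (hadd : ∀ A B, P A → P B → P fun ω => A ω + B ω) (hmul : ∀ A B, P A → P B → P fun ω => A ω * B ω)
    (hlim : ∀ (A : ℕ → Ω → E →L[ℂ] E) (B : Ω → E →L[ℂ] E), (∀ n, P (A n)) →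
      (∀ ω, Tendsto (fun n => A n ω) atTop (𝓝 (B ω))) → P B)
    (f : C(Metric.sphere (0 : ℂ) 1, ℂ)) : P fun ω => circleCalc (hU ω) f := by
  induction f using ContinuousMap.induction_on_of_compact with
  | const c =>
    have : ∀ ω, circleCalc (hU ω) (.const _ c) = c • 1 := fun ω => by
      have : (ContinuousMap.const _ c : C(Metric.sphere (0 : ℂ) 1, ℂ)) = c • 1 := by
        ext; simp
      rw [this, map_smul, map_one]
    simpa only [this] using hconst c
  | id => simpa only [circleCalc_id] using hgen
  | star_id => simpa only [map_star, circleCalc_id] using hstar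
  | add f g hf hg => simpa only [map_add] using hadd _ _ hf hg
  | mul f g hf hg => simpa only [map_mul] using hmul _ _ hf hg
  | frequently f hf =>
    have : ∀ n : ℕ, ∃ g : C(Metric.sphere (0 : ℂ) 1, ℂ), dist g f < 1 / (n + 1) ∧
        P fun ω => circleCalc (hU ω) g := by
      intro n
      obtain ⟨g, hg1, hg2⟩ := (hf.and_eventually (Metric.ball_mem_nhds f
        (Nat.one_div_pos_of_nat (α := ℝ) (n := n)))).exists
      exact ⟨g, hg2, hg1⟩
    choose g hg1 hg2 using this
    have hgf : Tendsto g atTop (𝓝 f) := by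
      rw [tendsto_iff_dist_tendsto_zero]
      exact squeeze_zero (fun _ => dist_nonneg) (fun n => (hg1 n).le)
        tendsto_one_div_add_atTop_nhds_zero_nat
    refine hlim (fun n ω => circleCalc (hU ω) (g n)) _ hg2 fun ω => ?_
    exact ((cfcHomSuperset_continuous _ _).tendsto f).comp hgf

end Abstract

end

/-! ### Covariant families of operators and the trace per unit volume -/

section

variable {d : ℕ}

/-- The canonical basis vector of `ℓ²(ℤᵈ)` at the site `x`. -/
def basisVec (x : Site d) : Hilb d := lp.single 2 x 1

theorem basisVec_apply (x y : Site d) : basisVec x y = if y = x then 1 else 0 := by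
  simp [basisVec, lp.single_apply, Pi.single_apply]

theorem norm_basisVec (x : Site d) : ‖basisVec x‖ = 1 := by
  rw [basisVec, lp.norm_single (by norm_num), norm_one]

theorem inner_basisVec_left (x : Site d) (ψ : Hilb d) : inner ℂ (basisVec x) ψ = ψ x := by
  rw [basisVec, lp.inner_single_left, RCLike.inner_apply, map_one, mul_one]

/-- The matrix element `⟨x| A |y⟩`. -/
def entry (A : Hilb d →L[ℂ] Hilb d) (x y : Site d) : ℂ := A (basisVec y) x

theorem norm_entry_le (A : Hilb d →L[ℂ] Hilb d) (x y : Site d) : ‖entry A x y‖ ≤ ‖A‖ := by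
  refine (lp.norm_apply_le_norm two_ne_zero _ x).trans ?_
  simpa [norm_basisVec] using A.le_opNorm (basisVec y)

theorem entry_star (A : Hilb d →L[ℂ] Hilb d) (x y : Site d) :
    entry (star A) x y = (starRingEnd ℂ) (entry A y x) := by
  rw [entry, entry, ← inner_basisVec_left, ← inner_basisVec_left,
    ContinuousLinearMap.star_eq_adjoint, ContinuousLinearMap.adjoint_inner_right,
    inner_conj_symm]

theorem hasSum_entry_mul_apply (A : Hilb d →L[ℂ] Hilb d) (ψ : Hilb d) (x : Site d) :
    HasSum (fun k => entry A x k * ψ k) (A ψ x) := by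
  have h1 := lp.hasSum_single (p := 2) (by norm_num) ψ
  have h2 := (lp.evalCLM ℂ (fun _ : Site d => ℂ) 2 x).hasSum (A.hasSum h1)
  convert! h2 using 1
  funext k
  have h3 : lp.single 2 k (ψ k) = ψ k • basisVec k := by
    rw [basisVec, ← lp.single_smul, smul_eq_mul, mul_one]
  rw [h3, map_smul, map_smul, smul_eq_mul, mul_comm]
  rfl

theorem entry_add (A B : Hilb d →L[ℂ] Hilb d) (x y : Site d) :
    entry (A + B) x y = entry A x y + entry B x y := rfl

theorem entry_smul (c : ℂ) (A : Hilb d →L[ℂ] Hilb d) (x y : Site d) :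
    entry (c • A) x y = c * entry A x y := rfl

theorem entry_one (x y : Site d) : entry (1 : Hilb d →L[ℂ] Hilb d) x y = if x = y then 1 else 0 :=
  basisVec_apply y x

theorem hasSum_entry_mul (A B : Hilb d →L[ℂ] Hilb d) (x y : Site d) :
    HasSum (fun k => entry A x k * entry B k y) (entry (A * B) x y) :=
  hasSum_entry_mul_apply A (B (basisVec y)) x

/-- A function given by convergent series of measurable functions is measurable. -/
theorem measurable_of_hasSum {Ω ι : Type*} [MeasurableSpace Ω] [Countable ι] {f : ι → Ω → ℂ}
    {g : Ω → ℂ} (hf : ∀ i, Measurable (f i)) (h : ∀ ω, HasSum (fun i => f i ω) (g ω)) :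
    Measurable g :=
  measurable_of_tendsto_metrizable' (atTop : Filter (Finset ι))
    (f := fun s ω => ∑ i ∈ s, f i ω) (fun _ => Finset.measurable_fun_sum _ fun i _ => hf i)
    (tendsto_pi_nhds.2 h)

/-- A family of operators, indexed by the potential, with measurable matrix elements, that is
covariant under translations. -/
structure CovariantFamily (A : (Site d → ℝ) → Hilb d →L[ℂ] Hilb d) : Prop where
  measurable : ∀ x y, Measurable fun V => entry (A V) x y
  covariant : ∀ (a : Site d) V x y, entry (A fun k => V (k + a)) x y = entry (A V) (x + a) (y + a)

namespace CovariantFamily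

variable {A B : (Site d → ℝ) → Hilb d →L[ℂ] Hilb d}

theorem const_smul_one (c : ℂ) :
    CovariantFamily fun _ : Site d → ℝ => (c • 1 : Hilb d →L[ℂ] Hilb d) :=
  ⟨fun _ _ => measurable_const, fun a V x y => by simp [entry_smul, entry_one]⟩

theorem add (hA : CovariantFamily A) (hB : CovariantFamily B) :
    CovariantFamily fun V => A V + B V :=
  ⟨fun x y => (hA.measurable x y).add (hB.measurable x y), fun a V x y => by
    simp only [entry_add, hA.covariant a V, hB.covariant a V]⟩

theorem smul (c : ℂ) (hA : CovariantFamily A) : CovariantFamily fun V => c • A V :=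
  ⟨fun x y => (hA.measurable x y).const_mul c, fun a V x y => by
    simp only [entry_smul, hA.covariant a V]⟩

theorem star (hA : CovariantFamily A) : CovariantFamily fun V => star (A V) :=
  ⟨fun x y => by
    simp only [entry_star]
    exact continuous_conj.measurable.comp (hA.measurable y x),
    fun a V x y => by simp only [entry_star, hA.covariant a V]⟩

theorem mul (hA : CovariantFamily A) (hB : CovariantFamily B) :
    CovariantFamily fun V => A V * B V :=
  ⟨fun x y => measurable_of_hasSum (fun k => (hA.measurable x k).mul (hB.measurable k y))
    fun V => hasSum_entry_mul (A V) (B V) x y, fun a V x y => by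
    refine (hasSum_entry_mul _ _ x y).unique ?_
    simp only [hA.covariant a V, hB.covariant a V]
    exact ((Equiv.addRight a).hasSum_iff
      (f := fun k => entry (A V) (x + a) k * entry (B V) k (y + a))).2
      (hasSum_entry_mul (A V) (B V) (x + a) (y + a))⟩

theorem of_tendsto {F : ℕ → (Site d → ℝ) → Hilb d →L[ℂ] Hilb d} (hF : ∀ n, CovariantFamily (F n))
    (h : ∀ V, Tendsto (fun n => F n V) atTop (𝓝 (A V))) : CovariantFamily A := by
  have hent : ∀ V x y, Tendsto (fun n => entry (F n V) x y) atTop (𝓝 (entry (A V) x y)) := by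
    intro V x y
    rw [tendsto_iff_norm_sub_tendsto_zero]
    refine squeeze_zero (fun _ => norm_nonneg _) (fun n => ?_)
      (tendsto_iff_norm_sub_tendsto_zero.1 (h V))
    exact norm_entry_le (F n V - A V) x y
  refine ⟨fun x y => measurable_of_tendsto_metrizable (fun n => (hF n).measurable x y)
    (tendsto_pi_nhds.2 fun V => hent V x y), fun a V x y => ?_⟩
  refine tendsto_nhds_unique (hent _ x y) ?_
  simp only [(hF _).covariant a V]
  exact hent V _ _

end CovariantFamily

theorem path_add (x a : Site d) (s : List (Step d)) :
    path (x + a) s = (path x s).map (· + a) := by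
  induction s generalizing x with
  | nil => rfl
  | cons e s ih => simp only [path, List.map_cons, ← ih, add_right_comm]

theorem endpoint_add (x a : Site d) (s : List (Step d)) :
    endpoint (x + a) s = endpoint x s + a := by
  induction s generalizing x with
  | nil => rfl
  | cons e s ih => simp only [endpoint, ← ih, add_right_comm]

theorem measurable_list_prod (z : ℂ) (l : List (Site d)) :
    Measurable fun V : Site d → ℝ => (l.map fun p => (V p - z : ℂ)⁻¹).prod := by
  induction l with
  | nil => simp
  | cons a l ih =>
    simp only [List.map_cons, List.prod_cons]
    exact Measurable.mul (by fun_prop) ih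

theorem covariantFamily_resolvent {lam : ℝ} {z : ℂ} (hz : 2 * d * |lam| < |z.im|) :
    CovariantFamily fun V : Site d → ℝ => resolventAt (hamiltonian lam V) z := by
  have hsum := fun (V : Site d → ℝ) (φ : Hilb d) (x : Site d) =>
    (isResolventAt_resolventAt V hz).hasSum_walkTerm hz φ x
  refine ⟨fun x y => measurable_of_hasSum (fun s => ?_) fun V => hsum V (basisVec y) x,
    fun a V x y => (hsum _ (basisVec y) x).unique ?_⟩
  · exact ((measurable_list_prod z _).const_mul _).mul_const _
  · convert! hsum V (basisVec (y + a)) (x + a) using 1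
    funext s
    simp only [walkTerm, path_add, endpoint_add, List.map_map, basisVec_apply, add_left_inj]
    rfl

theorem covariantFamily_funCalc {lam : ℝ} (hlam : 2 * d * |lam| < 1) (f : C₀(ℝ, ℂ)) :
    CovariantFamily fun V : Site d → ℝ => funCalc (hamiltonian lam V) f := by
  have hU := cayley_hamiltonian_mem_unitary (d := d) hlam
  have hgen : CovariantFamily fun V : Site d → ℝ => cayley (hamiltonian lam V) := by
    have h1 := (covariantFamily_resolvent (d := d) (lam := lam) (z := -I) (by simpa using hlam)).smul
      (-(2 * I))
    have h2 := (CovariantFamily.const_smul_one (d := d) 1).add h1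
    simpa only [cayley, one_smul, neg_smul, ← sub_eq_add_neg] using h2
  simp only [fun V => funCalc_eq_circleCalc (hU V)]
  exact circleCalc_induction hU CovariantFamily CovariantFamily.const_smul_one hgen hgen.star
    (fun _ _ => CovariantFamily.add) (fun _ _ => CovariantFamily.mul)
    (fun _ _ => CovariantFamily.of_tendsto) _

theorem covariantFamily_velocity (lam : ℝ) (ν : Fin d) :
    CovariantFamily fun _ : Site d → ℝ => velocity lam ν := by
  refine ⟨fun _ _ => measurable_const, fun a V x y => ?_⟩
  simp only [entry, velocity, smul_apply, sub_apply, lp.coeFn_smul, lp.coeFn_sub, Pi.smul_apply,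
    Pi.sub_apply, shift_apply, basisVec_apply, add_right_comm x a, add_left_inj]

theorem IsSiteDensity.isProbabilityMeasure_disorder {r : ℝ} {g : ℂ → ℂ} (hg : IsSiteDensity r g)
    (d : ℕ) : IsProbabilityMeasure (disorder d g) := by
  have := hg.isProbabilityMeasure
  unfold disorder
  infer_instance

/-- The disorder is invariant under translations. -/
theorem IsSiteDensity.measurePreserving_translate {r : ℝ} {g : ℂ → ℂ} (hg : IsSiteDensity r g)
    (a : Site d) : MeasurePreserving (fun (V : Site d → ℝ) k => V (k + a)) (disorder d g)
      (disorder d g) := by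
  have := hg.isProbabilityMeasure
  have hm : Measurable fun (V : Site d → ℝ) k => V (k + a) := by fun_prop
  refine ⟨hm, Measure.eq_infinitePi (fun _ => siteMeasure g) fun s t ht => ?_⟩
  rw [Measure.map_apply hm (MeasurableSet.pi s.countable_toSet fun i _ => ht i)]
  have hpre : (fun (V : Site d → ℝ) k => V (k + a)) ⁻¹' (Set.pi s t) =
      Set.pi (s.map (Equiv.addRight a).toEmbedding) fun i => t (i - a) := by
    ext V
    simp only [mem_preimage, Set.mem_pi, Finset.mem_coe, Finset.mem_map_equiv]
    constructor
    · intro h i hi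
      have h2 := h _ hi
      simpa [sub_eq_add_neg] using h2
    · intro h i hi
      have h2 := h (i + a) (by simpa using hi)
      simpa using h2
  rw [hpre, disorder, Measure.infinitePi_pi _ fun i _ => ht _, Finset.prod_map]
  simp

theorem traceP_eq_integral_entry (g : ℂ → ℂ) (A : (Site d → ℝ) → Hilb d →L[ℂ] Hilb d) :
    traceP d g A = ∫ V, entry (A V) 0 0 ∂(disorder d g) := by
  simp only [traceP]
  congr 1
  funext V
  exact inner_basisVec_left 0 _

theorem summable_norm_entry_sq (A : Hilb d →L[ℂ] Hilb d) (y : Site d) :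
    Summable (fun x => ‖entry A x y‖ ^ 2) ∧ ∑' x, ‖entry A x y‖ ^ 2 ≤ ‖A‖ ^ 2 := by
  have h1 := (memℓp_gen_iff (p := 2) (by norm_num)).1 (lp.memℓp (A (basisVec y)))
  have h2 := lp.norm_rpow_eq_tsum (p := 2) (by norm_num) (A (basisVec y))
  simp only [ENNReal.toReal_ofNat, Real.rpow_ofNat] at h1 h2
  refine ⟨h1, ?_⟩
  change ∑' x, ‖(A (basisVec y)) x‖ ^ 2 ≤ _
  rw [← h2]
  have := A.le_opNorm (basisVec y)
  rw [norm_basisVec, mul_one] at this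
  gcongr

theorem summable_norm_entry_sq' (A : Hilb d →L[ℂ] Hilb d) (y : Site d) :
    Summable (fun x => ‖entry A y x‖ ^ 2) ∧ ∑' x, ‖entry A y x‖ ^ 2 ≤ ‖A‖ ^ 2 := by
  have h1 : ‖star A‖ = ‖A‖ := norm_star A
  have := summable_norm_entry_sq (star A) y
  simpa only [entry_star, RCLike.norm_conj, h1] using this

/-- The trace per unit volume is cyclic. -/
theorem traceP_mul_comm {r : ℝ} {g : ℂ → ℂ} (hg : IsSiteDensity r g)
    {A B : (Site d → ℝ) → Hilb d →L[ℂ] Hilb d} (hA : CovariantFamily A) (hB : CovariantFamily B)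
    {C : ℝ} (hAC : ∀ V, ‖A V‖ ≤ C) (hBC : ∀ V, ‖B V‖ ≤ C) :
    traceP d g (fun V => A V * B V) = traceP d g fun V => B V * A V := by
  have := hg.isProbabilityMeasure_disorder d
  -- Both traces are sums over sites `x` of averages; summation and averaging commute because the
  -- rows and columns of the operators are square summable, uniformly in the disorder.
  have key : ∀ A B : (Site d → ℝ) → Hilb d →L[ℂ] Hilb d, CovariantFamily A → CovariantFamily B →
      (∀ V, ‖A V‖ ≤ C) → (∀ V, ‖B V‖ ≤ C) → traceP d g (fun V => A V * B V) =
        ∑' x, ∫ V, entry (A V) 0 x * entry (B V) x 0 ∂(disorder d g) := by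
    intro A B hA hB hAC hBC
    rw [traceP_eq_integral_entry]
    simp only [← fun V => (hasSum_entry_mul (A V) (B V) 0 0).tsum_eq]
    have hC : 0 ≤ C := (norm_nonneg _).trans (hAC 0)
    have hle : ∀ V x, ‖entry (A V) 0 x * entry (B V) x 0‖ ≤
        (‖entry (A V) 0 x‖ ^ 2 + ‖entry (B V) x 0‖ ^ 2) / 2 := by
      intro V x
      rw [norm_mul]
      nlinarith [sq_nonneg (‖entry (A V) 0 x‖ - ‖entry (B V) x 0‖)]
    refine (hasSum_integral_of_summable_integral_norm (fun x => ?_) ?_).tsum_eq.symm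
    · refine Integrable.of_bound ((hA.measurable 0 x).mul (hB.measurable x 0)).aestronglyMeasurable
        (C * C) (ae_of_all _ fun V => ?_)
      rw [norm_mul]
      exact mul_le_mul ((norm_entry_le _ _ _).trans (hAC V)) ((norm_entry_le _ _ _).trans (hBC V))
        (norm_nonneg _) hC
    · have hint : ∀ x, Integrable (fun V => ‖entry (A V) 0 x * entry (B V) x 0‖) (disorder d g) := by
        intro x
        refine Integrable.norm (Integrable.of_bound
          ((hA.measurable 0 x).mul (hB.measurable x 0)).aestronglyMeasurable
          (C * C) (ae_of_all _ fun V => ?_))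
        rw [norm_mul]
        exact mul_le_mul ((norm_entry_le _ _ _).trans (hAC V)) ((norm_entry_le _ _ _).trans (hBC V))
          (norm_nonneg _) hC
      refine summable_of_sum_le (c := C ^ 2) (fun x => integral_nonneg fun V => norm_nonneg _)
        fun s => ?_
      rw [← integral_finsetSum _ fun x _ => hint x]
      calc ∫ V, ∑ x ∈ s, ‖entry (A V) 0 x * entry (B V) x 0‖ ∂(disorder d g)
          ≤ ∫ _V, C ^ 2 ∂(disorder d g) := by
            refine integral_mono (integrable_finsetSum _ fun x _ => hint x) (integrable_const _)
              fun V => ?_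
            obtain ⟨a1, a2⟩ := summable_norm_entry_sq' (A V) 0
            obtain ⟨b1, b2⟩ := summable_norm_entry_sq (B V) 0
            have h1 := a1.sum_le_tsum s fun _ _ => sq_nonneg _
            have h2 := b1.sum_le_tsum s fun _ _ => sq_nonneg _
            have h3 : ‖A V‖ ^ 2 ≤ C ^ 2 := pow_le_pow_left₀ (norm_nonneg _) (hAC V) 2
            have h4 : ‖B V‖ ^ 2 ≤ C ^ 2 := pow_le_pow_left₀ (norm_nonneg _) (hBC V) 2
            calc ∑ x ∈ s, ‖entry (A V) 0 x * entry (B V) x 0‖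
                ≤ ∑ x ∈ s, (‖entry (A V) 0 x‖ ^ 2 + ‖entry (B V) x 0‖ ^ 2) / 2 :=
                  Finset.sum_le_sum fun x _ => hle V x
              _ = ((∑ x ∈ s, ‖entry (A V) 0 x‖ ^ 2) + ∑ x ∈ s, ‖entry (B V) x 0‖ ^ 2) / 2 := by
                  rw [← Finset.sum_div, Finset.sum_add_distrib]
              _ ≤ C ^ 2 := by linarith
        _ = C ^ 2 := by simp
  -- Translation by `-x` exchanges the sites `0` and `x` in the summand, up to the sign of `x`.
  rw [key A B hA hB hAC hBC, key B A hB hA hBC hAC, ← (Equiv.neg (Site d)).tsum_eq]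
  refine tsum_congr fun x => ?_
  have hmp := hg.measurePreserving_translate (d := d) (-x)
  have hm : AEStronglyMeasurable (fun V => entry (B V) 0 x * entry (A V) x 0)
      ((disorder d g).map fun V k => V (k + -x)) :=
    ((hB.measurable 0 x).mul (hA.measurable x 0)).aestronglyMeasurable
  conv_rhs => rw [← hmp.map_eq, integral_map hmp.measurable.aemeasurable hm]
  congr 1
  funext V
  rw [hA.covariant, hB.covariant, add_neg_cancel, zero_add, mul_comm]
  rfl

/-- `T(A A*)` is non-negative. -/
theorem traceP_mul_star_nonneg (g : ℂ → ℂ) (A : (Site d → ℝ) → Hilb d →L[ℂ] Hilb d) :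
    0 ≤ traceP d g fun V => A V * star (A V) := by
  simp only [traceP]
  refine integral_nonneg_of_ae (ae_of_all _ fun V => ?_)
  simp only [mul_apply_eq_comp]
  rw [ContinuousLinearMap.star_eq_adjoint, ← ContinuousLinearMap.adjoint_inner_left,
    inner_self_eq_norm_sq_to_K]
  simp only [Pi.zero_apply]
  positivity

end

/-! ### Measures from positive bilinear forms -/

/-- The tent `max 0 (1 - |y|)`. -/
def tent (y : ℝ) : ℝ := max 0 (1 - |y|)

theorem tent_nonneg (y : ℝ) : 0 ≤ tent y := le_max_left _ _

theorem tent_le_one (y : ℝ) : tent y ≤ 1 :=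
  max_le zero_le_one (by linarith [abs_nonneg y])

theorem continuous_tent : Continuous tent := by unfold tent; fun_prop

theorem abs_lt_one_of_tent_ne_zero {y : ℝ} (h : tent y ≠ 0) : |y| < 1 := by
  by_contra! h1
  exact h (max_eq_left (by linarith))

theorem tent_sub_intCast_eq_zero {y : ℝ} {i : ℤ} (h : i ≠ ⌊y⌋) (h' : i ≠ ⌊y⌋ + 1) :
    tent (y - i) = 0 := by
  by_contra h1
  have h2 := abs_lt.1 (abs_lt_one_of_tent_ne_zero h1)
  have h3 := Int.floor_le y
  have h4 := Int.lt_floor_add_one y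
  have h5 : (⌊y⌋ : ℝ) < i + 1 := by linarith
  have h6 : (i : ℝ) < ⌊y⌋ + 2 := by linarith
  have h7 : ⌊y⌋ < i + 1 := by exact_mod_cast h5
  have h8 : i < ⌊y⌋ + 2 := by exact_mod_cast h6
  omega

theorem sum_tent_pair (y : ℝ) : ∑ i ∈ ({⌊y⌋, ⌊y⌋ + 1} : Finset ℤ), tent (y - i) = 1 := by
  rw [Finset.sum_pair (by simp)]
  have h3 := Int.floor_le y
  have h4 := Int.lt_floor_add_one y
  push_cast
  rw [tent, tent, abs_of_nonneg (by linarith), abs_of_nonpos (by linarith),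
    max_eq_right (by linarith), max_eq_right (by linarith)]
  ring

theorem sum_tent_eq_one {y : ℝ} {s : Finset ℤ} (h : ⌊y⌋ ∈ s) (h' : ⌊y⌋ + 1 ∈ s) :
    ∑ i ∈ s, tent (y - i) = 1 := by
  rw [← sum_tent_pair y]
  refine (Finset.sum_subset ?_ ?_).symm
  · intro i hi
    simp only [Finset.mem_insert, Finset.mem_singleton] at hi
    rcases hi with rfl | rfl <;> assumption
  · intro i _ hi
    simp only [Finset.mem_insert, Finset.mem_singleton, not_or] at hi
    exact tent_sub_intCast_eq_zero hi.1 hi.2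

theorem sum_tent_le_one (y : ℝ) (s : Finset ℤ) : ∑ i ∈ s, tent (y - i) ≤ 1 := by
  refine (Finset.sum_le_sum_of_subset_of_nonneg (Finset.subset_union_left
    (s₂ := {⌊y⌋, ⌊y⌋ + 1})) fun _ _ _ => tent_nonneg _).trans ?_
  rw [sum_tent_eq_one] <;> simp

/-- The tents of width `2 / (n + 1)` at the points `i / (n + 1)`. -/
def grid (n : ℕ) (i : ℤ) (x : ℝ) : ℝ := tent ((n + 1) * x - i)

theorem grid_nonneg (n : ℕ) (i : ℤ) (x : ℝ) : 0 ≤ grid n i x := tent_nonneg _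

theorem continuous_grid (n : ℕ) (i : ℤ) : Continuous (grid n i) := by
  have := continuous_tent
  unfold grid
  fun_prop

theorem hasCompactSupport_grid (n : ℕ) (i : ℤ) : HasCompactSupport (grid n i) := by
  refine HasCompactSupport.intro (isCompact_closedBall ((i : ℝ) / (n + 1)) 1) fun x hx => ?_
  by_contra h
  refine hx ?_
  have h1 := abs_lt_one_of_tent_ne_zero h
  have hn : (0 : ℝ) < n + 1 := by positivity
  rw [Metric.mem_closedBall, Real.dist_eq]
  have h2 : x - i / (n + 1) = ((n + 1) * x - i) / (n + 1) := by field_simp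
  rw [h2, abs_div, abs_of_pos hn, div_le_one hn]
  have : (0 : ℝ) ≤ n := n.cast_nonneg
  linarith

/-- A continuous function with compact support, as an element of `C₀`. -/
def zeroAtInftyOfCompact (f : ℝ → ℝ) (hf : Continuous f) (h : HasCompactSupport f) :
    C₀(ℝ, ℂ) where
  toFun x := f x
  continuous_toFun := by fun_prop
  zero_at_infty' := by
    have h1 : HasCompactSupport fun x => (f x : ℂ) := h.comp_left ofReal_zero
    exact h1.is_zero_at_infty

theorem zeroAtInftyOfCompact_apply (f : ℝ → ℝ) (hf : Continuous f) (h : HasCompactSupport f)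
    (x : ℝ) : zeroAtInftyOfCompact f hf h x = f x := rfl

/-- The tent `grid n i` as an element of `C₀`. -/
def gridFun (n : ℕ) (i : ℤ) : C₀(ℝ, ℂ) :=
  zeroAtInftyOfCompact (grid n i) (continuous_grid n i) (hasCompactSupport_grid n i)

@[simp] theorem gridFun_apply (n : ℕ) (i : ℤ) (x : ℝ) : gridFun n i x = grid n i x := rfl

theorem exists_star_mul_self_gridFun (n : ℕ) (i : ℤ) : ∃ h : C₀(ℝ, ℂ), star h * h = gridFun n i := by
  refine ⟨zeroAtInftyOfCompact (fun x => √(grid n i x)) ((continuous_grid n i).sqrt)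
    ((hasCompactSupport_grid n i).comp_left Real.sqrt_zero), ?_⟩
  ext x
  simp only [ZeroAtInftyContinuousMap.coe_mul, ZeroAtInftyContinuousMap.coe_star, Pi.mul_apply,
    Pi.star_apply, zeroAtInftyOfCompact_apply, gridFun_apply, RCLike.star_def, conj_ofReal]
  rw [← ofReal_mul, Real.mul_self_sqrt (grid_nonneg n i x)]

/-- The finite index set of the grid points in `[-(n + 1), n + 1]`. -/
def gridSet (n : ℕ) : Finset ℤ := Finset.Icc (-(n + 1) ^ 2) ((n + 1) ^ 2)

/-- The interpolation of `f` on the grid. -/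
def interpolate (n : ℕ) (f : C₀(ℝ, ℂ)) : C₀(ℝ, ℂ) :=
  ∑ i ∈ gridSet n, f ((i : ℝ) / (n + 1)) • gridFun n i

theorem interpolate_apply (n : ℕ) (f : C₀(ℝ, ℂ)) (x : ℝ) :
    interpolate n f x = ∑ i ∈ gridSet n, f ((i : ℝ) / (n + 1)) * grid n i x := by
  have h : ∀ s : Finset ℤ, (∑ i ∈ s, f ((i : ℝ) / (n + 1)) • gridFun n i) x =
      ∑ i ∈ s, f ((i : ℝ) / (n + 1)) * grid n i x := by
    intro s
    induction s using Finset.induction_on with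
    | empty => simp
    | insert a s ha ih =>
      rw [Finset.sum_insert ha, Finset.sum_insert ha, ← ih]
      rfl
  exact h _

theorem sum_gridFun_apply (s : Finset ℤ) (n : ℕ) (x : ℝ) :
    (∑ i ∈ s, gridFun n i) x = ∑ i ∈ s, grid n i x := by
  induction s using Finset.induction_on with
  | empty => simp
  | insert a s ha ih =>
    rw [Finset.sum_insert ha, Finset.sum_insert ha]
    push_cast at ih ⊢
    rw [← ih]
    rfl

theorem norm_zeroAtInfty_le {f : C₀(ℝ, ℂ)} {c : ℝ} (hc : 0 ≤ c) (h : ∀ x, ‖f x‖ ≤ c) :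
    ‖f‖ ≤ c := by
  rw [← ZeroAtInftyContinuousMap.norm_toBCF_eq_norm]
  exact (BoundedContinuousFunction.norm_le hc).2 h

theorem norm_sum_gridFun_le (n : ℕ) (s : Finset ℤ) : ‖∑ i ∈ s, gridFun n i‖ ≤ 1 := by
  refine norm_zeroAtInfty_le zero_le_one fun x => ?_
  rw [sum_gridFun_apply, norm_real,
    Real.norm_of_nonneg (Finset.sum_nonneg fun i _ => grid_nonneg n i x)]
  exact sum_tent_le_one _ _

/-- Interpolation converges uniformly: by uniform continuity on the range of the grid, and because
`f` is small outside. -/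
theorem tendsto_interpolate (f : C₀(ℝ, ℂ)) :
    Tendsto (fun n => interpolate n f) atTop (𝓝 f) := by
  rw [Metric.tendsto_atTop]
  intro ε hε
  obtain ⟨δ, hδ, hδf⟩ := Metric.uniformContinuous_iff.1
    (ZeroAtInftyContinuousMap.uniformContinuous f) (ε / 3) (by positivity)
  have h0 := f.zero_at_infty'
  rw [Metric.tendsto_nhds] at h0
  have h1 := h0 (ε / 3) (by positivity)
  obtain ⟨R, hR⟩ := Metric.closedBall_compl_subset_of_mem_cocompact h1 0
  obtain ⟨N, hN⟩ := exists_nat_gt (max R (1 / δ))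
  refine ⟨N, fun n hn => ?_⟩
  have hnN : (N : ℝ) ≤ n := by exact_mod_cast hn
  have hn0 : (0 : ℝ) < n + 1 := by positivity
  have hnR : R < n := (le_max_left _ _).trans_lt (hN.trans_le hnN)
  have hnδ : 1 / (n + 1 : ℝ) < δ := by
    have h2 : 1 / δ < n + 1 := by linarith [le_max_right R (1 / δ)]
    rwa [div_lt_comm₀ hδ hn0] at h2
  rw [dist_eq_norm]
  refine (norm_zeroAtInfty_le (c := ε / 3 + ε / 3) (by positivity) fun x => ?_).trans_lt
    (by linarith)
  have hsum := sum_tent_le_one ((n + 1) * x) (gridSet n)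
  have hs0 : (0 : ℝ) ≤ ∑ i ∈ gridSet n, grid n i x := Finset.sum_nonneg fun i _ => grid_nonneg n i x
  have hdec : (interpolate n f - f) x = ∑ i ∈ gridSet n, (f ((i : ℝ) / (n + 1)) - f x) * grid n i x
      + ((∑ i ∈ gridSet n, grid n i x : ℝ) - 1) * f x := by
    rw [ZeroAtInftyContinuousMap.coe_sub, Pi.sub_apply, interpolate_apply]
    simp only [sub_mul, Finset.sum_sub_distrib, ofReal_sum, one_mul, ← Finset.mul_sum]
    ring
  rw [hdec]
  refine (norm_add_le _ _).trans (add_le_add ?_ ?_)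
  · refine (norm_sum_le _ _).trans (le_trans (Finset.sum_le_sum (g := fun i => ε / 3 * grid n i x)
      fun i _ => ?_) ?_)
    · rw [norm_mul, norm_real, Real.norm_of_nonneg (grid_nonneg n i x)]
      by_cases h : grid n i x = 0
      · simp [h]
      · refine mul_le_mul_of_nonneg_right ?_ (grid_nonneg n i x)
        rw [← dist_eq_norm]
        refine (hδf ?_).le
        have h2 := abs_lt_one_of_tent_ne_zero h
        rw [dist_comm, Real.dist_eq]
        have h3 : x - i / (n + 1) = ((n + 1) * x - i) / (n + 1) := by field_simp
        rw [h3, abs_div, abs_of_pos hn0]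
        exact (div_le_div_of_nonneg_right h2.le hn0.le).trans_lt hnδ
    · rw [← Finset.mul_sum]
      exact mul_le_of_le_one_right (by positivity) hsum
  · by_cases hx : |x| ≤ n
    · have hx' := abs_le.1 hx
      have hlo : (-(n + 1) ^ 2 : ℤ) ≤ ⌊(n + 1) * x⌋ := by
        rw [Int.le_floor]
        push_cast
        nlinarith [hx'.1]
      have hhi : ⌊(n + 1) * x⌋ + 1 ≤ ((n + 1) ^ 2 : ℤ) := by
        have h2 : (⌊(n + 1) * x⌋ + 1 : ℝ) ≤ ((n : ℝ) + 1) ^ 2 := by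
          have := Int.floor_le ((n + 1) * x)
          nlinarith [hx'.2]
        exact_mod_cast h2
      have h3 : (∑ i ∈ gridSet n, grid n i x) = 1 :=
        sum_tent_eq_one (Finset.mem_Icc.2 ⟨hlo, by omega⟩) (Finset.mem_Icc.2 ⟨by omega, hhi⟩)
      rw [h3]
      simp only [ofReal_one, sub_self, zero_mul, norm_zero]
      positivity
    · have h2 : ‖f x‖ < ε / 3 := by
        have h3 := hR (show x ∈ (Metric.closedBall 0 R)ᶜ by
          rw [mem_compl_iff, Metric.mem_closedBall, Real.dist_eq, sub_zero]
          linarith)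
        rw [← dist_zero_right]
        exact h3
      rw [norm_mul]
      have h4 : ‖(((∑ i ∈ gridSet n, grid n i x : ℝ) : ℂ) - 1)‖ ≤ 1 := by
        rw [← ofReal_one, ← ofReal_sub, norm_real, Real.norm_eq_abs, abs_le]
        have : ∑ i ∈ gridSet n, grid n i x ≤ 1 := hsum
        constructor <;> linarith
      calc _ ≤ 1 * ‖f x‖ := mul_le_mul_of_nonneg_right h4 (norm_nonneg _)
        _ ≤ ε / 3 := by linarith

/-- A bounded bilinear form on `C₀(ℝ)` that is nonnegative on pairs of nonnegative functions is
given by a finite measure on the plane. The measure is found as a limit of the discrete measures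
`∑ B(φ_i, φ_j) δ_{(x_i, x_j)}` with the tents `φ_i` of a grid of points `x_i`. -/
theorem exists_measure_of_bilinear (B : C₀(ℝ, ℂ) →ₗ[ℂ] C₀(ℝ, ℂ) →ₗ[ℂ] ℂ) {C : ℝ}
    (hC0 : 0 ≤ C) (hC : ∀ f f', ‖B f f'‖ ≤ C * ‖f‖ * ‖f'‖)
    (hB : ∀ h k, 0 ≤ B (star h * h) (star k * k)) :
    ∃ μ : Measure (ℝ × ℝ), IsFiniteMeasure μ ∧ ∀ f f', B f f' = ∫ p, f p.1 * f' p.2 ∂μ := by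
  have hpos : ∀ n i m j, 0 ≤ B (gridFun n i) (gridFun m j) := by
    intro n i m j
    obtain ⟨h, hh⟩ := exists_star_mul_self_gridFun n i
    obtain ⟨k, hk⟩ := exists_star_mul_self_gridFun m j
    rw [← hh, ← hk]
    exact hB h k
  have hre : ∀ n i m j, B (gridFun n i) (gridFun m j) = (B (gridFun n i) (gridFun m j)).re :=
    fun n i m j => Complex.ext_iff.2
      ⟨rfl, by simpa using (Complex.nonneg_iff.1 (hpos n i m j)).2.symm⟩
  have hre0 : ∀ n i m j, 0 ≤ (B (gridFun n i) (gridFun m j)).re :=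
    fun n i m j => (Complex.nonneg_iff.1 (hpos n i m j)).1
  have hinterp : ∀ n f f', B (interpolate n f) (interpolate n f') =
      ∑ i ∈ gridSet n, ∑ j ∈ gridSet n, f ((i : ℝ) / (n + 1)) * f' ((j : ℝ) / (n + 1)) *
        B (gridFun n i) (gridFun n j) := by
    intro n f f'
    simp only [interpolate, map_sum, LinearMap.sum_apply, map_smul, LinearMap.smul_apply,
      smul_eq_mul, Finset.mul_sum]
    rw [Finset.sum_comm]
    refine Finset.sum_congr rfl fun i _ => Finset.sum_congr rfl fun j _ => by ring
  -- the integral of `F` over the `n`-th discrete measure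
  let D (n : ℕ) (F : ℝ × ℝ → ℝ) : ℝ := ∑ i ∈ gridSet n, ∑ j ∈ gridSet n,
    F ((i : ℝ) / (n + 1), (j : ℝ) / (n + 1)) * (B (gridFun n i) (gridFun n j)).re
  have hmass : ∀ n, ∑ i ∈ gridSet n, ∑ j ∈ gridSet n, (B (gridFun n i) (gridFun n j)).re ≤ C := by
    intro n
    have h1 : ∑ i ∈ gridSet n, ∑ j ∈ gridSet n, (B (gridFun n i) (gridFun n j)).re =
        (B (∑ i ∈ gridSet n, gridFun n i) (∑ j ∈ gridSet n, gridFun n j)).re := by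
      simp only [map_sum, LinearMap.sum_apply, Complex.re_sum]
      rw [Finset.sum_comm]
    rw [h1]
    refine (Complex.re_le_norm _).trans ((hC _ _).trans ?_)
    have h2 := norm_sum_gridFun_le n (gridSet n)
    have h3 : ‖∑ i ∈ gridSet n, gridFun n i‖ * ‖∑ i ∈ gridSet n, gridFun n i‖ ≤ 1 :=
      mul_le_one₀ h2 (norm_nonneg _) h2
    rw [mul_assoc]
    exact mul_le_of_le_one_right hC0 h3
  have hD : ∀ n F c, (∀ p, |F p| ≤ c) → |D n F| ≤ c * C := by
    intro n F c hF
    have hc : 0 ≤ c := (abs_nonneg _).trans (hF 0)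
    refine le_trans ?_ (mul_le_mul_of_nonneg_left (hmass n) hc)
    rw [Finset.mul_sum]
    refine (Finset.abs_sum_le_sum_abs _ _).trans (Finset.sum_le_sum fun i _ => ?_)
    rw [Finset.mul_sum]
    refine (Finset.abs_sum_le_sum_abs _ _).trans (Finset.sum_le_sum fun j _ => ?_)
    rw [abs_mul, abs_of_nonneg (hre0 _ _ _ _)]
    exact mul_le_mul_of_nonneg_right (hF _) (hre0 _ _ _ _)
  -- Along an ultrafilter all the bounded sequences converge at once, to a positive functional.
  have hlim : ∀ F : C_c(ℝ × ℝ, ℝ), ∃ L, Tendsto (fun n => D n F) (hyperfilter ℕ) (𝓝 L) := by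
    intro F
    obtain ⟨c, hc⟩ := F.hasCompactSupport.exists_bound_of_continuous F.continuous
    have h1 : ∀ n, D n F ∈ Icc (-(c * C)) (c * C) := fun n => abs_le.1 (hD n F c hc)
    obtain ⟨L, -, hL⟩ := (isCompact_Icc (a := -(c * C)) (b := c * C)).ultrafilter_le_nhds
      ((hyperfilter ℕ).map fun n => D n F)
      (le_principal_iff.2 (mem_map.2 (univ_mem' h1)))
    exact ⟨L, hL⟩
  choose Λ hΛ using hlim
  have hDnonneg : ∀ n (F : C_c(ℝ × ℝ, ℝ)), 0 ≤ F → 0 ≤ D n F := fun n F hF =>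
    Finset.sum_nonneg fun i _ => Finset.sum_nonneg fun j _ => mul_nonneg (hF _) (hre0 _ _ _ _)
  let Λlin : C_c(ℝ × ℝ, ℝ) →ₗ[ℝ] ℝ :=
    { toFun := Λ
      map_add' := fun F G => by
        refine tendsto_nhds_unique (hΛ (F + G)) ?_
        convert! (hΛ F).add (hΛ G) using 1
        funext n
        simp only [D, CompactlySupportedContinuousMap.coe_add, Pi.add_apply, add_mul,
          Finset.sum_add_distrib]
      map_smul' := fun c F => by
        refine tendsto_nhds_unique (hΛ (c • F)) ?_
        convert! (hΛ F).const_mul c using 1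
        funext n
        simp only [D, CompactlySupportedContinuousMap.coe_smul, Pi.smul_apply, smul_eq_mul,
          Finset.mul_sum, mul_assoc] }
  let Λp : C_c(ℝ × ℝ, ℝ) →ₚ[ℝ] ℝ := PositiveLinearMap.mk₀ Λlin fun F hF =>
    ge_of_tendsto' (hΛ F) fun n => hDnonneg n F hF
  set μ := RealRMK.rieszMeasure Λp with hμ
  have hint : ∀ F : C_c(ℝ × ℝ, ℝ), ∫ p, F p ∂μ = Λ F := RealRMK.integral_rieszMeasure Λp
  have hfin : IsFiniteMeasure μ := by
    constructor
    rw [isOpen_univ.measure_eq_iSup_isCompact]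
    refine lt_of_le_of_lt (iSup₂_le fun K _ => iSup_le fun hK => ?_)
      (ENNReal.ofReal_lt_top (r := 1 * C))
    obtain ⟨f, hf1, -, hfc, hf01⟩ := exists_continuous_one_zero_of_isCompact hK isClosed_empty
      (disjoint_empty K)
    refine (RealRMK.rieszMeasure_le_of_eq_one (f := ⟨f, hfc⟩) Λp (fun x => (hf01 x).1) hK
      fun x hx => hf1 hx).trans (ENNReal.ofReal_le_ofReal ?_)
    refine le_of_tendsto' (hΛ ⟨f, hfc⟩) fun n => (le_abs_self _).trans (hD n _ 1 fun p => ?_)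
    exact abs_le.2 ⟨le_trans (by norm_num) (hf01 p).1, (hf01 p).2⟩
  refine ⟨μ, hfin, ?_⟩
  have hcont : ∀ (u v : ℕ → C₀(ℝ, ℂ)) f f' (l : Filter ℕ), Tendsto u l (𝓝 f) →
      Tendsto v l (𝓝 f') → Tendsto (fun n => B (u n) (v n)) l (𝓝 (B f f')) := by
    intro u v f f' l hu hv
    have h1 : Continuous fun p : C₀(ℝ, ℂ) × C₀(ℝ, ℂ) => B.mkContinuous₂ C hC p.1 p.2 :=
      ((B.mkContinuous₂ C hC).continuous.comp continuous_fst).clm_apply continuous_snd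
    exact (h1.tendsto (f, f')).comp (hu.prodMk_nhds hv)
  -- The claim for the tents is the definition of `μ`; the general case follows by interpolation.
  have hgrid : ∀ n i j, B (gridFun n i) (gridFun n j) =
      ∫ p, gridFun n i p.1 * gridFun n j p.2 ∂μ := by
    intro n i j
    let F : C_c(ℝ × ℝ, ℝ) :=
      { toFun := fun p => grid n i p.1 * grid n j p.2
        continuous_toFun := ((continuous_grid n i).comp continuous_fst).mul
          ((continuous_grid n j).comp continuous_snd)
        hasCompactSupport' := by
          refine HasCompactSupport.intro
            ((hasCompactSupport_grid n i).prod (hasCompactSupport_grid n j)) fun p hp => ?_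
          by_contra h
          exact hp ⟨subset_tsupport _ (left_ne_zero_of_mul h),
            subset_tsupport _ (right_ne_zero_of_mul h)⟩ }
    have h1 : Tendsto (fun k => ((D k F : ℝ) : ℂ)) (hyperfilter ℕ) (𝓝 (Λ F : ℂ)) :=
      (continuous_ofReal.tendsto _).comp (hΛ F)
    have h2 := hcont _ _ _ _ _ (tendsto_interpolate (gridFun n i))
      (tendsto_interpolate (gridFun n j))
    have h3 : ∀ k, ((D k F : ℝ) : ℂ) =
        B (interpolate k (gridFun n i)) (interpolate k (gridFun n j)) := by
      intro k
      rw [hinterp]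
      simp only [D, ofReal_sum, ofReal_mul]
      refine Finset.sum_congr rfl fun i' _ => Finset.sum_congr rfl fun j' _ => ?_
      rw [hre k i' k j', ofReal_re]
      change ((grid n i _ * grid n j _ : ℝ) : ℂ) * _ = _
      rw [ofReal_mul]
      rfl
    simp only [h3] at h1
    rw [tendsto_nhds_unique (h2.mono_left Nat.hyperfilter_le_atTop) h1, ← hint F,
      ← integral_complex_ofReal]
    refine integral_congr_ae (.of_forall fun p => ?_)
    exact ofReal_mul _ _
  intro f f'
  refine tendsto_nhds_unique (hcont _ _ _ _ _ (tendsto_interpolate f) (tendsto_interpolate f')) ?_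
  have happ : ∀ (f : C₀(ℝ, ℂ)) x, Tendsto (fun n => interpolate n f x) atTop (𝓝 (f x)) := by
    intro f x
    have h1 := ZeroAtInftyContinuousMap.tendsto_iff_tendstoUniformly.1 (tendsto_interpolate f)
    exact h1.tendsto_at x
  have hnorm : ∀ (n : ℕ) (f : C₀(ℝ, ℂ)) x, ‖interpolate n f x‖ ≤ ‖f‖ := by
    intro n f x
    rw [interpolate_apply]
    refine (norm_sum_le _ _).trans (le_trans (Finset.sum_le_sum (g := fun i => ‖f‖ * grid n i x)
      fun i _ => ?_) ?_)
    · rw [norm_mul, norm_real, Real.norm_of_nonneg (grid_nonneg n i x)]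
      exact mul_le_mul_of_nonneg_right (norm_zeroAtInfty_apply_le f _) (grid_nonneg n i x)
    · rw [← Finset.mul_sum]
      exact mul_le_of_le_one_right (norm_nonneg _) (sum_tent_le_one _ _)
  have hB2 : ∀ n, B (interpolate n f) (interpolate n f') =
      ∫ p, interpolate n f p.1 * interpolate n f' p.2 ∂μ := by
    intro n
    have hbd : ∀ i j, Integrable (fun p : ℝ × ℝ => f ((i : ℤ) / (n + 1)) *
        f' ((j : ℤ) / (n + 1)) * (gridFun n i p.1 * gridFun n j p.2)) μ := by
      intro i j
      refine Integrable.const_mul (Integrable.of_bound (C := ‖gridFun n i‖ * ‖gridFun n j‖)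
        (by fun_prop) (.of_forall fun p => ?_)) _
      rw [norm_mul]
      exact mul_le_mul (norm_zeroAtInfty_apply_le _ _) (norm_zeroAtInfty_apply_le _ _)
        (norm_nonneg _) (norm_nonneg _)
    rw [hinterp]
    simp only [hgrid, ← integral_const_mul]
    have h1 : ∀ p : ℝ × ℝ, interpolate n f p.1 * interpolate n f' p.2 =
        ∑ i ∈ gridSet n, ∑ j ∈ gridSet n, f ((i : ℤ) / (n + 1)) * f' ((j : ℤ) / (n + 1)) *
          (gridFun n i p.1 * gridFun n j p.2) := by
      intro p
      rw [interpolate_apply, interpolate_apply, Finset.sum_mul_sum]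
      refine Finset.sum_congr rfl fun i' _ => Finset.sum_congr rfl fun j' _ => ?_
      rw [gridFun_apply, gridFun_apply]
      ring
    simp only [h1]
    rw [integral_finsetSum _ fun i _ => integrable_finsetSum _ fun j _ => hbd i j]
    exact Finset.sum_congr rfl fun i _ => (integral_finsetSum _ fun j _ => hbd i j).symm
  simp only [hB2]
  refine tendsto_integral_of_dominated_convergence (fun _ => ‖f‖ * ‖f'‖)
    (fun n => by fun_prop) (integrable_const _) (fun n => .of_forall fun p => ?_)
    (.of_forall fun p => (happ f p.1).mul (happ f' p.2))
  rw [norm_mul]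
  exact mul_le_mul (hnorm n f _) (hnorm n f' _) (norm_nonneg _) (norm_nonneg _)

/-- A bounded positive linear functional on `C₀(ℝ)` is integration against a finite measure. -/
theorem exists_measure_of_linear (L : C₀(ℝ, ℂ) →ₗ[ℂ] ℂ) {C : ℝ} (hC0 : 0 ≤ C)
    (hC : ∀ f, ‖L f‖ ≤ C * ‖f‖) (hL : ∀ h, 0 ≤ L (star h * h)) :
    ∃ μ : Measure ℝ, IsFiniteMeasure μ ∧ ∀ f, L f = ∫ x, f x ∂μ := by
  -- The form `(f, f') ↦ L f * f' 0` reduces the claim to the one for bilinear forms.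
  obtain ⟨N, hN, hNf⟩ := exists_measure_of_bilinear
    (LinearMap.mk₂ ℂ (fun f f' => L f * f' 0) (fun _ _ _ => by rw [map_add, add_mul])
      (fun c f f' => by rw [map_smul, smul_eq_mul, smul_eq_mul, mul_assoc])
      (fun f f' f'' => by rw [ZeroAtInftyContinuousMap.coe_add, Pi.add_apply, mul_add])
      (fun c f f' => by
        rw [ZeroAtInftyContinuousMap.coe_smul, Pi.smul_apply, smul_eq_mul, smul_eq_mul]; ring))
    hC0 (fun f f' => by
      rw [LinearMap.mk₂_apply, norm_mul]
      exact mul_le_mul (hC f) (norm_zeroAtInfty_apply_le f' 0) (norm_nonneg _)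
        (mul_nonneg hC0 (norm_nonneg _)))
    (fun h k => mul_nonneg (hL h) (star_mul_self_nonneg (k 0)))
  let w (p : ℝ × ℝ) : ℝ≥0∞ := ENNReal.ofReal (grid 0 0 p.2)
  have hw : Measurable w :=
    ENNReal.measurable_ofReal.comp ((continuous_grid 0 0).measurable.comp measurable_snd)
  have hfin : IsFiniteMeasure (N.withDensity w) := by
    refine isFiniteMeasure_withDensity_ofReal (Integrable.of_bound (C := 1)
      ((continuous_grid 0 0).comp continuous_snd).aestronglyMeasurable (.of_forall fun p => ?_)).2
    rw [Function.comp_apply, Real.norm_of_nonneg (grid_nonneg _ _ _)]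
    exact tent_le_one _
  refine ⟨(N.withDensity w).map Prod.fst, inferInstance, fun f => ?_⟩
  rw [integral_map (by fun_prop) (by fun_prop),
    integral_withDensity_eq_integral_toReal_smul hw (.of_forall fun _ => ENNReal.ofReal_lt_top)]
  have h1 := hNf f (gridFun 0 0)
  have h2 : gridFun 0 0 0 = 1 := by
    rw [gridFun_apply]
    simp [grid, tent]
  rw [LinearMap.mk₂_apply, h2, mul_one] at h1
  rw [h1]
  refine integral_congr_ae (.of_forall fun p => ?_)
  simp only [w, ENNReal.toReal_ofReal (grid_nonneg _ _ _), gridFun_apply, real_smul]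
  rw [mul_comm]

/-! ### Spectral measures and the averaged trace of `f(H)` -/

theorem exists_isSpectralMeasure {E : Type*} [NormedAddCommGroup E] [InnerProductSpace ℂ E]
    [CompleteSpace E] {T : E →ₗ.[ℂ] E} (hU : cayley T ∈ unitary (E →L[ℂ] E)) (φ : E) :
    ∃ μ, IsSpectralMeasure T φ μ := by
  let L : C₀(ℝ, ℂ) →ₗ[ℂ] ℂ :=
    { toFun := fun f => inner ℂ φ (funCalc T f φ)
      map_add' := fun f f' => by
        rw [funCalc_add hU, add_apply, inner_add_right]
      map_smul' := fun c f => by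
        rw [funCalc_smul hU, smul_apply, inner_smul_right]
        rfl }
  obtain ⟨μ, hμ, h⟩ := exists_measure_of_linear L (C := ‖φ‖ * ‖φ‖) (by positivity) (fun f => by
      refine (norm_inner_le_norm _ _).trans ?_
      have h1 := ((funCalc T f).le_opNorm φ).trans
        (mul_le_mul_of_nonneg_right (norm_funCalc_le hU f) (norm_nonneg φ))
      nlinarith [norm_nonneg φ]) (fun h => by
      change 0 ≤ inner ℂ φ (funCalc T (star h * h) φ)
      rw [funCalc_mul hU, funCalc_star hU, mul_apply_eq_comp,
        ContinuousLinearMap.star_eq_adjoint, ContinuousLinearMap.adjoint_inner_right,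
        inner_self_eq_norm_sq_to_K]
      positivity)
  exact ⟨μ, hμ, h⟩

theorem isSpectralMeasure_spectralMeasure {E : Type*} [NormedAddCommGroup E]
    [InnerProductSpace ℂ E] [CompleteSpace E] {T : E →ₗ.[ℂ] E}
    (hU : cayley T ∈ unitary (E →L[ℂ] E)) (φ : E) :
    IsSpectralMeasure T φ (spectralMeasure T φ) := by
  have h := exists_isSpectralMeasure hU φ
  rw [spectralMeasure, dif_pos h]
  exact h.choose_spec

/-! ### Half-lines as limits of functions in `C₀`, and the measure of the density of states -/

section

/-- Functions in `C₀` that are bounded by one and converge pointwise to the indicator function of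
`(-∞, E]`. -/
def halfLine (n : ℕ) (E : ℝ) : C₀(ℝ, ℂ) :=
  zeroAtInftyOfCompact (fun x => max 0 (min 1 (n * (E - x) + 1)) * tent (x / (n + 1)))
    (by have := continuous_tent; fun_prop) (by
      refine HasCompactSupport.intro (isCompact_closedBall (0 : ℝ) (n + 1)) fun x hx => ?_
      by_contra h
      refine hx ?_
      have h1 := abs_lt_one_of_tent_ne_zero (right_ne_zero_of_mul h)
      have hn : (0 : ℝ) < n + 1 := by positivity
      rw [abs_div, abs_of_pos hn, div_lt_one hn] at h1
      rw [Metric.mem_closedBall, Real.dist_eq, sub_zero]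
      exact h1.le)

theorem halfLine_apply (n : ℕ) (E x : ℝ) :
    halfLine n E x = (max 0 (min 1 (n * (E - x) + 1)) * tent (x / (n + 1)) : ℝ) := rfl

theorem norm_halfLine_le (n : ℕ) (E x : ℝ) : ‖halfLine n E x‖ ≤ 1 := by
  rw [halfLine_apply, norm_real, Real.norm_of_nonneg (mul_nonneg (le_max_left _ _) (tent_nonneg _))]
  exact mul_le_one₀ (max_le zero_le_one (min_le_left _ _)) (tent_nonneg _) (tent_le_one _)

theorem tendsto_halfLine (E x : ℝ) :
    Tendsto (fun n => halfLine n E x) atTop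
      (𝓝 (((Iic E).indicator (fun _ => (1 : ℝ)) x : ℝ) : ℂ)) := by
  simp only [halfLine_apply]
  refine (continuous_ofReal.tendsto _).comp ?_
  have h1 : Tendsto (fun n : ℕ => tent (x / (n + 1))) atTop (𝓝 1) := by
    have h2 : Tendsto (fun n : ℕ => x / ((n : ℝ) + 1)) atTop (𝓝 0) :=
      tendsto_const_nhds.div_atTop (tendsto_atTop_add_const_right _ _ tendsto_natCast_atTop_atTop)
    have h3 : tent 0 = 1 := by simp [tent]
    have h4 := (continuous_tent.tendsto 0).comp h2
    rwa [h3] at h4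
  rw [← mul_one ((Iic E).indicator _ x)]
  refine Tendsto.mul (tendsto_const_nhds.congr' ?_) h1
  by_cases hx : x ≤ E
  · refine .of_forall fun n => ?_
    rw [indicator_of_mem (mem_Iic.2 hx)]
    have : (0 : ℝ) ≤ n * (E - x) := mul_nonneg n.cast_nonneg (by linarith)
    beta_reduce
    rw [min_eq_left (by linarith), max_eq_right zero_le_one]
  · rw [indicator_of_notMem (by simpa using hx)]
    have h2 : 0 < x - E := by linarith [not_le.1 hx]
    obtain ⟨N, hN⟩ := exists_nat_gt (1 / (x - E))
    refine eventually_atTop.2 ⟨N, fun n hn => ?_⟩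
    have hnN : (N : ℝ) ≤ n := by exact_mod_cast hn
    have h3 := (div_lt_iff₀ h2).1 (hN.trans_le hnN)
    beta_reduce
    rw [max_eq_left ((min_le_right _ _).trans (by linarith))]

theorem tendsto_integral_halfLine (μ : Measure ℝ) [IsFiniteMeasure μ] (E : ℝ) :
    Tendsto (fun n => ∫ x, halfLine n E x ∂μ) atTop (𝓝 (μ.real (Iic E))) := by
  have h := tendsto_integral_of_dominated_convergence (μ := μ) (fun _ => 1)
    (F := fun n x => halfLine n E x) (fun n => by fun_prop) (integrable_const _)
    (fun n => .of_forall fun x => norm_halfLine_le n E x)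
    (.of_forall fun x => tendsto_halfLine E x)
  rwa [integral_complex_ofReal, integral_indicator measurableSet_Iic, integral_const,
    measureReal_restrict_apply_univ, smul_eq_mul, mul_one] at h

theorem tendsto_integral_halfLine_mul (μ : Measure (ℝ × ℝ)) [IsFiniteMeasure μ] (E E' : ℝ) :
    Tendsto (fun n => ∫ p, halfLine n E p.1 * halfLine n E' p.2 ∂μ) atTop
      (𝓝 (μ.real (Iic E ×ˢ Iic E'))) := by
  have h := tendsto_integral_of_dominated_convergence (μ := μ) (fun _ => 1)
    (F := fun n p => halfLine n E p.1 * halfLine n E' p.2) (fun n => by fun_prop)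
    (integrable_const _)
    (fun n => .of_forall fun p => by
      rw [norm_mul]
      exact mul_le_one₀ (norm_halfLine_le n E _) (norm_nonneg _) (norm_halfLine_le n E' _))
    (.of_forall fun p => (tendsto_halfLine E p.1).mul (tendsto_halfLine E' p.2))
  simp only [← ofReal_mul] at h
  have h2 : ∀ p : ℝ × ℝ, (Iic E).indicator (fun _ => (1 : ℝ)) p.1 *
      (Iic E').indicator (fun _ => (1 : ℝ)) p.2 = (Iic E ×ˢ Iic E').indicator (fun _ => 1) p := by
    intro p
    by_cases h1 : p.1 ≤ E <;> by_cases h2 : p.2 ≤ E' <;> simp [indicator, Prod.le_def, h1, h2]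
  simp only [h2] at h
  rwa [integral_complex_ofReal, integral_indicator (measurableSet_Iic.prod measurableSet_Iic),
    integral_const, measureReal_restrict_apply_univ, smul_eq_mul, mul_one] at h

variable {d : ℕ} {r : ℝ} {g : ℂ → ℂ}

theorem CovariantFamily.integrable {A : (Site d → ℝ) → Hilb d →L[ℂ] Hilb d}
    (hA : CovariantFamily A) (hg : IsSiteDensity r g) {C : ℝ} (hC : ∀ V, ‖A V‖ ≤ C) :
    Integrable (fun V => entry (A V) 0 0) (disorder d g) := by
  have := hg.isProbabilityMeasure_disorder d
  exact .of_bound (hA.measurable 0 0).aestronglyMeasurable C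
    (.of_forall fun V => (norm_entry_le _ _ _).trans (hC V))

theorem norm_traceP_le (hg : IsSiteDensity r g) {A : (Site d → ℝ) → Hilb d →L[ℂ] Hilb d} {C : ℝ}
    (hC : ∀ V, ‖A V‖ ≤ C) : ‖traceP d g A‖ ≤ C := by
  have := hg.isProbabilityMeasure_disorder d
  rw [traceP_eq_integral_entry]
  refine (norm_integral_le_of_norm_le_const (C := C)
    (.of_forall fun V => (norm_entry_le _ _ _).trans (hC V))).trans (by simp)

theorem traceP_add (hg : IsSiteDensity r g) {A B : (Site d → ℝ) → Hilb d →L[ℂ] Hilb d}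
    (hA : CovariantFamily A) (hB : CovariantFamily B) {C C' : ℝ} (hC : ∀ V, ‖A V‖ ≤ C)
    (hC' : ∀ V, ‖B V‖ ≤ C') :
    traceP d g (fun V => A V + B V) = traceP d g A + traceP d g B := by
  simp only [traceP_eq_integral_entry, entry_add]
  exact integral_add (hA.integrable hg hC) (hB.integrable hg hC')

theorem traceP_smul (g : ℂ → ℂ) (c : ℂ) (A : (Site d → ℝ) → Hilb d →L[ℂ] Hilb d) :
    traceP d g (fun V => c • A V) = c * traceP d g A := by
  simp only [traceP_eq_integral_entry, entry_smul]
  exact integral_const_mul _ _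

/-- The measure `N` with `𝒯(f(H)) = ∫ f dN`; its distribution function is the integrated density
of states. -/
theorem exists_measure_traceP_funCalc (hg : IsSiteDensity r g) {lam : ℝ}
    (hlam : 2 * d * |lam| < 1) :
    ∃ N : Measure ℝ, IsFiniteMeasure N ∧
      (∀ f, traceP d g (fun V => funCalc (hamiltonian lam V) f) = ∫ x, f x ∂N) ∧
      ∀ E, ids d g lam E = N.real (Iic E) := by
  have hU := cayley_hamiltonian_mem_unitary (d := d) hlam
  have hP := hg.isProbabilityMeasure_disorder d
  have hcov := covariantFamily_funCalc (d := d) hlam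
  have hbd : ∀ f V, ‖funCalc (hamiltonian (d := d) lam V) f‖ ≤ ‖f‖ :=
    fun f V => norm_funCalc_le (hU V) f
  let L : C₀(ℝ, ℂ) →ₗ[ℂ] ℂ :=
    { toFun := fun f => traceP d g fun V => funCalc (hamiltonian lam V) f
      map_add' := fun f f' => by
        simp only [fun V => funCalc_add (hU V) f f']
        exact traceP_add hg (hcov f) (hcov f') (hbd f) (hbd f')
      map_smul' := fun c f => by
        simp only [fun V => funCalc_smul (hU V) c f]
        exact traceP_smul g c _ }
  obtain ⟨N, hN, hNL⟩ := exists_measure_of_linear L zero_le_one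
    (fun f => by rw [one_mul]; exact norm_traceP_le hg (hbd f)) (fun h => by
      change 0 ≤ traceP d g fun V => funCalc (hamiltonian lam V) (star h * h)
      have h1 : ∀ V, funCalc (hamiltonian lam V) (star h * h) =
          funCalc (hamiltonian (d := d) lam V) (star h) *
            star (funCalc (hamiltonian lam V) (star h)) := by
        intro V
        rw [funCalc_mul (hU V), funCalc_star (hU V), star_star]
      simp only [h1]
      exact traceP_mul_star_nonneg g _)
  refine ⟨N, hN, hNL, fun E => ?_⟩
  have hspec := fun V => isSpectralMeasure_spectralMeasure (hU V) (origin d)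
  have h1 : ∀ n, traceP d g (fun V => funCalc (hamiltonian lam V) (halfLine n E)) =
    ∫ x, halfLine n E x ∂N := fun n => hNL _
  have h2 : Tendsto (fun n => traceP d g fun V => funCalc (hamiltonian lam V) (halfLine n E)) atTop
      (𝓝 (ids d g lam E : ℂ)) := by
    rw [ids, ← integral_complex_ofReal]
    refine tendsto_integral_of_dominated_convergence (fun _ => 1) (fun n => ?_)
      (integrable_const _) (fun n => .of_forall fun V => ?_) (.of_forall fun V => ?_)
    · have h3 := ((hcov (halfLine n E)).measurable 0 0).aestronglyMeasurable (μ := disorder d g)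
      refine h3.congr (.of_forall fun V => ?_)
      exact (inner_basisVec_left 0 _).symm
    · refine (norm_inner_le_norm _ _).trans ?_
      have h4 : ‖origin d‖ = 1 := norm_basisVec 0
      have h5 := ((funCalc (hamiltonian lam V) (halfLine n E)).le_opNorm (origin d))
      have h6 := (hbd (halfLine n E) V).trans
        (norm_zeroAtInfty_le zero_le_one fun x => norm_halfLine_le n E x)
      rw [h4] at h5 ⊢
      linarith
    · simp only [(hspec V).2]
      have := (hspec V).1
      exact tendsto_integral_halfLine _ E
  simp only [h1] at h2
  exact_mod_cast tendsto_nhds_unique h2 (tendsto_integral_halfLine N E)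

end

/-! ### Complex measures that are combinations of positive measures -/

section

theorem isFiniteMeasure_variation {X : Type*} [MeasurableSpace X] (m : ComplexMeasure X) :
    IsFiniteMeasure m.variation := by
  have hfin : ∀ s : SignedMeasure X, IsFiniteMeasure s.totalVariation := fun s => by
    rw [SignedMeasure.totalVariation]
    infer_instance
  have h1 := hfin (ComplexMeasure.re m)
  have h2 := hfin (ComplexMeasure.im m)
  refine isFiniteMeasure_of_le ((ComplexMeasure.re m).totalVariation +
    (ComplexMeasure.im m).totalVariation) (VectorMeasure.variation_le_of_forall_enorm_le
      fun s _ => ?_)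
  have h3 : m s = ((ComplexMeasure.re m s : ℝ) : ℂ) + ((ComplexMeasure.im m s : ℝ) : ℂ) * I :=
    (re_add_im (m s)).symm
  rw [h3, Measure.add_apply]
  refine (enorm_add_le _ _).trans (add_le_add ?_ ?_)
  · rw [enorm_eq_iff_norm_eq.2 (norm_real _)]
    exact SignedMeasure.enorm_le_totalVariation _ s
  · rw [(enorm_eq_iff_norm_eq (y := ComplexMeasure.im m s)).2
      (by rw [norm_mul, norm_I, mul_one, norm_real])]
    exact SignedMeasure.enorm_le_totalVariation _ s

section

variable {X ι : Type*} [MeasurableSpace X] [Fintype ι]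

/-- The complex measure `∑ a_j μ_j`. -/
def combination (a : ι → ℂ) (μ : ι → Measure X) [∀ j, IsFiniteMeasure (μ j)] : ComplexMeasure X :=
  ∑ j, a j • (μ j).toSignedMeasure.toComplexMeasure 0

theorem combination_apply (a : ι → ℂ) (μ : ι → Measure X) [∀ j, IsFiniteMeasure (μ j)] {s : Set X}
    (hs : MeasurableSet s) : combination a μ s = ∑ j, a j * (μ j).real s := by
  have h1 : ∀ j, (μ j).toSignedMeasure.toComplexMeasure 0 s = ((μ j).real s : ℂ) := by
    intro j
    rw [SignedMeasure.toComplexMeasure_apply, Measure.toSignedMeasure_apply_measurable hs]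
    rfl
  rw [combination, FunLike.coe_sum, Finset.sum_apply]
  simp only [smul_apply, h1, smul_eq_mul]

theorem integral_indicator_const_complexMeasure (m : ComplexMeasure X) {s : Set X}
    (hs : MeasurableSet s) (c : ℂ) :
    ∫ᵛ x, s.indicator (fun _ => c) x ∂[ContinuousLinearMap.mul ℝ ℂ; m] = c * m s := by
  have := isFiniteMeasure_variation m
  exact setToFun_indicator_const _ hs (measure_ne_top _ _) c

theorem integral_eq_sum_of_eq_combination (a : ι → ℂ) (μ : ι → Measure X)
    [∀ j, IsFiniteMeasure (μ j)] {m : ComplexMeasure X}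
    (hm : ∀ s, MeasurableSet s → m s = ∑ j, a j * (μ j).real s) {f : X → ℂ} {C : ℝ}
    (hf : Measurable f) (hC : ∀ x, ‖f x‖ ≤ C) :
    ∫ᵛ x, f x ∂[ContinuousLinearMap.mul ℝ ℂ; m] = ∑ j, a j * ∫ x, f x ∂(μ j) := by
  have hfin := isFiniteMeasure_variation m
  have hsimple : ∀ F : SimpleFunc X ℂ,
      ∫ᵛ x, F x ∂[ContinuousLinearMap.mul ℝ ℂ; m] = ∑ j, a j * ∫ x, F x ∂(μ j) := by
    intro F
    induction F using SimpleFunc.induction with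
    | const c hs =>
      rename_i s
      simp only [SimpleFunc.coe_piecewise, SimpleFunc.coe_const, Function.const_zero,
        piecewise_eq_indicator]
      have h1 := integral_indicator_const_complexMeasure m hs c
      change ∫ᵛ x, s.indicator (fun _ => c) x ∂[ContinuousLinearMap.mul ℝ ℂ; m] =
        ∑ j, a j * ∫ x, s.indicator (fun _ => c) x ∂(μ j)
      rw [h1, hm s hs, Finset.mul_sum]
      refine Finset.sum_congr rfl fun j _ => ?_
      rw [integral_indicator hs, integral_const, measureReal_restrict_apply_univ, real_smul]
      ring
    | add hdisj hF hG =>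
      rename_i F G
      simp only [SimpleFunc.coe_add, Pi.add_apply]
      rw [VectorMeasure.integral_fun_add (SimpleFunc.integrable_of_isFiniteMeasure F)
        (SimpleFunc.integrable_of_isFiniteMeasure G), hF, hG, ← Finset.sum_add_distrib]
      refine Finset.sum_congr rfl fun j _ => ?_
      rw [integral_add (SimpleFunc.integrable_of_isFiniteMeasure F)
        (SimpleFunc.integrable_of_isFiniteMeasure G), mul_add]
  rcases isEmpty_or_nonempty X with hX | ⟨⟨x₀⟩⟩
  · simp [VectorMeasure.integral_of_isEmpty, Measure.eq_zero_of_isEmpty]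
  have hC0 : 0 ≤ C := (norm_nonneg _).trans (hC x₀)
  have hs := hf.stronglyMeasurable
  have h1 : Tendsto (fun n => ∫ᵛ x, hs.approxBounded C n x ∂[ContinuousLinearMap.mul ℝ ℂ; m])
      atTop (𝓝 (∫ᵛ x, f x ∂[ContinuousLinearMap.mul ℝ ℂ; m])) :=
    VectorMeasure.tendsto_integral_of_dominated_convergence
    (fun _ => C) (fun n => (hs.approxBounded C n).aestronglyMeasurable) (integrable_const _)
    (fun n => .of_forall fun x => hs.norm_approxBounded_le hC0 n x)
    (.of_forall fun x => hs.tendsto_approxBounded_of_norm_le (hC x))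
  simp only [hsimple] at h1
  refine tendsto_nhds_unique h1 (tendsto_finsetSum _ fun j _ => Tendsto.const_mul _ ?_)
  exact tendsto_integral_of_dominated_convergence (fun _ => C)
    (fun n => (hs.approxBounded C n).aestronglyMeasurable) (integrable_const _)
    (fun n => .of_forall fun x => hs.norm_approxBounded_le hC0 n x)
    (.of_forall fun x => hs.tendsto_approxBounded_of_norm_le (hC x))

end

/-- A complex measure on the plane is determined by the integrals of the products `f(E) f'(E')`. -/
theorem eq_combination_of_integral_eq {ι : Type*} [Fintype ι] (a : ι → ℂ)
    (μ : ι → Measure (ℝ × ℝ)) [∀ j, IsFiniteMeasure (μ j)] {m : ComplexMeasure (ℝ × ℝ)}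
    (hm : ∀ f f' : C₀(ℝ, ℂ), ∫ᵛ p, f p.1 * f' p.2 ∂[ContinuousLinearMap.mul ℝ ℂ; m] =
      ∑ j, a j * ∫ p, f p.1 * f' p.2 ∂(μ j)) : m = combination a μ := by
  have hfin := isFiniteMeasure_variation m
  have hbox : ∀ E E', m (Iic E ×ˢ Iic E') = combination a μ (Iic E ×ˢ Iic E') := by
    intro E E'
    have hbs := measurableSet_Iic (a := E).prod (measurableSet_Iic (a := E'))
    rw [combination_apply a μ hbs]
    have h1 : Tendsto (fun n => ∫ᵛ p, halfLine n E p.1 * halfLine n E' p.2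
          ∂[ContinuousLinearMap.mul ℝ ℂ; m]) atTop
        (𝓝 (∫ᵛ p, (Iic E ×ˢ Iic E').indicator (fun _ => 1) p ∂[ContinuousLinearMap.mul ℝ ℂ; m])) :=
      VectorMeasure.tendsto_integral_of_dominated_convergence
      (fun _ => 1) (fun n => by fun_prop) (integrable_const _)
      (fun n => .of_forall fun p => by
        rw [norm_mul]
        exact mul_le_one₀ (norm_halfLine_le n E _) (norm_nonneg _) (norm_halfLine_le n E' _))
      (.of_forall fun p => by
        have h2 := (tendsto_halfLine E p.1).mul (tendsto_halfLine E' p.2)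
        convert! h2 using 2
        by_cases h1 : p.1 ≤ E <;> by_cases h2 : p.2 ≤ E' <;> simp [indicator, Prod.le_def, h1, h2])
    rw [integral_indicator_const_complexMeasure m hbs, one_mul] at h1
    simp only [hm] at h1
    exact tendsto_nhds_unique h1 (tendsto_finsetSum _ fun j _ =>
      (tendsto_integral_halfLine_mul (μ j) E E').const_mul _)
  have hspan : IsCountablySpanning (range (Iic : ℝ → Set ℝ)) :=
    ⟨fun n => Iic (n : ℝ), fun n => ⟨n, rfl⟩,
      eq_univ_of_forall fun x => mem_iUnion.2 (exists_nat_ge x)⟩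
  refine VectorMeasure.ext_of_generateFrom
    (image2 (fun s t => s ×ˢ t) (range (Iic : ℝ → Set ℝ)) (range Iic)) ?_ ?_
    (isPiSystem_Iic.prod isPiSystem_Iic) ?_
  · rintro _ ⟨_, ⟨E, rfl⟩, _, ⟨E', rfl⟩, rfl⟩
    exact hbox E E'
  · rw [← generateFrom_prod_eq hspan hspan, ← borel_eq_generateFrom_Iic]
  · have hun : (⋃ n : ℕ, Iic (n : ℝ) ×ˢ Iic (n : ℝ)) = univ := by
      refine eq_univ_of_forall fun p => mem_iUnion.2 ?_
      obtain ⟨n, hn⟩ := exists_nat_ge (max p.1 p.2)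
      exact ⟨n, (le_max_left _ _).trans hn, (le_max_right _ _).trans hn⟩
    have hmono : Monotone fun n : ℕ => Iic (n : ℝ) ×ˢ Iic (n : ℝ) := fun i j hij =>
      prod_mono (Iic_subset_Iic.2 (by exact_mod_cast hij)) (Iic_subset_Iic.2 (by exact_mod_cast hij))
    have hlim := fun v : ComplexMeasure (ℝ × ℝ) => v.tendsto_vectorMeasure_iUnion_atTop_nat hmono
      fun n => measurableSet_Iic.prod measurableSet_Iic
    simp only [hun] at hlim
    refine tendsto_nhds_unique (hlim m) ?_
    simp only [hbox]
    exact hlim _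

theorem posSemidef_of_forall_sum_nonneg {n : Type*} [Fintype n] [DecidableEq n] {M : Matrix n n ℂ}
    (h : ∀ x : n → ℂ, 0 ≤ ∑ i, ∑ j, star (x i) * x j * M i j) : M.PosSemidef := by
  rw [← Matrix.isPositive_toEuclideanLin_iff, LinearMap.isPositive_iff_complex]
  intro x
  have h1 : inner ℂ (M.toEuclideanLin x) x = star (∑ i, ∑ j, star (x i) * x j * M i j) := by
    rw [EuclideanSpace.inner_eq_star_dotProduct, Matrix.ofLp_toLpLin, Matrix.toLin'_apply]
    simp only [dotProduct, Matrix.mulVec, Pi.star_apply, star_sum, Finset.mul_sum, star_mul', star_star]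
    exact Finset.sum_congr rfl fun i _ => Finset.sum_congr rfl fun j _ => by ring
  have h2 := Complex.nonneg_iff.1 (star_nonneg_iff.2 (h x))
  rw [h1]
  exact ⟨Complex.ext rfl h2.2, h2.1⟩

/-! ### The current-current correlation measure -/

variable {d : ℕ} {r : ℝ} {g : ℂ → ℂ} {lam : ℝ}

/-- The trace per unit volume `𝒯(f(H) A f'(H) A')`. -/
def pairTrace (g : ℂ → ℂ) (lam : ℝ) (A A' : Hilb d →L[ℂ] Hilb d) (f f' : C₀(ℝ, ℂ)) : ℂ :=
  traceP d g fun V => funCalc (hamiltonian lam V) f * A * funCalc (hamiltonian lam V) f' * A'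

/-- An operator that commutes with the translations. -/
def IsInvariant (A : Hilb d →L[ℂ] Hilb d) : Prop := CovariantFamily fun _ : Site d → ℝ => A

theorem covariantFamily_pair (hlam : 2 * d * |lam| < 1) {A A' : Hilb d →L[ℂ] Hilb d}
    (hA : IsInvariant A) (hA' : IsInvariant A') (f f' : C₀(ℝ, ℂ)) :
    CovariantFamily fun V : Site d → ℝ =>
      funCalc (hamiltonian lam V) f * A * funCalc (hamiltonian lam V) f' * A' :=
  (((covariantFamily_funCalc hlam f).mul hA).mul (covariantFamily_funCalc hlam f')).mul hA'

theorem norm_pair_le (hlam : 2 * d * |lam| < 1) (A A' : Hilb d →L[ℂ] Hilb d) (f f' : C₀(ℝ, ℂ))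
    (V : Site d → ℝ) :
    ‖funCalc (hamiltonian lam V) f * A * funCalc (hamiltonian lam V) f' * A'‖ ≤
      ‖A‖ * ‖A'‖ * ‖f‖ * ‖f'‖ := by
  have hU := cayley_hamiltonian_mem_unitary hlam V
  have h1 := norm_funCalc_le hU f
  have h2 := norm_funCalc_le hU f'
  calc _ ≤ ‖funCalc (hamiltonian lam V) f‖ * ‖A‖ * ‖funCalc (hamiltonian lam V) f'‖ * ‖A'‖ :=
        (norm_mul_le _ _).trans (mul_le_mul_of_nonneg_right ((norm_mul_le _ _).trans
          (mul_le_mul_of_nonneg_right (norm_mul_le _ _) (norm_nonneg _))) (norm_nonneg _))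
    _ ≤ ‖f‖ * ‖A‖ * ‖f'‖ * ‖A'‖ := by gcongr
    _ = _ := by ring

theorem pairTrace_add_left (hg : IsSiteDensity r g) (hlam : 2 * d * |lam| < 1)
    {A A' B : Hilb d →L[ℂ] Hilb d} (hA : IsInvariant A) (hA' : IsInvariant A')
    (hB : IsInvariant B) (f f' : C₀(ℝ, ℂ)) :
    pairTrace g lam (A + B) A' f f' = pairTrace g lam A A' f f' + pairTrace g lam B A' f f' := by
  simp only [pairTrace, mul_add, add_mul]
  exact traceP_add hg (covariantFamily_pair hlam hA hA' f f') (covariantFamily_pair hlam hB hA' f f')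
    (norm_pair_le hlam _ _ _ _) (norm_pair_le hlam _ _ _ _)

theorem pairTrace_add_right (hg : IsSiteDensity r g) (hlam : 2 * d * |lam| < 1)
    {A A' B : Hilb d →L[ℂ] Hilb d} (hA : IsInvariant A) (hA' : IsInvariant A')
    (hB : IsInvariant B) (f f' : C₀(ℝ, ℂ)) :
    pairTrace g lam A (A' + B) f f' = pairTrace g lam A A' f f' + pairTrace g lam A B f f' := by
  simp only [pairTrace, mul_add]
  exact traceP_add hg (covariantFamily_pair hlam hA hA' f f') (covariantFamily_pair hlam hA hB f f')
    (norm_pair_le hlam _ _ _ _) (norm_pair_le hlam _ _ _ _)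

theorem pairTrace_smul_left (c : ℂ) (A A' : Hilb d →L[ℂ] Hilb d) (f f' : C₀(ℝ, ℂ)) :
    pairTrace g lam (c • A) A' f f' = c * pairTrace g lam A A' f f' := by
  simp only [pairTrace, mul_smul_comm, smul_mul_assoc]
  exact traceP_smul g c _

theorem pairTrace_smul_right (c : ℂ) (A A' : Hilb d →L[ℂ] Hilb d) (f f' : C₀(ℝ, ℂ)) :
    pairTrace g lam A (c • A') f f' = c * pairTrace g lam A A' f f' := by
  simp only [pairTrace, mul_smul_comm]
  exact traceP_smul g c _

/-- For an operator `A` that commutes with translations, `𝒯(f(H) A f'(H) A*)` is given by a finite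
positive measure. -/
theorem exists_measure_pairTrace (hg : IsSiteDensity r g) (hlam : 2 * d * |lam| < 1)
    {A : Hilb d →L[ℂ] Hilb d} (hA : IsInvariant A) :
    ∃ μ : Measure (ℝ × ℝ), IsFiniteMeasure μ ∧
      ∀ f f', pairTrace g lam A (star A) f f' = ∫ p, f p.1 * f' p.2 ∂μ := by
  have hU := cayley_hamiltonian_mem_unitary (d := d) hlam
  have hA' : IsInvariant (star A) := hA.star
  have hcov := covariantFamily_pair (d := d) hlam hA hA'
  have hbd := norm_pair_le (d := d) hlam A (star A)
  refine exists_measure_of_bilinear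
    (LinearMap.mk₂ ℂ (fun f f' => pairTrace g lam A (star A) f f')
      (fun f₁ f₂ f' => ?_) (fun c f f' => ?_) (fun f f₁ f₂ => ?_) (fun c f f' => ?_))
    (C := ‖A‖ * ‖star A‖) (by positivity) (fun f f' => ?_) (fun h k => ?_)
  · simp only [pairTrace, fun V => funCalc_add (hU V) f₁ f₂, add_mul]
    exact traceP_add hg (hcov _ _) (hcov _ _) (hbd _ _) (hbd _ _)
  · simp only [pairTrace, fun V => funCalc_smul (hU V) c f, smul_mul_assoc]
    exact traceP_smul g c _
  · simp only [pairTrace, fun V => funCalc_add (hU V) f₁ f₂, mul_add, add_mul]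
    exact traceP_add hg (hcov _ _) (hcov _ _) (hbd _ _) (hbd _ _)
  · simp only [pairTrace, fun V => funCalc_smul (hU V) c f', mul_smul_comm, smul_mul_assoc]
    exact traceP_smul g c _
  · exact norm_traceP_le hg (hbd f f')
  · -- By cyclicity, `𝒯(h* h A k* k A*) = 𝒯(X X*)` with `X = h A k*`.
    rw [LinearMap.mk₂_apply, pairTrace]
    have h1 : ∀ V, funCalc (hamiltonian lam V) (star h * h) * A *
        funCalc (hamiltonian lam V) (star k * k) * star A =
        funCalc (hamiltonian (d := d) lam V) (star h) * (funCalc (hamiltonian lam V) h * A *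
          funCalc (hamiltonian lam V) (star k * k) * star A) := fun V => by
      rw [funCalc_mul (hU V) (star h) h]
      simp only [mul_assoc]
    simp only [h1]
    rw [traceP_mul_comm hg (covariantFamily_funCalc hlam (star h)) (hcov h (star k * k))
      (C := max ‖star h‖ (‖A‖ * ‖star A‖ * ‖h‖ * ‖star k * k‖))
      (fun V => (norm_funCalc_le (hU V) _).trans (le_max_left _ _))
      (fun V => (hbd _ _ V).trans (le_max_right _ _))]
    have h2 : ∀ V, funCalc (hamiltonian lam V) h * A * funCalc (hamiltonian lam V) (star k * k) *
        star A * funCalc (hamiltonian (d := d) lam V) (star h) =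
        (funCalc (hamiltonian lam V) h * A * funCalc (hamiltonian lam V) (star k)) *
          star (funCalc (hamiltonian lam V) h * A * funCalc (hamiltonian lam V) (star k)) :=
      fun V => by
        rw [funCalc_mul (hU V) (star k) k, star_mul, star_mul, ← funCalc_star (hU V) (star k),
          star_star, ← funCalc_star (hU V) h]
        simp only [mul_assoc]
    simp only [h2]
    exact traceP_mul_star_nonneg g _

theorem IsInvariant.sum_smul {ι : Type*} (s : Finset ι) (c : ι → ℂ)
    {A : ι → Hilb d →L[ℂ] Hilb d} (hA : ∀ i, IsInvariant (A i)) :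
    IsInvariant (∑ i ∈ s, c i • A i) := by
  classical
  induction s using Finset.induction_on with
  | empty => simpa using! CovariantFamily.const_smul_one (d := d) 0
  | insert a s ha ih =>
    rw [Finset.sum_insert ha]
    exact CovariantFamily.add (CovariantFamily.smul (c a) (hA a)) ih

theorem pairTrace_sum_left (hg : IsSiteDensity r g) (hlam : 2 * d * |lam| < 1) {ι : Type*}
    (s : Finset ι) (c : ι → ℂ) {A : ι → Hilb d →L[ℂ] Hilb d} {A' : Hilb d →L[ℂ] Hilb d}
    (hA : ∀ i, IsInvariant (A i)) (hA' : IsInvariant A') (f f' : C₀(ℝ, ℂ)) :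
    pairTrace g lam (∑ i ∈ s, c i • A i) A' f f' = ∑ i ∈ s, c i * pairTrace g lam (A i) A' f f' := by
  classical
  induction s using Finset.induction_on with
  | empty => simp [pairTrace, traceP]
  | insert a s ha ih =>
    rw [Finset.sum_insert ha, Finset.sum_insert ha, pairTrace_add_left hg hlam
      (CovariantFamily.smul (c a) (hA a)) hA' (IsInvariant.sum_smul s c hA), ih,
      pairTrace_smul_left]

theorem pairTrace_sum_right (hg : IsSiteDensity r g) (hlam : 2 * d * |lam| < 1) {ι : Type*}
    (s : Finset ι) (c : ι → ℂ) {A : ι → Hilb d →L[ℂ] Hilb d} {A' : Hilb d →L[ℂ] Hilb d}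
    (hA : ∀ i, IsInvariant (A i)) (hA' : IsInvariant A') (f f' : C₀(ℝ, ℂ)) :
    pairTrace g lam A' (∑ i ∈ s, c i • A i) f f' = ∑ i ∈ s, c i * pairTrace g lam A' (A i) f f' := by
  classical
  induction s using Finset.induction_on with
  | empty => simp [pairTrace, traceP]
  | insert a s ha ih =>
    rw [Finset.sum_insert ha, Finset.sum_insert ha, pairTrace_add_right hg hlam hA'
      (CovariantFamily.smul (c a) (hA a)) (IsInvariant.sum_smul s c hA), ih,
      pairTrace_smul_right]

/-- The coefficients `(-i)^k / 4` of the polarization identity. -/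
def polarCoeff (k : Fin 4) : ℂ := (-I) ^ (k : ℕ) / 4

/-- The operators `∂_ν H + (-i)^k ∂_ν' H` of the polarization identity. -/
def polarVelocity (lam : ℝ) (ν ν' : Fin d) (k : Fin 4) : Hilb d →L[ℂ] Hilb d :=
  velocity lam ν + (-I) ^ (k : ℕ) • velocity lam ν'

theorem isInvariant_polarVelocity (lam : ℝ) (ν ν' : Fin d) (k : Fin 4) :
    IsInvariant (polarVelocity lam ν ν' k) :=
  (covariantFamily_velocity lam ν).add ((covariantFamily_velocity lam ν').smul _)

theorem pairTrace_velocity_eq_polarization (hg : IsSiteDensity r g) (hlam : 2 * d * |lam| < 1)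
    (ν ν' : Fin d) (f f' : C₀(ℝ, ℂ)) :
    pairTrace g lam (velocity lam ν) (velocity lam ν') f f' = ∑ k, polarCoeff k *
      pairTrace g lam (polarVelocity lam ν ν' k) (star (polarVelocity lam ν ν' k)) f f' := by
  have hv := fun ν : Fin d => covariantFamily_velocity lam ν
  have hexp : ∀ k, pairTrace g lam (polarVelocity lam ν ν' k) (star (polarVelocity lam ν ν' k)) f f'
      = pairTrace g lam (velocity lam ν) (velocity lam ν) f f' +
        I ^ (k : ℕ) * pairTrace g lam (velocity lam ν) (velocity lam ν') f f' +
        ((-I) ^ (k : ℕ) * pairTrace g lam (velocity lam ν') (velocity lam ν) f f' +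
        (-I) ^ (k : ℕ) * (I ^ (k : ℕ) *
          pairTrace g lam (velocity lam ν') (velocity lam ν') f f')) := by
    intro k
    have h1 : star (polarVelocity lam ν ν' k) =
        velocity lam ν + I ^ (k : ℕ) • velocity lam ν' := by
      rw [polarVelocity, star_add, star_smul, star_velocity, star_velocity, star_pow]
      simp
    rw [h1, polarVelocity, pairTrace_add_left hg hlam (hv ν) ((hv ν).add ((hv ν').smul _))
      ((hv ν').smul _), pairTrace_add_right hg hlam (hv ν) (hv ν) ((hv ν').smul _),
      pairTrace_add_right hg hlam ((hv ν').smul _) (hv ν) ((hv ν').smul _),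
      pairTrace_smul_left, pairTrace_smul_left, pairTrace_smul_right, pairTrace_smul_right]
  simp only [hexp, polarCoeff, Fin.sum_univ_four]
  norm_num [pow_succ]
  ring_nf
  simp only [I_sq]
  ring

/-- The positive measures `μ` that correspond to the operators of the polarization identity. -/
theorem exists_polarMeasure (hg : IsSiteDensity r g) (hlam : 2 * d * |lam| < 1) :
    ∃ μ : Fin d → Fin d → Fin 4 → Measure (ℝ × ℝ), (∀ ν ν' k, IsFiniteMeasure (μ ν ν' k)) ∧
      (∀ ν ν' k f f', pairTrace g lam (polarVelocity lam ν ν' k)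
        (star (polarVelocity lam ν ν' k)) f f' = ∫ p, f p.1 * f' p.2 ∂(μ ν ν' k)) ∧
      ∀ ν ν' f f', pairTrace g lam (velocity lam ν) (velocity lam ν') f f' =
        ∑ k, polarCoeff k * ∫ p, f p.1 * f' p.2 ∂(μ ν ν' k) := by
  choose μ hμ hμf using fun ν ν' k =>
    exists_measure_pairTrace hg hlam (isInvariant_polarVelocity (d := d) lam ν ν' k)
  refine ⟨μ, hμ, hμf, fun ν ν' f f' => ?_⟩
  rw [pairTrace_velocity_eq_polarization hg hlam]
  simp only [hμf]

theorem IsCurrentCorrelation.eq_combination {m : Fin d → Fin d → ComplexMeasure (ℝ × ℝ)}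
    (hm : IsCurrentCorrelation d g lam m) {ν ν' : Fin d} {μ : Fin 4 → Measure (ℝ × ℝ)}
    [∀ k, IsFiniteMeasure (μ k)]
    (hμ : ∀ f f', pairTrace g lam (velocity lam ν) (velocity lam ν') f f' =
        ∑ k, polarCoeff k * ∫ p, f p.1 * f' p.2 ∂(μ k)) :
    m ν ν' = combination polarCoeff μ :=
  eq_combination_of_integral_eq _ _ fun f f' => (hm.2 ν ν' f f').symm.trans (hμ f f')

theorem measurable_and_norm_le_mul (f f' : C₀(ℝ, ℂ)) :
    Measurable (fun p : ℝ × ℝ => f p.1 * f' p.2) ∧ ∀ p : ℝ × ℝ, ‖f p.1 * f' p.2‖ ≤ ‖f‖ * ‖f'‖ :=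
  ⟨by fun_prop, fun p => by
    rw [norm_mul]
    exact mul_le_mul (norm_zeroAtInfty_apply_le f _) (norm_zeroAtInfty_apply_le f' _)
      (norm_nonneg _) (norm_nonneg _)⟩

/-- The current-current correlation measure exists: the combinations `∑ conj x_ν x_ν' m_νν'` are
positive since they belong to the pair of `∑ conj x_ν ∂_ν H` and its adjoint. -/
theorem exists_isCurrentCorrelation (hg : IsSiteDensity r g) (hlam : 2 * d * |lam| < 1) :
    ∃ m, IsCurrentCorrelation d g lam m := by
  obtain ⟨μ, hfin, -, hμ⟩ := exists_polarMeasure (d := d) hg hlam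
  have hcomb : ∀ ν ν' s, MeasurableSet s → combination polarCoeff (μ ν ν') s =
      ∑ k, polarCoeff k * (μ ν ν' k).real s := fun ν ν' s hs => combination_apply _ _ hs
  refine ⟨fun ν ν' => combination polarCoeff (μ ν ν'), fun B hB => ?_, fun ν ν' f f' => ?_⟩
  · refine posSemidef_of_forall_sum_nonneg fun x => ?_
    have hA : IsInvariant (∑ ν, star (x ν) • velocity lam ν) :=
      IsInvariant.sum_smul _ _ (covariantFamily_velocity lam)
    obtain ⟨N, hN, hNf⟩ := exists_measure_pairTrace hg hlam hA
    -- The measure `∑ star x_ν x_ν' m_νν'` and the positive measure `N` have the same integrals.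
    let v : ComplexMeasure (ℝ × ℝ) :=
      ∑ ν, ∑ ν', (star (x ν) * x ν') • combination polarCoeff (μ ν ν')
    have hv : ∀ s, MeasurableSet s → v s = ∑ q : Fin d × Fin d × Fin 4,
        star (x q.1) * x q.2.1 * polarCoeff q.2.2 * (μ q.1 q.2.1 q.2.2).real s := by
      intro s hs
      simp only [v, FunLike.coe_sum, Finset.sum_apply, smul_apply, smul_eq_mul, hcomb _ _ s hs,
        Fintype.sum_prod_type, Finset.mul_sum, mul_assoc]
    have hv2 : v = combination (fun _ : Unit => 1) fun _ => N := by
      refine eq_combination_of_integral_eq _ _ fun f f' => ?_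
      rw [integral_eq_sum_of_eq_combination (fun q : Fin d × Fin d × Fin 4 =>
        star (x q.1) * x q.2.1 * polarCoeff q.2.2) (fun q => μ q.1 q.2.1 q.2.2) hv
        (measurable_and_norm_le_mul f f').1 (measurable_and_norm_le_mul f f').2]
      simp only [Finset.univ_unique, Finset.sum_const, Finset.card_singleton, one_smul, one_mul]
      rw [← hNf, star_sum]
      simp only [star_smul, star_star, star_velocity]
      rw [pairTrace_sum_left hg hlam _ _ (covariantFamily_velocity lam)
        (IsInvariant.sum_smul _ _ (covariantFamily_velocity lam))]
      simp only [fun ν => pairTrace_sum_right hg hlam Finset.univ x (covariantFamily_velocity lam)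
        (covariantFamily_velocity lam ν) f f', hμ, Fintype.sum_prod_type, Finset.mul_sum, mul_assoc]
    have h1 : ∑ ν, ∑ ν', star (x ν) * x ν' *
        Matrix.of (fun ν ν' => combination polarCoeff (μ ν ν') B) ν ν' = v B := by
      simp only [v, FunLike.coe_sum, Finset.sum_apply, smul_apply, smul_eq_mul, Matrix.of_apply]
    rw [h1, hv2, combination_apply _ _ hB]
    simp only [Finset.univ_unique, Finset.sum_const, Finset.card_singleton, one_smul, one_mul]
    exact_mod_cast measureReal_nonneg
  · rw [integral_eq_sum_of_eq_combination _ (μ ν ν') (hcomb ν ν')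
      (measurable_and_norm_le_mul f f').1 (measurable_and_norm_le_mul f f').2]
    exact hμ ν ν' f f'

end

/-! ### Recovering the density of a measure from its smoothings -/

section

section Smoothing

variable {X : Type*} [NormedAddCommGroup X] [NormedSpace ℝ X] [FiniteDimensional ℝ X]
  [MeasurableSpace X] [BorelSpace X]

/-- The density at `p` of the convolution of `N` with `P` scaled to width `η`. -/
def smoothing (P : X → ℝ) (N : Measure X) (η : ℝ) (p : X) : ℝ :=
  ∫ x, (η ^ Module.finrank ℝ X)⁻¹ * P (η⁻¹ • (p - x)) ∂N

omit [FiniteDimensional ℝ X] [BorelSpace X] in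
theorem smoothing_nonneg {P : X → ℝ} {N : Measure X} (hP0 : ∀ y, 0 ≤ P y) {η : ℝ} (hη : 0 < η)
    (p : X) :
    0 ≤ smoothing P N η p :=
  integral_nonneg fun _ => mul_nonneg (by positivity) (hP0 _)

variable {vol : Measure X} [vol.IsAddHaarMeasure] {P : X → ℝ} {N : Measure X} [IsFiniteMeasure N]

theorem integral_mul_scaled {η : ℝ} (hη : 0 < η) (φ : X → ℝ) (x : X) :
    ∫ p, φ p * ((η ^ Module.finrank ℝ X)⁻¹ * P (η⁻¹ • (p - x))) ∂vol =
      ∫ y, φ (x + η • y) * P y ∂vol := by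
  have h1 := Measure.integral_comp_smul vol (fun q => φ (x + q) * P (η⁻¹ • q)) η
  simp only [smul_smul, inv_mul_cancel₀ hη.ne', one_smul] at h1
  rw [h1, abs_of_pos (by positivity), smul_eq_mul, ← integral_const_mul,
    ← integral_add_left_eq_self _ x]
  refine integral_congr_ae (.of_forall fun q => ?_)
  simp only [add_sub_cancel_left]
  ring

theorem integrable_scaled (hP : Integrable P vol) {η : ℝ} (hη : 0 < η) (x : X) :
    Integrable (fun p => (η ^ Module.finrank ℝ X)⁻¹ * P (η⁻¹ • (p - x))) vol :=
  ((hP.comp_smul (inv_ne_zero hη.ne')).comp_sub_right x).const_mul _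

theorem integrable_mul_scaled_prod (hPc : Continuous P) (hP0 : ∀ y, 0 ≤ P y)
    (hP : Integrable P vol) (hP1 : ∫ y, P y ∂vol = 1) {φ : X → ℝ} (hφ : Continuous φ) {M : ℝ}
    (hM : ∀ p, |φ p| ≤ M) {η : ℝ} (hη : 0 < η) :
    Integrable (fun q : X × X => φ q.1 * ((η ^ Module.finrank ℝ X)⁻¹ * P (η⁻¹ • (q.1 - q.2))))
      (vol.prod N) := by
  have hM0 : 0 ≤ M := (abs_nonneg _).trans (hM 0)
  have hmeas : Continuous fun q : X × X =>
      φ q.1 * ((η ^ Module.finrank ℝ X)⁻¹ * P (η⁻¹ • (q.1 - q.2))) := by fun_prop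
  have hx : ∀ x, Integrable (fun p => φ p * ((η ^ Module.finrank ℝ X)⁻¹ * P (η⁻¹ • (p - x)))) vol :=
    fun x => (integrable_scaled hP hη x).bdd_mul hφ.aestronglyMeasurable (.of_forall hM)
  refine (integrable_prod_iff' hmeas.aestronglyMeasurable).2 ⟨.of_forall hx, ?_⟩
  refine Integrable.of_bound
    (hmeas.norm.stronglyMeasurable.integral_prod_left').aestronglyMeasurable M
    (.of_forall fun x => ?_)
  have h1 := integral_mul_scaled (vol := vol) (P := P) hη (fun _ => 1) x
  simp only [one_mul, hP1] at h1
  rw [Real.norm_of_nonneg (integral_nonneg fun _ => norm_nonneg _)]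
  calc _ ≤ ∫ p, M * ((η ^ Module.finrank ℝ X)⁻¹ * P (η⁻¹ • (p - x))) ∂vol := by
        refine integral_mono (hx x).norm ((integrable_scaled hP hη x).const_mul M) fun p => ?_
        have h2 : 0 ≤ (η ^ Module.finrank ℝ X)⁻¹ * P (η⁻¹ • (p - x)) :=
          mul_nonneg (by positivity) (hP0 _)
        simp only [norm_mul (φ p), Real.norm_of_nonneg h2]
        exact mul_le_mul_of_nonneg_right (hM p) h2
    _ = M := by rw [integral_const_mul, h1, mul_one]

theorem tendsto_integral_mul_smoothing (hPc : Continuous P) (hP0 : ∀ y, 0 ≤ P y)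
    (hP : Integrable P vol) (hP1 : ∫ y, P y ∂vol = 1) {φ : X → ℝ} (hφ : Continuous φ) {M : ℝ}
    (hM : ∀ p, |φ p| ≤ M) {η : ℕ → ℝ} (hη : ∀ n, 0 < η n) (hη0 : Tendsto η atTop (𝓝 0)) :
    Tendsto (fun n => ∫ p, φ p * smoothing P N (η n) p ∂vol) atTop (𝓝 (∫ x, φ x ∂N)) := by
  have h1 : ∀ n, ∫ p, φ p * smoothing P N (η n) p ∂vol =
      ∫ x, ∫ y, φ (x + η n • y) * P y ∂vol ∂N := by
    intro n
    simp only [smoothing, ← integral_const_mul, ← integral_mul_scaled (hη n)]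
    exact integral_integral_swap (integrable_mul_scaled_prod hPc hP0 hP hP1 hφ hM (hη n))
  simp only [h1]
  have hM0 : 0 ≤ M := (abs_nonneg _).trans (hM 0)
  have hbd : ∀ n x y, ‖φ (x + η n • y) * P y‖ ≤ M * P y := fun n x y => by
    rw [norm_mul, Real.norm_of_nonneg (hP0 y)]
    exact mul_le_mul_of_nonneg_right (hM _) (hP0 y)
  refine tendsto_integral_of_dominated_convergence (fun _ => M) (fun n => ?_) (integrable_const _)
    (fun n => .of_forall fun x => ?_) (.of_forall fun x => ?_)
  · have hc : Continuous fun q : X × X => φ (q.1 + η n • q.2) * P q.2 := by fun_prop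
    exact hc.stronglyMeasurable.integral_prod_right'.aestronglyMeasurable
  · refine (norm_integral_le_of_norm_le (hP.const_mul M) (.of_forall (hbd n x))).trans ?_
    rw [integral_const_mul, hP1, mul_one]
  · have h2 : φ x = ∫ y, φ x * P y ∂vol := by rw [integral_const_mul, hP1, mul_one]
    rw [h2]
    refine tendsto_integral_of_dominated_convergence (fun y => M * P y) (fun n => by fun_prop)
      (hP.const_mul M) (fun n => .of_forall (hbd n x)) (.of_forall fun y => ?_)
    refine Tendsto.mul_const _ ?_
    have h3 : Tendsto (fun n => x + η n • y) atTop (𝓝 x) := by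
      simpa using tendsto_const_nhds.add (hη0.smul_const y)
    exact (hφ.tendsto x).comp h3

theorem stronglyMeasurable_smoothing (hPc : Continuous P) (η : ℝ) :
    StronglyMeasurable (smoothing P N η) := by
  have hc : Continuous fun q : X × X => (η ^ Module.finrank ℝ X)⁻¹ * P (η⁻¹ • (q.1 - q.2)) := by
    fun_prop
  exact hc.stronglyMeasurable.integral_prod_right'

/-- If the smoothings of `N` converge to `k` on the open set `U`, boundedly near every point, then
`k` is the density of `N` on `U`. -/
theorem hasDensity_of_tendsto_smoothing (hPc : Continuous P) (hP0 : ∀ y, 0 ≤ P y)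
    (hP : Integrable P vol) (hP1 : ∫ y, P y ∂vol = 1)
    {η : ℕ → ℝ} (hη : ∀ n, 0 < η n) (hη0 : Tendsto η atTop (𝓝 0)) {U : Set X} (hU : IsOpen U)
    {k : X → ℝ} (hk : ContinuousOn k U)
    (hlim : ∀ p ∈ U, Tendsto (fun n => smoothing P N (η n) p) atTop (𝓝 (k p)))
    (hbd : ∀ p ∈ U, ∃ W ∈ 𝓝 p, ∃ C, ∀ᶠ n in atTop, ∀ q ∈ W, |smoothing P N (η n) q| ≤ C) :
    IntegrableOn k U vol ∧ ∀ B, MeasurableSet B → B ⊆ U → N.real B = ∫ p in B, k p ∂vol := by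
  have hk0 : ∀ p ∈ U, 0 ≤ k p := fun p hp =>
    ge_of_tendsto' (hlim p hp) fun n => smoothing_nonneg hP0 (hη n) p
  have hcompact : ∀ K ⊆ U, IsCompact K → ∃ C, ∀ᶠ n in atTop, ∀ q ∈ K, |smoothing P N (η n) q| ≤ C := by
    intro K hKU hK
    refine hK.induction_on (p := fun s => ∃ C, ∀ᶠ n in atTop, ∀ q ∈ s, |smoothing P N (η n) q| ≤ C)
      ⟨0, by simp⟩ (fun s t hst ⟨C, hC⟩ => ⟨C, hC.mono fun n hn q hq => hn q (hst hq)⟩)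
      (fun s t ⟨C, hC⟩ ⟨C', hC'⟩ => ⟨max C C', ?_⟩) (fun p hp => ?_)
    · filter_upwards [hC, hC'] with n h1 h2 q hq
      exact hq.elim (fun h => (h1 q h).trans (le_max_left _ _))
        fun h => (h2 q h).trans (le_max_right _ _)
    · obtain ⟨W, hW, C, hC⟩ := hbd p (hKU hp)
      exact ⟨W, mem_nhdsWithin_of_mem_nhds hW, C, hC⟩
  -- The smoothings converge weakly to `N`, and by dominated convergence on compact sets to `k`.
  have htest : ∀ K ⊆ U, IsCompact K → ∀ φ : X → ℝ, Continuous φ → (∀ p, 0 ≤ φ p) → (∀ p, φ p ≤ 1) →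
      (∀ p ∉ K, φ p = 0) → ∫ x, φ x ∂N = ∫ p in K, φ p * k p ∂vol := by
    intro K hKU hK φ hφ hφ0 hφ1 hφK
    obtain ⟨C, hC⟩ := hcompact K hKU hK
    have h1 : ∀ n, ∫ p, φ p * smoothing P N (η n) p ∂vol =
        ∫ p in K, φ p * smoothing P N (η n) p ∂vol := fun n =>
      (setIntegral_eq_integral_of_forall_compl_eq_zero fun p hp => by rw [hφK p hp, zero_mul]).symm
    refine tendsto_nhds_unique (tendsto_integral_mul_smoothing hPc hP0 hP hP1 hφ (M := 1)
      (fun p => by rw [abs_of_nonneg (hφ0 p)]; exact hφ1 p) hη hη0) ?_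
    simp only [h1]
    have hfin : IsFiniteMeasure (vol.restrict K) := ⟨by simpa using hK.measure_lt_top⟩
    refine tendsto_integral_filter_of_dominated_convergence (fun _ => C) (.of_forall fun n =>
      (hφ.stronglyMeasurable.mul (stronglyMeasurable_smoothing hPc (η n))).aestronglyMeasurable) ?_
      (integrable_const _) ?_
    · filter_upwards [hC] with n hn
      refine (ae_restrict_iff' hK.measurableSet).2 (.of_forall fun p hp => ?_)
      rw [norm_mul, Real.norm_of_nonneg (hφ0 p)]
      exact (mul_le_of_le_one_left (norm_nonneg _) (hφ1 p)).trans (hn p hp)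
    · exact (ae_restrict_iff' hK.measurableSet).2 (.of_forall fun p hp =>
        (hlim p (hKU hp)).const_mul _)
  -- indicator functions of compact sets are limits of continuous functions
  have hN : ∀ K ⊆ U, IsCompact K → N.real K = ∫ p in K, k p ∂vol := by
    intro K hKU hK
    obtain ⟨δ, hδ, hδU⟩ := hK.exists_cthickening_subset_open hU hKU
    have hK' : IsCompact (Metric.cthickening δ K) := hK.cthickening
    have hpos : ∀ n : ℕ, 0 < δ / (n + 1) := fun n => by positivity
    have hlim0 : Tendsto (fun n : ℕ => δ / (n + 1)) atTop (𝓝 0) :=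
      tendsto_const_nhds.div_atTop (tendsto_atTop_add_const_right _ _ tendsto_natCast_atTop_atTop)
    let φ (n : ℕ) (p : X) : ℝ := thickenedIndicator (hpos n) K p
    have hφc : ∀ n, Continuous (φ n) := fun n =>
      NNReal.continuous_coe.comp (thickenedIndicator (hpos n) K).continuous
    have hφ1 : ∀ n p, φ n p ≤ 1 := fun n p => thickenedIndicator_le_one (hpos n) K p
    have hφ0 : ∀ n p, 0 ≤ φ n p := fun n p => NNReal.coe_nonneg _
    have hφlim : ∀ p, Tendsto (fun n => φ n p) atTop (𝓝 (K.indicator (fun _ => 1) p)) := by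
      intro p
      have h1 := tendsto_pi_nhds.1 (thickenedIndicator_tendsto_indicator_closure hpos hlim0 K) p
      rw [hK.isClosed.closure_eq] at h1
      have h2 := (NNReal.continuous_coe.tendsto _).comp h1
      convert! h2 using 2
      by_cases hp : p ∈ K <;> simp [hp]
    have heq := fun n => htest _ hδU hK' (φ n) (hφc n) (hφ0 n) (hφ1 n) fun p hp => by
      simp only [φ, NNReal.coe_eq_zero]
      refine thickenedIndicator_zero (hpos n) K fun h => hp ?_
      refine Metric.thickening_subset_cthickening_of_le ?_ K h
      exact div_le_self hδ.le (by linarith [(n.cast_nonneg : (0 : ℝ) ≤ n)])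
    have h1 : Tendsto (fun n => ∫ x, φ n x ∂N) atTop (𝓝 (∫ x, K.indicator (fun _ => (1 : ℝ)) x ∂N)) :=
      tendsto_integral_of_dominated_convergence (fun _ => 1)
        (fun n => (hφc n).aestronglyMeasurable) (integrable_const _)
        (fun n => .of_forall fun p => by rw [Real.norm_of_nonneg (hφ0 n p)]; exact hφ1 n p)
        (.of_forall hφlim)
    rw [integral_indicator hK.measurableSet, integral_const, measureReal_restrict_apply_univ,
      smul_eq_mul, mul_one] at h1
    simp only [heq] at h1
    refine tendsto_nhds_unique h1 ?_
    have hkK : IntegrableOn k (Metric.cthickening δ K) vol :=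
      (hk.mono hδU).integrableOn_compact hK'
    have h2 : ∫ p in K, k p ∂vol =
        ∫ p in Metric.cthickening δ K, K.indicator (fun _ => 1) p * k p ∂vol := by
      have h3 : ∀ p, K.indicator (fun _ => (1 : ℝ)) p * k p = K.indicator k p := fun p => by
        by_cases hp : p ∈ K <;> simp [hp]
      simp only [h3]
      rw [setIntegral_indicator hK.measurableSet,
        inter_eq_self_of_subset_right (Metric.self_subset_cthickening K)]
    rw [h2]
    refine tendsto_integral_of_dominated_convergence (fun p => ‖k p‖)
      (fun n => (hφc n).aestronglyMeasurable.mul hkK.aestronglyMeasurable) hkK.norm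
      (fun n => .of_forall fun p => ?_) (.of_forall fun p => (hφlim p).mul_const _)
    rw [norm_mul, Real.norm_of_nonneg (hφ0 n p)]
    exact mul_le_of_le_one_left (norm_nonneg _) (hφ1 n p)
  have hkm : AEStronglyMeasurable k (vol.restrict U) := hk.aestronglyMeasurable hU.measurableSet
  let κ : Measure X := (vol.restrict U).withDensity fun p => ENNReal.ofReal (k p)
  have hκ : ∀ B, MeasurableSet B → B ⊆ U → κ B = ∫⁻ p in B, ENNReal.ofReal (k p) ∂vol := by
    intro B hB hBU
    rw [withDensity_apply _ hB, Measure.restrict_restrict hB, inter_eq_self_of_subset_left hBU]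
  have hκK : ∀ K ⊆ U, IsCompact K → N K = κ K := by
    intro K hKU hK
    rw [hκ K hK.measurableSet hKU, ← ofReal_integral_eq_lintegral_ofReal
      ((hk.mono hKU).integrableOn_compact hK)
      ((ae_restrict_iff' hK.measurableSet).2 (.of_forall fun p hp => hk0 p (hKU hp))), ← hN K hKU hK,
      ofReal_measureReal]
  obtain ⟨F, hFc, hFU, hFeq, hFm⟩ := hU.exists_iUnion_isClosed
  -- Relatively closed subsets of `U` are exhausted by compact ones, and they form a π-system; the
  -- integrability of `k` on `U` comes for free from the finiteness of `N`.
  have hclosed : ∀ A, IsClosed A → N (A ∩ U) = κ (A ∩ U) := by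
    intro A hA
    have h1 : A ∩ U = ⋃ n : ℕ, A ∩ (F n ∩ Metric.closedBall 0 n) := by
      rw [← inter_iUnion, ← hFeq]
      congr 1
      ext x
      simp only [mem_iUnion, mem_inter_iff]
      refine ⟨fun ⟨n, hn⟩ => ?_, fun ⟨n, hn, _⟩ => ⟨n, hn⟩⟩
      obtain ⟨j, hj⟩ := exists_nat_ge ‖x‖
      refine ⟨max n j, hFm (le_max_left _ _) hn, ?_⟩
      rw [mem_closedBall_zero_iff]
      exact hj.trans (by exact_mod_cast le_max_right n j)
    have hmono : Monotone fun n : ℕ => A ∩ (F n ∩ Metric.closedBall 0 (n : ℝ)) := fun i j hij =>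
      inter_subset_inter_right _ (inter_subset_inter (hFm hij)
        (Metric.closedBall_subset_closedBall (by exact_mod_cast hij)))
    rw [h1, hmono.measure_iUnion, hmono.measure_iUnion]
    refine iSup_congr fun n => hκK _ (fun x hx => hFU n hx.2.1) ?_
    exact ((isCompact_closedBall (0 : X) n).inter_left (hFc n)).inter_left hA
  have hκU : ∀ B, MeasurableSet B → κ (B ∩ U) = κ B := by
    intro B hB
    rw [hκ _ (hB.inter hU.measurableSet) inter_subset_right, withDensity_apply _ hB,
      Measure.restrict_restrict hB]
  have heq : N.restrict U = κ := by
    refine ext_of_generate_finite {s | IsClosed s} ?_ isPiSystem_isClosed (fun A hA => ?_) ?_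
    · rw [← borel_eq_generateFrom_isClosed]
      exact BorelSpace.measurable_eq
    · rw [Measure.restrict_apply hA.measurableSet, hclosed A hA, hκU A hA.measurableSet]
    · rw [Measure.restrict_apply .univ, hclosed _ isClosed_univ, hκU _ .univ]
  have hNB : ∀ B, MeasurableSet B → B ⊆ U → N B = ∫⁻ p in B, ENNReal.ofReal (k p) ∂vol := by
    intro B hB hBU
    rw [← hκ B hB hBU, ← heq, Measure.restrict_apply hB, inter_eq_self_of_subset_left hBU]
  refine ⟨⟨hkm, ?_⟩, fun B hB hBU => ?_⟩
  · rw [hasFiniteIntegral_iff_ofReal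
      ((ae_restrict_iff' hU.measurableSet).2 (.of_forall hk0)), ← hNB U hU.measurableSet subset_rfl]
    exact measure_lt_top N U
  · rw [integral_eq_lintegral_of_nonneg_ae
      ((ae_restrict_iff' hB).2 (.of_forall fun p hp => hk0 p (hBU hp)))
      (hkm.mono_measure (Measure.restrict_mono hBU le_rfl)), ← hNB B hB hBU, measureReal_def]

end Smoothing

/-! ### Poisson kernels and boundary values of Stieltjes transforms -/

/-- The Poisson kernel of the half-plane at height one. -/
def poisson (y : ℝ) : ℝ := Real.pi⁻¹ * (1 + y ^ 2)⁻¹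

theorem poisson_nonneg (y : ℝ) : 0 ≤ poisson y := by unfold poisson; positivity

theorem continuous_poisson : Continuous poisson := by
  unfold poisson
  exact continuous_const.mul (Continuous.inv₀ (by fun_prop) fun y => by positivity)

theorem integrable_poisson : Integrable poisson := integrable_inv_one_add_sq.const_mul _

theorem integral_poisson : ∫ y, poisson y = 1 := by
  simp only [poisson, integral_const_mul, integral_univ_inv_one_add_sq]
  exact inv_mul_cancel₀ Real.pi_ne_zero

/-- The sign `±1`; it distinguishes the two sides of the real axis. -/
def sgn (s : Bool) : ℝ := if s then 1 else -1

theorem poisson_scaled {η : ℝ} (hη : 0 < η) (E x : ℝ) :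
    ((η⁻¹ * poisson (η⁻¹ * (E - x)) : ℝ) : ℂ) =
      (2 * Real.pi * I)⁻¹ * ∑ s : Bool, sgn s * (x - (E + sgn s * η * I) : ℂ)⁻¹ := by
  have hpi : (Real.pi : ℂ) ≠ 0 := ofReal_ne_zero.2 Real.pi_ne_zero
  have hη' : (η : ℂ) ≠ 0 := ofReal_ne_zero.2 hη.ne'
  have h1 : (x - (E + η * I) : ℂ) ≠ 0 := fun h => hη.ne' (by simpa using congrArg Complex.im h)
  have h2 : (x - (E - η * I) : ℂ) ≠ 0 := fun h => hη.ne' (by simpa using congrArg Complex.im h)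
  have h3 : (1 + ((η : ℂ)⁻¹ * (E - x)) ^ 2) * η ^ 2 = (x - (E + η * I)) * (x - (E - η * I)) := by
    have : (η : ℂ)⁻¹ * η = 1 := inv_mul_cancel₀ hη'
    linear_combination ((E - x) ^ 2 * ((η : ℂ)⁻¹ * η + 1)) * this + η ^ 2 * I_sq
  have h4 : (1 + ((η : ℂ)⁻¹ * (E - x)) ^ 2) ≠ 0 := by
    intro h
    rw [h, zero_mul] at h3
    exact mul_ne_zero h1 h2 h3.symm
  simp only [Fintype.sum_bool, sgn, poisson]
  push_cast
  simp only [one_mul, neg_mul, ← sub_eq_add_neg]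
  rw [inv_sub_inv h1 h2, ← h3]
  field_simp
  ring

/-- The Stieltjes transform `∫ (x - z)⁻¹ dN(x)`. -/
def stieltjes (N : Measure ℝ) (z : ℂ) : ℂ := ∫ x : ℝ, (x - z : ℂ)⁻¹ ∂N

/-- The Stieltjes transform `∫ (x - z)⁻¹ (x' - z')⁻¹ dN(x, x')`. -/
def stieltjes₂ (N : Measure (ℝ × ℝ)) (z z' : ℂ) : ℂ :=
  ∫ p : ℝ × ℝ, (p.1 - z : ℂ)⁻¹ * (p.2 - z' : ℂ)⁻¹ ∂N

theorem sgn_ne_zero (s : Bool) : sgn s ≠ 0 := by cases s <;> simp [sgn]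

theorem im_boundary_ne_zero {η : ℝ} (hη : 0 < η) (E : ℝ) (s : Bool) :
    (E + sgn s * η * I : ℂ).im ≠ 0 := by
  simpa using ⟨sgn_ne_zero s, hη.ne'⟩

/-- The smoothing with the Poisson kernel is `1 / (2 π i)` times the jump of the Stieltjes transform
between `E - i η` and `E + i η`. -/
theorem smoothing_poisson (N : Measure ℝ) [IsFiniteMeasure N] {η : ℝ} (hη : 0 < η) (E : ℝ) :
    (smoothing poisson N η E : ℂ) =
      (2 * Real.pi * I)⁻¹ * ∑ s : Bool, sgn s * stieltjes N (E + sgn s * η * I) := by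
  have hint : ∀ s : Bool, Integrable (fun x : ℝ => (x - (E + sgn s * η * I) : ℂ)⁻¹) N := fun s =>
    .of_bound (resFun _ (im_boundary_ne_zero hη E s)).continuous.aestronglyMeasurable
      ‖resFun _ (im_boundary_ne_zero hη E s)‖
      (.of_forall fun x => norm_zeroAtInfty_apply_le (resFun _ (im_boundary_ne_zero hη E s)) x)
  simp only [stieltjes, ← integral_const_mul]
  rw [← integral_finsetSum _ fun s _ => (hint s).const_mul _, ← integral_const_mul, smoothing,
    ← integral_complex_ofReal]
  refine integral_congr_ae (.of_forall fun x => ?_)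
  simp only [Module.finrank_self, pow_one, smul_eq_mul]
  exact poisson_scaled hη E x

/-- The Poisson kernel of a product of two half-planes. -/
def poisson₂ (y : ℝ × ℝ) : ℝ := poisson y.1 * poisson y.2

theorem smoothing_poisson₂ (N : Measure (ℝ × ℝ)) [IsFiniteMeasure N] {η : ℝ} (hη : 0 < η)
    (p : ℝ × ℝ) :
    (smoothing poisson₂ N η p : ℂ) = (2 * Real.pi * I)⁻¹ ^ 2 * ∑ s : Bool, ∑ s' : Bool,
      sgn s * sgn s' * stieltjes₂ N (p.1 + sgn s * η * I) (p.2 + sgn s' * η * I) := by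
  have hint : ∀ s s' : Bool, Integrable (fun x : ℝ × ℝ => (x.1 - (p.1 + sgn s * η * I) : ℂ)⁻¹ *
      (x.2 - (p.2 + sgn s' * η * I) : ℂ)⁻¹) N := fun s s' => by
    have h := measurable_and_norm_le_mul (resFun _ (im_boundary_ne_zero hη p.1 s))
      (resFun _ (im_boundary_ne_zero hη p.2 s'))
    exact .of_bound h.1.aestronglyMeasurable _ (.of_forall h.2)
  simp only [stieltjes₂, ← integral_const_mul]
  have h2 : ∑ s : Bool, ∑ s' : Bool, ∫ x : ℝ × ℝ, (sgn s * sgn s' : ℂ) *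
      ((x.1 - (p.1 + sgn s * η * I) : ℂ)⁻¹ * (x.2 - (p.2 + sgn s' * η * I) : ℂ)⁻¹) ∂N =
      ∫ x : ℝ × ℝ, ∑ s : Bool, ∑ s' : Bool, (sgn s * sgn s' : ℂ) *
        ((x.1 - (p.1 + sgn s * η * I) : ℂ)⁻¹ * (x.2 - (p.2 + sgn s' * η * I) : ℂ)⁻¹) ∂N := by
    rw [integral_finsetSum _ fun s _ =>
      integrable_finsetSum _ fun s' _ => (hint s s').const_mul _]
    exact Finset.sum_congr rfl fun s _ =>
      (integral_finsetSum _ fun s' _ => (hint s s').const_mul _).symm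
  rw [h2, ← integral_const_mul, smoothing, ← integral_complex_ofReal]
  refine integral_congr_ae (.of_forall fun x => ?_)
  have h3 : ((η ^ Module.finrank ℝ (ℝ × ℝ))⁻¹ * poisson₂ (η⁻¹ • (p - x)) : ℝ) =
      (η⁻¹ * poisson (η⁻¹ * (p.1 - x.1))) * (η⁻¹ * poisson (η⁻¹ * (p.2 - x.2))) := by
    rw [Module.finrank_prod, Module.finrank_self, poisson₂, ← inv_pow]
    simp only [Prod.smul_fst, Prod.smul_snd, Prod.fst_sub, Prod.snd_sub, smul_eq_mul]
    ring
  simp only [h3]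
  rw [ofReal_mul, poisson_scaled hη, poisson_scaled hη, mul_mul_mul_comm, ← sq, Finset.sum_mul_sum]
  congr 1
  refine Finset.sum_congr rfl fun s _ => Finset.sum_congr rfl fun s' _ => ?_
  ring

/-- If, near every point of `U`, the smoothings of `N` extend continuously to `η = 0`, then `N` has
a density on `U`, and it is given by this extension. -/
theorem exists_density_of_continuous_extension {X : Type*} [NormedAddCommGroup X] [NormedSpace ℝ X]
    [FiniteDimensional ℝ X] [MeasurableSpace X] [BorelSpace X] {vol : Measure X}
    [vol.IsAddHaarMeasure] {P : X → ℝ} {N : Measure X} [IsFiniteMeasure N] (hPc : Continuous P)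
    (hP0 : ∀ y, 0 ≤ P y) (hP : Integrable P vol) (hP1 : ∫ y, P y ∂vol = 1) {U : Set X}
    (hU : IsOpen U)
    (h : ∀ p ∈ U, ∃ Φ : X × ℝ → ℂ, ∀ᶠ w in 𝓝 (p, (0 : ℝ)), ContinuousAt Φ w ∧
      (0 < w.2 → (smoothing P N w.2 w.1 : ℂ) = Φ w)) :
    ∃ k : X → ℝ, (∀ p ∈ U, 0 ≤ k p) ∧
      (∀ p ∈ U, ∀ Φ : X × ℝ → ℂ, (∀ᶠ w in 𝓝 (p, (0 : ℝ)), ContinuousAt Φ w ∧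
        (0 < w.2 → (smoothing P N w.2 w.1 : ℂ) = Φ w)) → ∀ᶠ q in 𝓝 p, (k q : ℂ) = Φ (q, 0)) ∧
      IntegrableOn k U vol ∧ ∀ B, MeasurableSet B → B ⊆ U → N.real B = ∫ p in B, k p ∂vol := by
  let η (n : ℕ) : ℝ := 1 / (n + 1)
  have hη : ∀ n, 0 < η n := fun n => by positivity
  have hη0 : Tendsto η atTop (𝓝 0) := tendsto_one_div_add_atTop_nhds_zero_nat
  -- a choice of `k` that does not depend on the local extensions; the limit exists on `U`
  let k (p : X) : ℝ := limUnder atTop fun n => smoothing P N (η n) p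
  have hloc : ∀ p ∈ U, ∀ Φ : X × ℝ → ℂ, (∀ᶠ w in 𝓝 (p, (0 : ℝ)), ContinuousAt Φ w ∧
      (0 < w.2 → (smoothing P N w.2 w.1 : ℂ) = Φ w)) →
      ∀ᶠ q in 𝓝 p, Tendsto (fun n => smoothing P N (η n) q) atTop (𝓝 (k q)) ∧
        (k q : ℂ) = Φ (q, 0) := by
    intro p hp Φ hΦ
    have h1 : ∀ᶠ q in 𝓝 p, ∀ᶠ w in 𝓝 (q, (0 : ℝ)), ContinuousAt Φ w ∧
        (0 < w.2 → (smoothing P N w.2 w.1 : ℂ) = Φ w) :=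
      (Continuous.prodMk_left (0 : ℝ)).continuousAt.eventually (eventually_eventually_nhds.2 hΦ)
    filter_upwards [h1] with q hq
    have h2 : Tendsto (fun n => (q, η n)) atTop (𝓝 (q, (0 : ℝ))) :=
      tendsto_const_nhds.prodMk_nhds hη0
    have h3 : Tendsto (fun n => (smoothing P N (η n) q : ℂ)) atTop (𝓝 (Φ (q, 0))) := by
      refine (hq.self_of_nhds.1.tendsto.comp h2).congr' ?_
      filter_upwards [h2.eventually hq] with n hn
      exact (hn.2 (hη n)).symm
    have h4 := (continuous_re.tendsto _).comp h3
    have h5 := (continuous_im.tendsto _).comp h3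
    have h6 : (Φ (q, 0)).im = 0 := tendsto_nhds_unique h5 (by simp [Function.comp_def])
    have h7 : k q = (Φ (q, 0)).re := h4.limUnder_eq
    refine ⟨by rw [h7]; exact h4, ?_⟩
    rw [h7]
    exact Complex.ext rfl h6.symm
  choose! Φ hΦ using h
  have hlim : ∀ p ∈ U, Tendsto (fun n => smoothing P N (η n) p) atTop (𝓝 (k p)) := fun p hp =>
    (hloc p hp (Φ p) (hΦ p hp)).self_of_nhds.1
  have hkc : ContinuousOn k U := by
    intro p hp
    refine ContinuousAt.continuousWithinAt ?_
    have h1 : ContinuousAt (fun q => (Φ p (q, 0)).re) p :=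
      continuous_re.continuousAt.comp (ContinuousAt.comp (f := fun q => (q, (0 : ℝ)))
        (hΦ p hp).self_of_nhds.1 (Continuous.prodMk_left (0 : ℝ)).continuousAt)
    refine h1.congr ?_
    filter_upwards [hloc p hp (Φ p) (hΦ p hp)] with q hq
    rw [← hq.2, ofReal_re]
  have hbd : ∀ p ∈ U, ∃ W ∈ 𝓝 p, ∃ C, ∀ᶠ n in atTop, ∀ q ∈ W, |smoothing P N (η n) q| ≤ C := by
    intro p hp
    have h1 : ∀ᶠ w in 𝓝 (p, (0 : ℝ)), ‖Φ p w‖ < ‖Φ p (p, 0)‖ + 1 :=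
      (hΦ p hp).self_of_nhds.1.norm.eventually (gt_mem_nhds (lt_add_one _))
    have h2 := h1.and (hΦ p hp)
    rw [nhds_prod_eq] at h2
    obtain ⟨W, hW, T, hT, hWT⟩ := eventually_prod_iff.1 h2
    refine ⟨{q | W q}, hW, ‖Φ p (p, 0)‖ + 1, ?_⟩
    filter_upwards [hη0.eventually hT] with n hn q hq
    obtain ⟨h3, -, h4⟩ := hWT hq hn
    rw [← Real.norm_eq_abs, ← norm_real, h4 (hη n)]
    exact h3.le
  obtain ⟨h1, h2⟩ := hasDensity_of_tendsto_smoothing hPc hP0 hP hP1 hη hη0 hU hkc hlim hbd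
  exact ⟨k, fun p hp => ge_of_tendsto' (hlim p hp) fun n => smoothing_nonneg hP0 (hη n) p,
    fun p hp Φ hΦ => (hloc p hp Φ hΦ).mono fun q hq => hq.2, h1, h2⟩

/-- If the Stieltjes transform of `N` continues analytically across the real axis from both sides,
then the jump of the continuations is the density of `N`. -/
theorem density_of_continuation (N : Measure ℝ) [IsFiniteMeasure N] {a : ℝ} (ha : 0 < a)
    {G : Bool → ℂ → ℂ} (hG : ∀ s, DifferentiableOn ℂ (G s) (strip a))
    (hK : ∀ s z, z ∈ strip a → 0 < sgn s * z.im → stieltjes N z = G s z) :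
    ∃ k : ℝ → ℝ, (∀ E : ℝ, (k E : ℂ) = (2 * Real.pi * I)⁻¹ * ∑ s : Bool, sgn s * G s E) ∧
      (∀ E, 0 ≤ k E) ∧ Integrable k ∧ ∀ E, N.real (Iic E) = ∫ x in Iic E, k x := by
  let pt (s : Bool) (w : ℝ × ℝ) : ℂ := w.1 + sgn s * w.2 * I
  have hpt : ∀ s, Continuous (pt s) := fun s => by fun_prop
  let Φ (w : ℝ × ℝ) : ℂ := (2 * Real.pi * I)⁻¹ * ∑ s : Bool, sgn s * G s (pt s w)
  have hstrip : ∀ s E, ∀ᶠ w in 𝓝 (E, (0 : ℝ)), pt s w ∈ strip a := fun s E =>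
    (hpt s).continuousAt.eventually ((isOpen_strip a).mem_nhds (by simpa [pt, strip] using ha))
  have hΦ : ∀ E : ℝ, ∀ᶠ w in 𝓝 (E, (0 : ℝ)), ContinuousAt Φ w ∧
      (0 < w.2 → (smoothing poisson N w.2 w.1 : ℂ) = Φ w) := by
    intro E
    filter_upwards [hstrip true E, hstrip false E] with w h1 h2
    have h3 : ∀ s, pt s w ∈ strip a := fun s => by cases s <;> assumption
    refine ⟨?_, fun hw => ?_⟩
    · refine continuousAt_const.mul (tendsto_finsetSum _ fun s _ => Tendsto.const_mul _ ?_)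
      exact ContinuousAt.comp (f := pt s) (((hG s).differentiableAt
        ((isOpen_strip a).mem_nhds (h3 s))).continuousAt) (hpt s).continuousAt
    · rw [smoothing_poisson N hw]
      simp only [Φ]
      congr 1
      refine Finset.sum_congr rfl fun s _ => ?_
      rw [hK s _ (h3 s) (by cases s <;> simpa [pt, sgn] using hw)]
  obtain ⟨k, hk0, hkΦ, hki, hkN⟩ := exists_density_of_continuous_extension (vol := volume) (N := N)
    continuous_poisson poisson_nonneg integrable_poisson integral_poisson isOpen_univ
    fun E _ => ⟨Φ, hΦ E⟩
  refine ⟨k, fun E => ?_, fun E => hk0 E trivial, by simpa using hki, fun E =>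
    hkN _ measurableSet_Iic (subset_univ _)⟩
  rw [(hkΦ E trivial Φ (hΦ E)).self_of_nhds]
  simp [Φ, pt]

/-- If the Stieltjes transform of a measure on the plane continues analytically, from each of the
four sides, to a neighbourhood of every point of `U`, then the measure has a real analytic density
on `U`. -/
theorem exists_analytic_density (N : Measure (ℝ × ℝ)) [IsFiniteMeasure N] {U : Set (ℝ × ℝ)}
    (hU : IsOpen U)
    (h : ∀ p ∈ U, ∀ s s' : Bool, ∃ G : ℂ × ℂ → ℂ, AnalyticAt ℂ G (p.1, p.2) ∧
      ∀ᶠ q in 𝓝 ((p.1, p.2) : ℂ × ℂ), 0 < sgn s * q.1.im → 0 < sgn s' * q.2.im →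
        stieltjes₂ N q.1 q.2 = G q) :
    ∃ k : ℝ × ℝ → ℝ, AnalyticOnNhd ℝ k U ∧ IntegrableOn k U ∧
      ∀ B, MeasurableSet B → B ⊆ U → N.real B = ∫ p in B, k p := by
  choose! G hGan hGK using h
  let pt (s s' : Bool) (w : (ℝ × ℝ) × ℝ) : ℂ × ℂ :=
    (w.1.1 + sgn s * w.2 * I, w.1.2 + sgn s' * w.2 * I)
  have hpt : ∀ s s', Continuous (pt s s') := fun s s' => by fun_prop
  have hpt0 : ∀ s s' p, pt s s' (p, 0) = (↑p.1, ↑p.2) := fun s s' p => by simp [pt]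
  let Φ (p : ℝ × ℝ) (w : (ℝ × ℝ) × ℝ) : ℂ := (2 * Real.pi * I)⁻¹ ^ 2 *
    ∑ s : Bool, ∑ s' : Bool, sgn s * sgn s' * G p s s' (pt s s' w)
  have hΦ : ∀ p ∈ U, ∀ᶠ w in 𝓝 (p, (0 : ℝ)), ContinuousAt (Φ p) w ∧
      (0 < w.2 → (smoothing poisson₂ N w.2 w.1 : ℂ) = Φ p w) := by
    intro p hp
    have h1 : ∀ s s', ∀ᶠ w in 𝓝 (p, (0 : ℝ)), AnalyticAt ℂ (G p s s') (pt s s' w) ∧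
        (0 < w.2 → stieltjes₂ N (pt s s' w).1 (pt s s' w).2 = G p s s' (pt s s' w)) := by
      intro s s'
      have h2 := ((hGan p hp s s').eventually_analyticAt.and (hGK p hp s s'))
      rw [← hpt0 s s'] at h2
      refine ((hpt s s').continuousAt.eventually h2).mono fun w hw => ⟨hw.1, fun hw0 => ?_⟩
      exact hw.2 (by cases s <;> simpa [pt, sgn] using hw0) (by cases s' <;> simpa [pt, sgn] using hw0)
    have h3 := eventually_all.2 fun s => eventually_all.2 fun s' => h1 s s'
    filter_upwards [h3] with w hw
    refine ⟨?_, fun hw0 => ?_⟩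
    · refine continuousAt_const.mul (tendsto_finsetSum _ fun s _ => tendsto_finsetSum _ fun s' _ =>
        Tendsto.const_mul _ ?_)
      exact ContinuousAt.comp (f := pt s s') (hw s s').1.continuousAt (hpt s s').continuousAt
    · rw [smoothing_poisson₂ N hw0]
      simp only [Φ]
      congr 1
      refine Finset.sum_congr rfl fun s _ => Finset.sum_congr rfl fun s' _ => ?_
      rw [← (hw s s').2 hw0]
  have hP1 : ∫ y, poisson₂ y = 1 := by
    rw [Measure.volume_eq_prod]
    simp only [poisson₂]
    rw [integral_prod_mul poisson poisson, integral_poisson, mul_one]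
  obtain ⟨k, -, hkΦ, hki, hkN⟩ := exists_density_of_continuous_extension (vol := volume) (N := N)
    (P := poisson₂) ((continuous_poisson.comp continuous_fst).mul
      (continuous_poisson.comp continuous_snd))
    (fun y => mul_nonneg (poisson_nonneg _) (poisson_nonneg _))
    (integrable_poisson.mul_prod integrable_poisson) hP1 hU fun p hp => ⟨Φ p, hΦ p hp⟩
  refine ⟨k, fun p hp => ?_, hki, hkN⟩
  have hcast : AnalyticAt ℝ (fun q : ℝ × ℝ => ((q.1, q.2) : ℂ × ℂ)) p :=
    ((ofRealCLM.analyticAt _).comp analyticAt_fst).prod ((ofRealCLM.analyticAt _).comp analyticAt_snd)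
  have h1 : AnalyticAt ℝ (fun q => Φ p (q, 0)) p := by
    simp only [Φ, hpt0]
    refine analyticAt_const.mul (Finset.analyticAt_fun_sum _ fun s _ =>
      Finset.analyticAt_fun_sum _ fun s' _ => analyticAt_const.mul ?_)
    exact AnalyticAt.comp (f := fun q : ℝ × ℝ => ((q.1, q.2) : ℂ × ℂ))
      ((hGan p hp s s').restrictScalars) hcast
  have h2 : AnalyticAt ℝ (fun q => (Φ p (q, 0)).re) p := (reCLM.analyticAt _).comp h1
  refine h2.congr ?_
  filter_upwards [hkΦ p hp (Φ p) (hΦ p hp)] with q hq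
  rw [← hq, ofReal_re]

end

/-! ### Walk expansions of averaged resolvents -/

section

variable {d : ℕ} {r C : ℝ} {g : ℂ → ℂ} {lam : ℝ} {γ w : ℝ → ℂ}

/-- Averaging a walk expansion term by term. -/
theorem integral_eq_walkSeries (hr : 0 < r) (hg : IsSiteDensity r g)
    (hd : IsDeformation r g C γ w) {ι : Type*} [Countable ι] {c : ι → ℂ} {l l' : ι → List (Site d)}
    (hs : Summable fun i => ‖c i‖ * (r + 1)⁻¹ ^ ((l i).length + (l' i).length)) {z z' : ℂ}
    (hz : r + 1 ≤ |z.im|) (hz' : r + 1 ≤ |z'.im|) {F : (Site d → ℝ) → ℂ}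
    (hF : ∀ V, HasSum (fun i => c i * (((l i).map fun x => (V x - z : ℂ)⁻¹).prod *
      ((l' i).map fun x => (V x - z' : ℂ)⁻¹).prod)) (F V)) :
    ∫ V, F V ∂(disorder d g) = walkSeries γ w c l l' z z' := by
  have hP := hg.isProbabilityMeasure_disorder d
  have hr1 : 0 < r + 1 := by linarith
  have hz0 : z.im ≠ 0 := abs_pos.1 (hr1.trans_le hz)
  have hz0' : z'.im ≠ 0 := abs_pos.1 (hr1.trans_le hz')
  let f (i : ι) (V : Site d → ℝ) : ℂ := c i * (((l i).map fun x => (V x - z : ℂ)⁻¹).prod *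
    ((l' i).map fun x => (V x - z' : ℂ)⁻¹).prod)
  have hbd : ∀ i V, ‖f i V‖ ≤ ‖c i‖ * (r + 1)⁻¹ ^ ((l i).length + (l' i).length) := by
    intro i V
    simp only [f]
    rw [norm_mul, norm_mul, pow_add]
    have h1 := norm_list_prod_le V hz0 (l i)
    have h2 := norm_list_prod_le V hz0' (l' i)
    have h3 : |z.im|⁻¹ ≤ (r + 1)⁻¹ := inv_anti₀ hr1 hz
    have h4 : |z'.im|⁻¹ ≤ (r + 1)⁻¹ := inv_anti₀ hr1 hz'
    refine mul_le_mul_of_nonneg_left (mul_le_mul (h1.trans ?_) (h2.trans ?_) (norm_nonneg _)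
      (by positivity)) (norm_nonneg _)
    · gcongr
    · gcongr
  have hmeas : ∀ i, AEStronglyMeasurable (f i) (disorder d g) := fun i =>
    (((measurable_list_prod z (l i)).mul (measurable_list_prod z' (l' i))).const_mul
      (c i)).aestronglyMeasurable
  have hint : ∀ i, Integrable (f i) (disorder d g) := fun i =>
    .of_bound (hmeas i) _ (.of_forall (hbd i))
  have hnorm : Summable fun i => ∫ V, ‖f i V‖ ∂(disorder d g) := by
    refine Summable.of_nonneg_of_le (fun i => integral_nonneg fun _ => norm_nonneg _) (fun i => ?_) hs
    calc ∫ V, ‖f i V‖ ∂(disorder d g) ≤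
        ∫ _, ‖c i‖ * (r + 1)⁻¹ ^ ((l i).length + (l' i).length) ∂(disorder d g) :=
          integral_mono (hint i).norm (integrable_const _) (hbd i)
      _ = _ := by simp
  have h1 := (hasSum_integral_of_summable_integral_norm hint hnorm).tsum_eq
  rw [walkSeries]
  calc ∫ V, F V ∂(disorder d g) = ∫ V, ∑' i, f i V ∂(disorder d g) := by
        simp only [fun V => (hF V).tsum_eq.symm, f]
    _ = ∑' i, ∫ V, f i V ∂(disorder d g) := h1.symm
    _ = _ := by
        refine tsum_congr fun i => ?_
        simp only [f]
        rw [integral_const_mul, hg.integral_list_prod hd hz hz']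

/-- The coefficients of the walk expansion of `⟨0| (H - z)⁻¹ |0⟩`. -/
def loopCoeff (lam : ℝ) (s : List (Step d)) : ℂ :=
  (-lam : ℂ) ^ s.length * basisVec (0 : Site d) (endpoint 0 s)

theorem summable_pow_lam {x : ℝ} (hx : 0 ≤ x) (h : 2 * d * |lam| * x < 1) :
    Summable fun s : List (Step d) => (|lam| * x) ^ s.length := by
  refine summable_pow_length (by positivity) ?_
  simp only [Fintype.card_prod, Fintype.card_fin, Fintype.card_bool]
  push_cast
  linarith

theorem summable_loopCoeff {x : ℝ} (hx : 0 ≤ x) (h : 2 * d * |lam| * x < 1) :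
    Summable fun s : List (Step d) => ‖loopCoeff lam s‖ *
      x ^ ((path 0 s).length + ([] : List (Site d)).length) := by
  refine Summable.of_nonneg_of_le (fun s => by positivity) (fun s => ?_)
    ((summable_pow_lam hx h).mul_right x)
  rw [loopCoeff, norm_mul, norm_pow, norm_neg, norm_real, Real.norm_eq_abs, length_path,
    List.length_nil, add_zero, pow_succ, mul_pow]
  have h1 : ‖basisVec (0 : Site d) (endpoint 0 s)‖ ≤ 1 := by
    rw [← norm_basisVec (0 : Site d)]
    exact lp.norm_apply_le_norm two_ne_zero _ _
  calc |lam| ^ s.length * ‖basisVec (0 : Site d) (endpoint 0 s)‖ * (x ^ s.length * x)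
      ≤ |lam| ^ s.length * 1 * (x ^ s.length * x) := by gcongr
    _ = _ := by ring

/-- Far from the real axis, the Stieltjes transform `𝒯((H - z)⁻¹)` of the density of states measure
is the walk series along any admissible contour. -/
theorem stieltjes_eq_walkSeries (hr : 0 < r) (hg : IsSiteDensity r g)
    (hd : IsDeformation r g C γ w) (hlam : 2 * d * |lam| < 1) {N : Measure ℝ}
    (hN : ∀ f : C₀(ℝ, ℂ), traceP d g (fun V => funCalc (hamiltonian lam V) f) = ∫ x, f x ∂N) {z : ℂ}
    (hz : r + 1 ≤ |z.im|) :
    stieltjes N z = walkSeries γ w (loopCoeff (d := d) lam) (path 0) (fun _ => []) z z := by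
  have hz0 : z.im ≠ 0 := abs_pos.1 (by linarith)
  have hzl : 2 * d * |lam| < |z.im| := by linarith
  have hU := cayley_hamiltonian_mem_unitary (d := d) hlam
  have hx : (0 : ℝ) ≤ (r + 1)⁻¹ := by positivity
  have hx1 : 2 * d * |lam| * (r + 1)⁻¹ < 1 :=
    (mul_le_of_le_one_right (by positivity) (inv_le_one_of_one_le₀ (by linarith))).trans_lt hlam
  rw [← integral_eq_walkSeries (d := d) hr hg hd (summable_loopCoeff hx hx1) hz hz
    (F := fun V => entry (resolventAt (hamiltonian lam V) z) 0 0) (fun V => ?_)]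
  · have h1 := hN (resFun z hz0)
    simp only [fun V => funCalc_resFun (hU V) (exists_isResolventAt V (by simpa using hlam)) hz0
      (isResolventAt_resolventAt V hzl)] at h1
    rw [← traceP_eq_integral_entry, h1]
    rfl
  · convert! (isResolventAt_resolventAt V hzl).hasSum_walkTerm hzl (basisVec 0) 0 using 1
    funext s
    simp only [walkTerm, loopCoeff, List.map_nil, List.prod_nil]
    ring

/-- `(A ψ)(x) = ∑_e α_e ψ(x + e)`, the sum over the `2 d` unit steps. -/
def IsNeighborSum (α : Step d → ℂ) (A : Hilb d →L[ℂ] Hilb d) : Prop :=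
  ∀ ψ x, A ψ x = ∑ e, α e * ψ (x + stepVec e)

theorem IsNeighborSum.add {α β : Step d → ℂ} {A B : Hilb d →L[ℂ] Hilb d} (hA : IsNeighborSum α A)
    (hB : IsNeighborSum β B) : IsNeighborSum (α + β) (A + B) := fun ψ x => by
  rw [add_apply, lp.coeFn_add, Pi.add_apply, hA, hB, ← Finset.sum_add_distrib]
  simp only [Pi.add_apply, add_mul]

theorem IsNeighborSum.smul (c : ℂ) {α : Step d → ℂ} {A : Hilb d →L[ℂ] Hilb d}
    (hA : IsNeighborSum α A) : IsNeighborSum (c • α) (c • A) := fun ψ x => by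
  rw [smul_apply, lp.coeFn_smul, Pi.smul_apply, hA, smul_eq_mul, Finset.mul_sum]
  simp only [Pi.smul_apply, smul_eq_mul, mul_assoc]

theorem isNeighborSum_velocity (lam : ℝ) (ν : Fin d) : ∃ α, IsNeighborSum α (velocity lam ν) := by
  refine ⟨fun e => I * lam * if e.1 = ν then (if e.2 then -1 else 1) else 0, fun ψ x => ?_⟩
  have h1 : ∀ j : Fin d, ∑ b : Bool, (I * lam * if j = ν then (if b then -1 else 1) else 0) *
      ψ (x + stepVec (j, b)) = if j = ν then I * lam * (ψ (x - unitVec j) - ψ (x + unitVec j))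
        else 0 := by
    intro j
    by_cases h : j = ν
    · simp only [Fintype.sum_bool, stepVec, h, if_true, Bool.false_eq_true, if_false,
        ← sub_eq_add_neg]
      ring
    · simp [h]
  rw [Fintype.sum_prod_type]
  simp only [h1, Finset.sum_ite_eq', Finset.mem_univ, if_true]
  simp only [velocity, smul_apply, sub_apply, lp.coeFn_smul, lp.coeFn_sub, Pi.smul_apply,
    Pi.sub_apply, shift_apply, smul_eq_mul, ← sub_eq_add_neg]

theorem isNeighborSum_polarVelocity (lam : ℝ) (ν ν' : Fin d) (k : Fin 4) :
    ∃ α, IsNeighborSum α (polarVelocity lam ν ν' k) := by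
  obtain ⟨α, hα⟩ := isNeighborSum_velocity lam ν
  obtain ⟨β, hβ⟩ := isNeighborSum_velocity lam ν'
  exact ⟨_, hα.add (hβ.smul _)⟩

/-- The index set of the walk expansion of `⟨0| (H - z)⁻¹ A (H - z')⁻¹ A' |0⟩`: a walk, a step from
its end point, and a walk from there. -/
abbrev WalkPair (d : ℕ) : Type := List (Step d) × Step d × List (Step d)

/-- The starting point of the second walk of a pair. -/
def secondStart (q : WalkPair d) : Site d := endpoint 0 q.1 + stepVec q.2.1

/-- The coefficients of the walk expansion of `((H - z)⁻¹ A (H - z')⁻¹ φ)(0)`. -/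
def pairCoeff (lam : ℝ) (α : Step d → ℂ) (φ : Hilb d) (q : WalkPair d) : ℂ :=
  (-lam : ℂ) ^ q.1.length * α q.2.1 * (-lam : ℂ) ^ q.2.2.length *
    φ (endpoint (secondStart q) q.2.2)

theorem summable_pairCoeff (α : Step d → ℂ) (φ : Hilb d) {x : ℝ} (hx : 0 ≤ x)
    (h : 2 * d * |lam| * x < 1) :
    Summable fun q : WalkPair d => ‖pairCoeff lam α φ q‖ *
      x ^ ((path 0 q.1).length + (path (secondStart q) q.2.2).length) := by
  have h1 := summable_pow_lam (d := d) hx h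
  have h2 : Summable fun e : Step d => ‖α e‖ := (hasSum_fintype _).summable
  have h3 := (h1.mul_of_nonneg (h2.mul_of_nonneg h1 (fun _ => norm_nonneg _)
    fun s => by positivity) (fun s => by positivity) fun q => by positivity).mul_right (x * x * ‖φ‖)
  refine Summable.of_nonneg_of_le (fun q => by positivity) (fun q => ?_) h3
  rw [pairCoeff, norm_mul, norm_mul, norm_mul, norm_pow, norm_pow, norm_neg, norm_real,
    Real.norm_eq_abs, length_path, length_path]
  calc |lam| ^ q.1.length * ‖α q.2.1‖ * |lam| ^ q.2.2.length *
        ‖φ (endpoint (secondStart q) q.2.2)‖ * x ^ (q.1.length + 1 + (q.2.2.length + 1))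
      ≤ |lam| ^ q.1.length * ‖α q.2.1‖ * |lam| ^ q.2.2.length * ‖φ‖ *
        x ^ (q.1.length + 1 + (q.2.2.length + 1)) := by
        gcongr
        exact lp.norm_apply_le_norm two_ne_zero _ _
    _ = _ := by rw [mul_pow, mul_pow]; ring

theorem hasSum_pair {α : Step d → ℂ} {A : Hilb d →L[ℂ] Hilb d} (hA : IsNeighborSum α A) (φ : Hilb d)
    (V : Site d → ℝ) {z z' : ℂ} (hz : 2 * d * |lam| < |z.im|) (hz' : 2 * d * |lam| < |z'.im|) :
    HasSum (fun q : WalkPair d => pairCoeff lam α φ q *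
      (((path 0 q.1).map fun x => (V x - z : ℂ)⁻¹).prod *
        ((path (secondStart q) q.2.2).map fun x => (V x - z' : ℂ)⁻¹).prod))
      (resolventAt (hamiltonian lam V) z (A (resolventAt (hamiltonian lam V) z' φ)) 0) := by
  have hz0 : 0 < |z.im| := lt_of_le_of_lt (by positivity) hz
  have hz0' : 0 < |z'.im| := lt_of_le_of_lt (by positivity) hz'
  set m := min |z.im| |z'.im| with hm
  have hm0 : 0 < m := lt_min hz0 hz0'
  have hsum : Summable fun q : WalkPair d => pairCoeff lam α φ q *
      (((path 0 q.1).map fun x => (V x - z : ℂ)⁻¹).prod *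
        ((path (secondStart q) q.2.2).map fun x => (V x - z' : ℂ)⁻¹).prod) := by
    refine Summable.of_norm_bounded (summable_pairCoeff (lam := lam) α φ (x := m⁻¹) (by positivity) ?_)
      fun q => ?_
    · rw [← div_eq_mul_inv, div_lt_one hm0]
      exact lt_min hz hz'
    · rw [norm_mul, norm_mul, pow_add]
      have h1 := norm_list_prod_le V (abs_pos.1 hz0) (path 0 q.1)
      have h2 := norm_list_prod_le V (abs_pos.1 hz0') (path (secondStart q) q.2.2)
      have h3 : |z.im|⁻¹ ≤ m⁻¹ := inv_anti₀ hm0 (min_le_left _ _)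
      have h4 : |z'.im|⁻¹ ≤ m⁻¹ := inv_anti₀ hm0 (min_le_right _ _)
      refine mul_le_mul_of_nonneg_left (mul_le_mul (h1.trans ?_) (h2.trans ?_) (norm_nonneg _)
        (by positivity)) (norm_nonneg _)
      · gcongr
      · gcongr
  set R' := resolventAt (hamiltonian lam V) z' with hR'
  have hinner : ∀ s : List (Step d), HasSum (fun p : Step d × List (Step d) =>
      pairCoeff lam α φ (s, p) * (((path 0 s).map fun x => (V x - z : ℂ)⁻¹).prod *
        ((path (secondStart (s, p)) p.2).map fun x => (V x - z' : ℂ)⁻¹).prod))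
      (walkTerm lam V z (A (R' φ)) 0 s) := by
    intro s
    have h1 := (hsum.comp_injective (Prod.mk_right_injective s)).hasSum
    have h2 : ∀ e : Step d, HasSum (fun s' : List (Step d) =>
        pairCoeff lam α φ (s, e, s') * (((path 0 s).map fun x => (V x - z : ℂ)⁻¹).prod *
        ((path (secondStart (s, e, s')) s').map fun x => (V x - z' : ℂ)⁻¹).prod))
        ((-lam : ℂ) ^ s.length * ((path 0 s).map fun x => (V x - z : ℂ)⁻¹).prod *
          (α e * R' φ (endpoint 0 s + stepVec e))) := by
      intro e
      have h3 := (isResolventAt_resolventAt V hz').hasSum_walkTerm hz' φ (endpoint 0 s + stepVec e)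
      convert! h3.mul_left ((-lam : ℂ) ^ s.length *
        ((path 0 s).map fun x => (V x - z : ℂ)⁻¹).prod * α e) using 1
      · funext s'
        simp only [pairCoeff, walkTerm, secondStart]
        ring
      · rw [← hR']
        ring
    have h4 := h1.prod_fiberwise h2
    have h5 : walkTerm lam V z (A (R' φ)) 0 s = ∑ e, (-lam : ℂ) ^ s.length *
        ((path 0 s).map fun x => (V x - z : ℂ)⁻¹).prod *
          (α e * R' φ (endpoint 0 s + stepVec e)) := by
      rw [walkTerm, hA, Finset.mul_sum]
    rw [h5, (hasSum_fintype _).unique h4]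
    exact h1
  have h6 := hsum.hasSum.prod_fiberwise hinner
  rw [((isResolventAt_resolventAt V hz).hasSum_walkTerm hz _ 0).unique h6]
  exact hsum.hasSum

/-- Far from the real axis, the Stieltjes transform `𝒯((H - z)⁻¹ A (H - z')⁻¹ A')` is the walk
series along any admissible contour. -/
theorem stieltjes₂_eq_walkSeries (hr : 0 < r) (hg : IsSiteDensity r g)
    (hd : IsDeformation r g C γ w) (hlam : 2 * d * |lam| < 1) {α : Step d → ℂ}
    {A A' : Hilb d →L[ℂ] Hilb d} (hA : IsNeighborSum α A) {N : Measure (ℝ × ℝ)}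
    (hN : ∀ f f' : C₀(ℝ, ℂ), pairTrace g lam A A' f f' = ∫ p, f p.1 * f' p.2 ∂N) {z z' : ℂ}
    (hz : r + 1 ≤ |z.im|) (hz' : r + 1 ≤ |z'.im|) :
    stieltjes₂ N z z' = walkSeries γ w (pairCoeff lam α (A' (basisVec 0))) (fun q => path 0 q.1)
      (fun q => path (secondStart q) q.2.2) z z' := by
  have hz0 : z.im ≠ 0 := abs_pos.1 (by linarith)
  have hz0' : z'.im ≠ 0 := abs_pos.1 (by linarith)
  have hzl : 2 * d * |lam| < |z.im| := by linarith
  have hzl' : 2 * d * |lam| < |z'.im| := by linarith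
  have hU := cayley_hamiltonian_mem_unitary (d := d) hlam
  have hx : (0 : ℝ) ≤ (r + 1)⁻¹ := by positivity
  have hx1 : 2 * d * |lam| * (r + 1)⁻¹ < 1 :=
    (mul_le_of_le_one_right (by positivity) (inv_le_one_of_one_le₀ (by linarith))).trans_lt hlam
  rw [← integral_eq_walkSeries (d := d) hr hg hd (summable_pairCoeff α (A' (basisVec 0)) hx hx1)
    hz hz' fun V => hasSum_pair hA (A' (basisVec 0)) V hzl hzl']
  have h1 := hN (resFun z hz0) (resFun z' hz0')
  simp only [pairTrace, fun V => funCalc_resFun (hU V) (exists_isResolventAt V (by simpa using hlam))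
    hz0 (isResolventAt_resolventAt V hzl), fun V => funCalc_resFun (hU V)
    (exists_isResolventAt V (by simpa using hlam)) hz0' (isResolventAt_resolventAt V hzl')] at h1
  rw [traceP_eq_integral_entry] at h1
  exact h1.symm

end

/-! ### Holomorphy and continuation of the Stieltjes transforms -/

section

/-- The half-plane `{a < ± Im z}`. -/
def halfPlane (s : Bool) (a : ℝ) : Set ℂ := {z | a < sgn s * z.im}

theorem isOpen_halfPlane (s : Bool) (a : ℝ) : IsOpen (halfPlane s a) :=
  isOpen_lt continuous_const (by fun_prop)

theorem convex_halfPlane (s : Bool) (a : ℝ) : Convex ℝ (halfPlane s a) := by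
  cases s
  · have h : halfPlane false a = {z : ℂ | z.im < -a} := by
      ext z
      simp only [halfPlane, sgn, Bool.false_eq_true, if_false, mem_ofPred_eq]
      constructor <;> intro h <;> linarith
    rw [h]
    exact convex_halfSpace_im_lt _
  · have h : halfPlane true a = {z : ℂ | a < z.im} := by
      ext z
      simp [halfPlane, sgn]
    rw [h]
    exact convex_halfSpace_im_gt _

theorem abs_sgn_mul (s : Bool) (x : ℝ) : |sgn s * x| = |x| := by
  cases s <;> simp [sgn]

theorem sgn_mul_sgn (s : Bool) : sgn s * sgn s = 1 := by
  cases s <;> simp [sgn]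

theorem im_ne_zero_of_mem_halfPlane {s : Bool} {z : ℂ} (hz : z ∈ halfPlane s 0) : z.im ≠ 0 := by
  intro h
  simp [halfPlane, h] at hz

/-- The point of a half-plane with prescribed real part and distance from the real axis. -/
theorem exists_mem_halfPlane (s : Bool) (x y : ℝ) : ∃ z : ℂ, z.re = x ∧ sgn s * z.im = y :=
  ⟨x + (sgn s * y : ℝ) * I, by simp, by simp [← mul_assoc, sgn_mul_sgn]⟩

theorem differentiableOn_integral_inv_sub {X : Type*} [MeasurableSpace X] (N : Measure X)
    [IsFiniteMeasure N] {x : X → ℝ} (hx : Measurable x) {u : X → ℂ} (hu : Measurable u) {B : ℝ}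
    (hB : ∀ p, ‖u p‖ ≤ B) (s : Bool) :
    DifferentiableOn ℂ (fun z => ∫ p, (x p - z : ℂ)⁻¹ * u p ∂N) (halfPlane s 0) := by
  intro z₀ hz₀
  have hz₀' : 0 < sgn s * z₀.im := hz₀
  set a := sgn s * z₀.im / 2 with ha
  have ha0 : 0 < a := by positivity
  have hWo := isOpen_halfPlane s a
  have hW : z₀ ∈ halfPlane s a := by
    change a < sgn s * z₀.im
    linarith
  have hfar : ∀ z ∈ halfPlane s a, ∀ p, a ≤ ‖(x p - z : ℂ)‖ := by
    intro z hz p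
    have h1 : a < sgn s * z.im := hz
    have h2 := abs_im_le_norm (x p - z)
    rw [sub_im, ofReal_im, zero_sub, abs_neg, ← abs_sgn_mul s] at h2
    exact (h1.le.trans (le_abs_self _)).trans h2
  have hbd : ∀ z ∈ halfPlane s a, ∀ p n, ‖(x p - z : ℂ)⁻¹ ^ n * u p‖ ≤ a⁻¹ ^ n * B := by
    intro z hz p n
    rw [norm_mul]
    exact mul_le_mul (norm_inv_pow_le ha0 (hfar z hz p) n) (hB p) (norm_nonneg _) (by positivity)
  have hmeas : ∀ (z : ℂ) (n : ℕ), AEStronglyMeasurable (fun p => (x p - z : ℂ)⁻¹ ^ n * u p) N :=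
    fun z n => by
      have : Measurable fun p => (x p - z : ℂ)⁻¹ ^ n * u p := by fun_prop
      exact this.aestronglyMeasurable
  have h1 := (hasDerivAt_integral_of_dominated_loc_of_deriv_le (μ := N)
    (F := fun z p => (x p - z : ℂ)⁻¹ * u p) (F' := fun z p => (x p - z : ℂ)⁻¹ ^ 2 * u p)
    (bound := fun _ => a⁻¹ ^ 2 * B) (hWo.mem_nhds hW)
    (.of_forall fun z => by simpa using hmeas z 1)
    (.of_bound (by simpa using hmeas z₀ 1) (a⁻¹ ^ 1 * B)
      (.of_forall fun p => by simpa using hbd z₀ hW p 1))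
    (hmeas z₀ 2) (.of_forall fun p z hz => hbd z hz p 2) (integrable_const _)
    (.of_forall fun p z hz => ?_)).2
  · exact h1.differentiableAt.differentiableWithinAt
  · have hne : (x p - z : ℂ) ≠ 0 := norm_pos_iff.1 (ha0.trans_le (hfar z hz p))
    have h2 : HasDerivAt (fun z : ℂ => (x p - z : ℂ)⁻¹) (-(-1) / (x p - z) ^ 2) z :=
      ((hasDerivAt_id z).const_sub (x p : ℂ)).inv hne
    convert! h2.mul_const (u p) using 1
    rw [neg_neg, one_div, inv_pow]

theorem differentiableOn_stieltjes (N : Measure ℝ) [IsFiniteMeasure N] (s : Bool) :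
    DifferentiableOn ℂ (stieltjes N) (halfPlane s 0) := by
  have h := differentiableOn_integral_inv_sub N (x := fun p => p) measurable_id' (u := fun _ => 1)
    measurable_const (B := 1) (by simp) s
  simp only [mul_one] at h
  exact h

theorem differentiableOn_stieltjes₂_left (N : Measure (ℝ × ℝ)) [IsFiniteMeasure N] (s : Bool)
    {z' : ℂ} (hz' : z'.im ≠ 0) :
    DifferentiableOn ℂ (fun z => stieltjes₂ N z z') (halfPlane s 0) :=
  differentiableOn_integral_inv_sub N measurable_fst
    (u := fun p => (p.2 - z' : ℂ)⁻¹) (by fun_prop) (fun p => norm_inv_sub_le hz' p.2) s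

theorem differentiableOn_stieltjes₂_right (N : Measure (ℝ × ℝ)) [IsFiniteMeasure N] (s : Bool)
    {z : ℂ} (hz : z.im ≠ 0) :
    DifferentiableOn ℂ (fun z' => stieltjes₂ N z z') (halfPlane s 0) := by
  have h := differentiableOn_integral_inv_sub N measurable_snd
    (u := fun p => (p.1 - z : ℂ)⁻¹) (by fun_prop) (fun p => norm_inv_sub_le hz p.1) s
  simpa only [stieltjes₂, mul_comm] using h

/-- The identity theorem on a convex domain that reaches far away from the real axis. -/
theorem eqOn_of_eq_far {f h : ℂ → ℂ} {W : Set ℂ} (hWo : IsOpen W) (hWc : Convex ℝ W)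
    (hf : DifferentiableOn ℂ f W) (hh : DifferentiableOn ℂ h W) {s : Bool} {R : ℝ}
    (hfar : ∃ z ∈ W, R < sgn s * z.im) (heq : ∀ z ∈ W, R < sgn s * z.im → f z = h z) :
    EqOn f h W := by
  obtain ⟨z₀, hz₀, hR⟩ := hfar
  refine AnalyticOnNhd.eqOn_of_preconnected_of_eventuallyEq (hf.analyticOnNhd hWo)
    (hh.analyticOnNhd hWo) hWc.isPreconnected hz₀ ?_
  filter_upwards [hWo.mem_nhds hz₀, (isOpen_halfPlane s R).mem_nhds hR] with z h1 h2
  exact heq z h1 h2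

variable {d : ℕ} {r C : ℝ} {g : ℂ → ℂ} {lam : ℝ} {γ w : ℝ → ℂ}

/-- The walk series along a deformed contour is an analytic function of `(z, z')` where both stay
away from the contour, and it continues the Stieltjes transform. -/
theorem walkSeries_continuation₂ (hr : 0 < r) (hg : IsSiteDensity r g)
    (hd : IsDeformation r g C γ w) (hC : 1 ≤ C) (hlam : 2 * d * |lam| < 1) {α : Step d → ℂ}
    {A A' : Hilb d →L[ℂ] Hilb d} (hA : IsNeighborSum α A) {N : Measure (ℝ × ℝ)} [IsFiniteMeasure N]
    (hN : ∀ f f' : C₀(ℝ, ℂ), pairTrace g lam A A' f f' = ∫ p, f p.1 * f' p.2 ∂N)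
    {δ : ℝ} (hδ : 0 < δ) (hlamδ : 2 * d * |lam| * C < δ) {Z Z' : Set ℂ} (hZo : IsOpen Z)
    (hZc : Convex ℝ Z) (hZ : ∀ z ∈ Z, ∀ t, δ ≤ ‖γ t - z‖) (hZo' : IsOpen Z') (hZc' : Convex ℝ Z')
    (hZ' : ∀ z ∈ Z', ∀ t, δ ≤ ‖γ t - z‖) {s s' : Bool}
    (hfar : ∃ z ∈ Z, r + 1 < sgn s * z.im) (hfar' : ∃ z ∈ Z', r + 1 < sgn s' * z.im) {p : ℂ × ℂ}
    (hp : p ∈ Z ×ˢ Z') :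
    ∃ G : ℂ × ℂ → ℂ, AnalyticAt ℂ G p ∧ ∀ᶠ q in 𝓝 p, 0 < sgn s * q.1.im → 0 < sgn s' * q.2.im →
        stieltjes₂ N q.1 q.2 = G q := by
  let J := walkSeries γ w (pairCoeff lam α (A' (basisVec 0))) (fun q => path 0 q.1)
    fun q => path (secondStart q) q.2.2
  have hx1 : 2 * d * |lam| * (C * δ⁻¹) < 1 := by
    rw [← mul_assoc, ← div_eq_mul_inv, div_lt_one hδ]
    exact hlamδ
  have hs := summable_pairCoeff α (A' (basisVec 0)) (by positivity) hx1
  have hleft : ∀ z' ∈ Z', DifferentiableOn ℂ (fun z => J z z') Z := fun z' hz' =>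
    differentiableOn_walkSeries_left hd.measurable hd.integrable hd.bound hC hδ hs hZo hZ (hZ' z' hz')
  have hright : ∀ z ∈ Z, DifferentiableOn ℂ (fun z' => J z z') Z' := fun z hz =>
    differentiableOn_walkSeries_right hd.measurable hd.integrable hd.bound hC hδ hs hZo' hZ' (hZ z hz)
  have hr1 : 0 < r + 1 := by linarith
  have hfarW : ∀ {Z : Set ℂ} {s : Bool}, (∃ z ∈ Z, r + 1 < sgn s * z.im) →
      ∃ z ∈ Z ∩ halfPlane s 0, r + 1 < sgn s * z.im := fun ⟨z, h1, h2⟩ =>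
    ⟨z, ⟨h1, hr1.trans h2⟩, h2⟩
  have habs : ∀ {s : Bool} {z : ℂ}, r + 1 < sgn s * z.im → r + 1 ≤ |z.im| := fun {s z} h => by
    rw [← abs_sgn_mul s]
    exact h.le.trans (le_abs_self _)
  -- The walk expansion holds far from the real axis; the identity theorem extends the equality to
  -- the half-planes, in one variable after the other.
  have h1 : ∀ z ∈ Z ∩ halfPlane s 0, ∀ z' ∈ Z' ∩ halfPlane s' 0, r + 1 < sgn s' * z'.im →
      stieltjes₂ N z z' = J z z' := by
    intro z hz z' hz' hzR'
    exact eqOn_of_eq_far (hZo.inter (isOpen_halfPlane s 0)) (hZc.inter (convex_halfPlane s 0))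
      ((differentiableOn_stieltjes₂_left N s (im_ne_zero_of_mem_halfPlane hz'.2)).mono
        inter_subset_right) ((hleft z' hz'.1).mono inter_subset_left) (hfarW hfar)
      (fun z _ hzR => stieltjes₂_eq_walkSeries hr hg hd hlam hA hN (habs hzR) (habs hzR')) hz
  have h2 : ∀ z ∈ Z ∩ halfPlane s 0, ∀ z' ∈ Z' ∩ halfPlane s' 0, stieltjes₂ N z z' = J z z' := by
    intro z hz z' hz'
    exact eqOn_of_eq_far (hZo'.inter (isOpen_halfPlane s' 0)) (hZc'.inter (convex_halfPlane s' 0))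
      ((differentiableOn_stieltjes₂_right N s' (im_ne_zero_of_mem_halfPlane hz.2)).mono
        inter_subset_right) ((hright z hz.1).mono inter_subset_left) (hfarW hfar')
      (fun z' hz' hzR' => h1 z hz z' hz' hzR') hz'
  refine ⟨fun q => J q.1 q.2, analyticAt_of_separately hZo hZo' (continuousOn_walkSeries
    hd.measurable hd.integrable hd.bound hC hδ hs hZ hZ') hleft hright hp, ?_⟩
  filter_upwards [(hZo.prod hZo').mem_nhds hp] with q hq h3 h4
  exact h2 q.1 ⟨hq.1, h3⟩ q.2 ⟨hq.2, h4⟩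

/-- The part of a half-plane to the left of the abscissa `x`. -/
def leftQuadrant (s : Bool) (a x : ℝ) : Set ℂ := {z | z.re < x} ∩ halfPlane s a

/-- The part of a half-plane to the right of the abscissa `x`. -/
def rightQuadrant (s : Bool) (a x : ℝ) : Set ℂ := {z | x < z.re} ∩ halfPlane s a

theorem le_norm_sub_of_halfPlane {s : Bool} {δ : ℝ} {z v : ℂ} (hz : z ∈ halfPlane s (-δ))
    (hv : v.im = -(2 * δ) * sgn s) : δ ≤ ‖v - z‖ := by
  have h1 : -δ < sgn s * z.im := hz
  have h2 := abs_im_le_norm (v - z)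
  rw [← abs_sgn_mul s, sub_im, hv] at h2
  have h3 : sgn s * (-(2 * δ) * sgn s - z.im) = -(2 * δ + sgn s * z.im) := by
    linear_combination -(2 * δ) * sgn_mul_sgn s
  rw [h3, abs_neg] at h2
  linarith [le_abs_self (2 * δ + sgn s * z.im)]

theorem le_norm_stepContour_sub_left {s : Bool} {M δ b : ℝ} {z : ℂ}
    (hz : z ∈ leftQuadrant s (-δ) (M - δ)) (t : ℝ) :
    δ ≤ ‖stepContour M (-(2 * δ) * sgn s) b t - z‖ := by
  have h1 : z.re < M - δ := hz.1
  by_cases ht : t ≤ M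
  · exact le_norm_sub_of_halfPlane hz.2 (by simp [stepContour, ht])
  · have h2 : M ≤ (stepContour M (-(2 * δ) * sgn s) b t).re := by
      by_cases ht' : t ≤ M + 1
      · simp [stepContour, ht, ht']
      · simp [stepContour, ht, ht']
        linarith
    have h3 := (le_abs_self _).trans (abs_re_le_norm (stepContour M (-(2 * δ) * sgn s) b t - z))
    rw [sub_re] at h3
    linarith

theorem le_norm_stepContour_sub_right {s : Bool} {M δ a : ℝ} {z : ℂ}
    (hz : z ∈ rightQuadrant s (-δ) (M + δ)) (t : ℝ) :
    δ ≤ ‖stepContour M a (-(2 * δ) * sgn s) t - z‖ := by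
  have h1 : M + δ < z.re := hz.1
  by_cases ht : t ≤ M + 1
  · have h2 : (stepContour M a (-(2 * δ) * sgn s) t).re ≤ M := by
      by_cases ht' : t ≤ M
      · simp [stepContour, ht']
      · simp [stepContour, ht, ht']
    have h3 := (neg_le_abs _).trans (abs_re_le_norm (stepContour M a (-(2 * δ) * sgn s) t - z))
    rw [sub_re] at h3
    linarith
  · exact le_norm_sub_of_halfPlane hz.2 (by
      have ht' : ¬ t ≤ M := fun h => ht (by linarith)
      simp [stepContour, ht, ht'])

theorem IsDeformation.mono {C' : ℝ} (hd : IsDeformation r g C γ w) (h : C ≤ C') :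
    IsDeformation r g C' γ w :=
  ⟨hd.measurable, hd.integrable, hd.bound.trans h, hd.repr⟩

/-- Near a pair of energies that are far from each other compared with `|λ|`, the contour of
integration in the potential can pass on the required side of each of the two energies, because it
can change sides half-way between them. -/
theorem exists_continuation_near {K B : ℝ} (hr : 0 < r) (hg : IsSiteDensity r g)
    (hK : StripL1 r g K) (hB0 : 0 ≤ B) (hB : ∀ z : ℂ, |z.im| ≤ r / 2 → ‖g z‖ ≤ B)
    (hlam : 2 * d * |lam| < 1) {α : Step d → ℂ}
    {A A' : Hilb d →L[ℂ] Hilb d} (hA : IsNeighborSum α A) {N : Measure (ℝ × ℝ)} [IsFiniteMeasure N]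
    (hN : ∀ f f' : C₀(ℝ, ℂ), pairTrace g lam A A' f f' = ∫ p, f p.1 * f' p.2 ∂N)
    {δ : ℝ} (hδ : 0 < δ) (hδr : 4 * δ < r) (hlamδ : 2 * d * |lam| * max 1 (2 * K + r * B) < δ)
    {p : ℝ × ℝ} (hp : 2 * δ < |p.1 - p.2|) (s s' : Bool) :
    ∃ G : ℂ × ℂ → ℂ, AnalyticAt ℂ G (p.1, p.2) ∧
      ∀ᶠ q in 𝓝 ((p.1, p.2) : ℂ × ℂ), 0 < sgn s * q.1.im → 0 < sgn s' * q.2.im →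
        stieltjes₂ N q.1 q.2 = G q := by
  -- The contour crosses over at the midpoint of the energies, and runs at height `2 δ` on the side
  -- opposite to the one from which the spectral parameter comes.
  set M := (p.1 + p.2) / 2 with hM
  have hheight : ∀ s, |-(2 * δ) * sgn s| = 2 * δ := fun s => by
    rw [mul_comm, abs_sgn_mul, abs_neg, abs_of_pos (by linarith)]
  have hmem : ∀ s, -(2 * δ) * sgn s ∈ Ioo (-r) r := fun s => by
    have := abs_le.1 (hheight s).le
    constructor <;> linarith [this.1, this.2]
  have hdef : ∀ s s', IsDeformation r g (max 1 (2 * K + r * B))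
      (stepContour M (-(2 * δ) * sgn s) (-(2 * δ) * sgn s'))
      (stepWeight g M (-(2 * δ) * sgn s) (-(2 * δ) * sgn s')) := by
    intro s s'
    refine (hK.isDeformation hr (hmem s) (hmem s') M (B := B) fun _ y hy => hB _ ?_).mono ?_
    · have h1 := abs_le.1 (hheight s).le
      have h2 := abs_le.1 (hheight s').le
      simp only [add_im, ofReal_im, mul_im, ofReal_re, I_im, mul_one, I_re, mul_zero, add_zero,
        zero_add]
      rw [abs_le]
      rcases mem_uIcc.1 hy with h | h <;> constructor <;> linarith [h1.1, h1.2, h2.1, h2.2, h.1, h.2]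
    · refine le_trans ?_ (le_max_right _ _)
      have h3 : |-(2 * δ) * sgn s' - -(2 * δ) * sgn s| ≤ r := by
        refine (abs_sub _ _).trans ?_
        rw [hheight, hheight]
        linarith
      gcongr
  have hL : ∀ s, IsOpen (leftQuadrant s (-δ) (M - δ)) ∧ Convex ℝ (leftQuadrant s (-δ) (M - δ)) ∧
      ∃ z ∈ leftQuadrant s (-δ) (M - δ), r + 1 < sgn s * z.im := by
    intro s
    refine ⟨(isOpen_lt continuous_re continuous_const).inter (isOpen_halfPlane _ _),
      (convex_halfSpace_re_lt _).inter (convex_halfPlane _ _), ?_⟩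
    obtain ⟨z, h1, h2⟩ := exists_mem_halfPlane s (M - δ - 1) (r + 2)
    refine ⟨z, ⟨?_, ?_⟩, ?_⟩
    · change z.re < M - δ
      linarith
    · change -δ < sgn s * z.im
      linarith
    · linarith
  have hR : ∀ s, IsOpen (rightQuadrant s (-δ) (M + δ)) ∧ Convex ℝ (rightQuadrant s (-δ) (M + δ)) ∧
      ∃ z ∈ rightQuadrant s (-δ) (M + δ), r + 1 < sgn s * z.im := by
    intro s
    refine ⟨(isOpen_lt continuous_const continuous_re).inter (isOpen_halfPlane _ _),
      (convex_halfSpace_re_gt _).inter (convex_halfPlane _ _), ?_⟩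
    obtain ⟨z, h1, h2⟩ := exists_mem_halfPlane s (M + δ + 1) (r + 2)
    refine ⟨z, ⟨?_, ?_⟩, ?_⟩
    · change M + δ < z.re
      linarith
    · change -δ < sgn s * z.im
      linarith
    · linarith
  have hreal : ∀ (s : Bool) (E : ℝ), (E : ℂ) ∈ halfPlane s (-δ) := fun s E => by
    simpa [halfPlane] using hδ
  have hC1 := le_max_left 1 (2 * K + r * B)
  rcases lt_abs.1 hp with h | h
  · refine walkSeries_continuation₂ hr hg (hdef s' s) hC1 hlam hA hN hδ hlamδ (hR s).1 (hR s).2.1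
      (fun z hz => le_norm_stepContour_sub_right hz) (hL s').1 (hL s').2.1
      (fun z hz => le_norm_stepContour_sub_left hz) (hR s).2.2 (hL s').2.2
      ⟨⟨?_, hreal s _⟩, ?_, hreal s' _⟩
    · change M + δ < p.1
      linarith
    · change p.2 < M - δ
      linarith
  · refine walkSeries_continuation₂ hr hg (hdef s s') hC1 hlam hA hN hδ hlamδ (hL s).1 (hL s).2.1
      (fun z hz => le_norm_stepContour_sub_left hz) (hR s').1 (hR s').2.1
      (fun z hz => le_norm_stepContour_sub_right hz) (hL s).2.2 (hR s').2.2
      ⟨⟨?_, hreal s _⟩, ?_, hreal s' _⟩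
    · change p.1 < M - δ
      linarith
    · change M + δ < p.2
      linarith

/-! ### The density of states and the current-current correlation -/

theorem exists_densityOfStates {K ε : ℝ} (hr : 0 < r) (hg : IsSiteDensity r g)
    (hK : StripL1 r g K) (hε : 0 < ε) (hεr : ε < r) (hlam : 2 * d * |lam| < 1)
    (hlamε : 2 * d * |lam| * max 1 (2 * K) < ε / 2) :
    ∃ ρ : ℂ → ℂ, DifferentiableOn ℂ ρ (strip (r - ε)) ∧ (∀ E : ℝ, (ρ E).im = 0) ∧
      IsDensityOfStates d g lam fun E : ℝ => (ρ E).re := by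
  obtain ⟨N, hfin, hN, hids⟩ := exists_measure_traceP_funCalc (d := d) hg hlam
  -- the height of the contour, at distance `ε / 2` from the half-plane `± Im z > -(r - ε)`
  let a (s : Bool) : ℝ := -(r - ε / 2) * sgn s
  have ha : ∀ s, a s ∈ Ioo (-r) r := fun s => by
    cases s <;> simp only [a, sgn] <;> constructor <;> norm_num <;> linarith
  have hdef : ∀ s, IsDeformation r g (max 1 (2 * K)) (stepContour 0 (a s) (a s))
      (stepWeight g 0 (a s) (a s)) := fun s =>
    (hK.isDeformation hr (ha s) (ha s) 0 (B := 0) fun h => absurd rfl h).mono (by simp)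
  have hcim : ∀ s t, (stepContour 0 (a s) (a s) t).im = a s := by
    intro s t
    unfold stepContour
    split_ifs <;> simp
  have hdist : ∀ s, ∀ z ∈ halfPlane s (-(r - ε)), ∀ t,
      ε / 2 ≤ ‖stepContour 0 (a s) (a s) t - z‖ := by
    intro s z hz t
    have h1 : -(r - ε) < sgn s * z.im := hz
    have h2 := abs_im_le_norm (stepContour 0 (a s) (a s) t - z)
    rw [← abs_sgn_mul s, sub_im, hcim] at h2
    have h3 : sgn s * (a s - z.im) = -((r - ε / 2) + sgn s * z.im) := by
      linear_combination -(r - ε / 2) * sgn_mul_sgn s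
    rw [h3, abs_neg] at h2
    linarith [le_abs_self ((r - ε / 2) + sgn s * z.im)]
  let G (s : Bool) (z : ℂ) : ℂ := walkSeries (stepContour 0 (a s) (a s))
    (stepWeight g 0 (a s) (a s)) (loopCoeff (d := d) lam) (path 0) (fun _ => []) z z
  have hx1 : 2 * d * |lam| * (max 1 (2 * K) * (ε / 2)⁻¹) < 1 := by
    rw [← mul_assoc, ← div_eq_mul_inv, div_lt_one (by positivity)]
    exact hlamε
  have hs := summable_loopCoeff (d := d) (lam := lam)
    (mul_nonneg (zero_le_one.trans (le_max_left 1 (2 * K))) (by positivity)) hx1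
  have hGd : ∀ s, DifferentiableOn ℂ (G s) (halfPlane s (-(r - ε))) := by
    intro s
    have hconst : ∀ z z' z'' : ℂ, walkSeries (stepContour 0 (a s) (a s))
        (stepWeight g 0 (a s) (a s)) (loopCoeff (d := d) lam) (path 0) (fun _ => []) z z' =
        walkSeries (stepContour 0 (a s) (a s))
        (stepWeight g 0 (a s) (a s)) (loopCoeff (d := d) lam) (path 0) (fun _ => []) z z'' := by
      intro z z' z''
      simp [walkSeries, listIntegral, siteIntegral]
    -- the second variable does not occur, so it can be frozen at a point away from the contour
    obtain ⟨z₀, -, hz₀⟩ := exists_mem_halfPlane s 0 r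
    have hz₀' : z₀ ∈ halfPlane s (-(r - ε)) := by
      change -(r - ε) < sgn s * z₀.im
      linarith
    refine (differentiableOn_walkSeries_left (hdef s).measurable (hdef s).integrable (hdef s).bound
      (le_max_left _ _) (half_pos hε) hs (isOpen_halfPlane _ _) (hdist s)
      (hdist s z₀ hz₀')).congr fun z _ => hconst z z z₀
  have hGK : ∀ s, EqOn (stieltjes N) (G s) (halfPlane s 0) := by
    intro s
    refine eqOn_of_eq_far (isOpen_halfPlane s 0) (convex_halfPlane s 0)
      (differentiableOn_stieltjes N s) ((hGd s).mono fun z hz => ?_) (s := s) (R := r + 1) ?_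
      fun z _ hz => stieltjes_eq_walkSeries hr hg (hdef s) hlam hN ?_
    · change -(r - ε) < sgn s * z.im
      have : 0 < sgn s * z.im := hz
      linarith
    · obtain ⟨z, -, hz⟩ := exists_mem_halfPlane s 0 (r + 2)
      exact ⟨z, by change 0 < sgn s * z.im; linarith, by linarith⟩
    · rw [← abs_sgn_mul s]
      exact hz.le.trans (le_abs_self _)
  have hsub : ∀ s, strip (r - ε) ⊆ halfPlane s (-(r - ε)) := by
    intro s z hz
    have h1 : |z.im| < r - ε := hz
    rw [← abs_sgn_mul s] at h1
    exact (abs_lt.1 h1).1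
  obtain ⟨k, hkρ, hk0, hki, hkN⟩ := density_of_continuation N (a := r - ε) (by linarith) (G := G)
    (fun s => (hGd s).mono (hsub s)) fun s z _ hz => hGK s hz
  refine ⟨fun z => (2 * Real.pi * I)⁻¹ * ∑ s : Bool, sgn s * G s z, ?_, fun E => ?_, ?_⟩
  · exact (DifferentiableOn.fun_sum fun s _ =>
      ((hGd s).mono (hsub s)).const_mul _).const_mul _
  · beta_reduce
    rw [← hkρ E, ofReal_im]
  · simp only [← hkρ, ofReal_re]
    exact ⟨hki, hk0, fun E => (hids E).trans (hkN E)⟩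

theorem IsCurrentCorrelation.exists_analytic_density {K B : ℝ} (hr : 0 < r)
    (hg : IsSiteDensity r g) (hK : StripL1 r g K) (hB0 : 0 ≤ B)
    (hB : ∀ z : ℂ, |z.im| ≤ r / 2 → ‖g z‖ ≤ B) (hlam : 2 * d * |lam| < 1)
    (hlamr : 2 * d * |lam| * max 1 (2 * K + r * B) < r / 4) {a₂ : ℝ}
    (ha₂ : 4 * d * max 1 (2 * K + r * B) ≤ a₂) {m : Fin d → Fin d → ComplexMeasure (ℝ × ℝ)}
    (hm : IsCurrentCorrelation d g lam m) (ν ν' : Fin d) :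
    ∃ k : ℝ × ℝ → ℂ, AnalyticOnNhd ℝ k {p : ℝ × ℝ | a₂ * |lam| < |p.1 - p.2|} ∧
      HasDensityOn (m ν ν') {p : ℝ × ℝ | a₂ * |lam| < |p.1 - p.2|} k := by
  set U := {p : ℝ × ℝ | a₂ * |lam| < |p.1 - p.2|} with hU
  have hUo : IsOpen U := isOpen_lt continuous_const (by fun_prop)
  obtain ⟨μ, hfin, hμ, hpol⟩ := exists_polarMeasure (d := d) hg hlam
  have hdens : ∀ j, ∃ k : ℝ × ℝ → ℝ, AnalyticOnNhd ℝ k U ∧ IntegrableOn k U ∧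
      ∀ S, MeasurableSet S → S ⊆ U → (μ ν ν' j).real S = ∫ p in S, k p := by
    intro j
    obtain ⟨α, hα⟩ := isNeighborSum_polarVelocity lam ν ν' j
    refine Anderson.exists_analytic_density (μ ν ν' j) hUo fun p hp s s' => ?_
    have hp' : a₂ * |lam| < |p.1 - p.2| := hp
    have h1 : 4 * d * max 1 (2 * K + r * B) * |lam| ≤ a₂ * |lam| :=
      mul_le_mul_of_nonneg_right ha₂ (abs_nonneg _)
    have h0 : 0 ≤ 2 * d * |lam| * max 1 (2 * K + r * B) := by
      have := zero_le_one.trans (le_max_left 1 (2 * K + r * B))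
      positivity
    obtain ⟨δ, hδ1, hδ2⟩ := exists_between (show 2 * d * |lam| * max 1 (2 * K + r * B) <
      min (r / 4) (|p.1 - p.2| / 2) from lt_min hlamr (by linarith))
    exact exists_continuation_near hr hg hK hB0 hB hlam hα (hμ ν ν' j) (h0.trans_lt hδ1)
      (by linarith [hδ2.trans_le (min_le_left _ _)]) hδ1
      (by linarith [hδ2.trans_le (min_le_right _ _)]) s s'
  choose k hkan hki hkS using hdens
  have hcomb := hm.eq_combination (hpol ν ν')
  have hkc : ∀ j, IntegrableOn (fun p => polarCoeff j * (k j p : ℂ)) U := fun j =>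
    (hki j).ofReal.const_mul _
  refine ⟨fun p => ∑ j, polarCoeff j * k j p, fun p hp => ?_, ?_, fun S hS hSU => ?_⟩
  · exact Finset.analyticAt_fun_sum _ fun j _ =>
      analyticAt_const.mul ((ofRealCLM.analyticAt _).comp (hkan j p hp))
  · exact integrable_finsetSum _ fun j _ => hkc j
  · rw [hcomb, combination_apply _ _ hS, integral_finsetSum _ fun j _ => (hkc j).mono_set hSU]
    refine Finset.sum_congr rfl fun j _ => ?_
    rw [hkS j S hS hSU, integral_const_mul, integral_complex_ofReal]

end

end Anderson

end

theorem corollary1 (d : ℕ) (r : ℝ) (hr : 0 < r) (g : ℂ → ℂ) (hg : Anderson.IsSiteDensity r g) :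
    ∃ a₂ : ℝ, 0 < a₂ ∧ ∀ ε : ℝ, 0 < ε → ε < r → ∃ lam₀ : ℝ, 0 < lam₀ ∧
      ∀ lam : ℝ, |lam| < lam₀ →
        (∃ ρ : ℂ → ℂ, DifferentiableOn ℂ ρ (Anderson.strip (r - ε)) ∧
          (∀ E : ℝ, (ρ E).im = 0) ∧
          Anderson.IsDensityOfStates d g lam fun E : ℝ => (ρ E).re) ∧
        (∃ m, Anderson.IsCurrentCorrelation d g lam m) ∧
        ∀ m, Anderson.IsCurrentCorrelation d g lam m →
          ∀ ν ν' : Fin d, ∃ k : ℝ × ℝ → ℂ,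
            AnalyticOnNhd ℝ k {p : ℝ × ℝ | a₂ * |lam| < |p.1 - p.2|} ∧
            Anderson.HasDensityOn (m ν ν') {p : ℝ × ℝ | a₂ * |lam| < |p.1 - p.2|} k := by
  obtain ⟨K, hK⟩ := hg.stripL1
  obtain ⟨B, hB0, hB⟩ := hK.exists_bound hr
  have hC0 : 0 < max 1 (2 * K + r * B) := lt_max_of_lt_left one_pos
  have hC0' : 0 < max 1 (2 * K) := lt_max_of_lt_left one_pos
  -- a smallness condition `2 d |λ| c < b` holds for `|λ| < b / (2 d c + 1)`
  have hsmall : ∀ b c x : ℝ, 0 ≤ c → 0 ≤ x → x < b / (2 * d * c + 1) → 2 * d * x * c < b := by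
    intro b c x hc hx h
    have h1 : 0 < 2 * d * c + 1 := by positivity
    rw [lt_div_iff₀ h1] at h
    linarith
  -- the summand `1` makes the constant positive also for `d = 0`
  refine ⟨4 * d * max 1 (2 * K + r * B) + 1, by positivity, fun ε hε hεr =>
    ⟨min (1 / (2 * d * 1 + 1)) (min (r / 4 / (2 * d * max 1 (2 * K + r * B) + 1))
      (ε / 2 / (2 * d * max 1 (2 * K) + 1))), by positivity, fun lam hlam => ?_⟩⟩
  have h1 : 2 * d * |lam| < 1 := by
    simpa using hsmall 1 1 |lam| zero_le_one (abs_nonneg _) (hlam.trans_le (min_le_left _ _))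
  have h2 := hsmall (r / 4) _ |lam| hC0.le (abs_nonneg _)
    (hlam.trans_le ((min_le_right _ _).trans (min_le_left _ _)))
  have h3 := hsmall (ε / 2) _ |lam| hC0'.le (abs_nonneg _)
    (hlam.trans_le ((min_le_right _ _).trans (min_le_right _ _)))
  exact ⟨Anderson.exists_densityOfStates hr hg hK hε hεr h1 h3,
    Anderson.exists_isCurrentCorrelation hg h1, fun m hm ν ν' =>
      hm.exists_analytic_density hr hg hK hB0 hB h1 h2 (by linarith) ν ν'⟩
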